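/- For $\lambda\in\mathbb{R}$ and $0<\alpha\le 1$ let $L(\lambda,\alpha,s)=\sum_{n\ge 0}e^{2\pi i\lambda n}(n+\alpha)^{-s}$ be the Lerch zeta-function (the series converges for $\Re s>0$ if $\lambda\notin\mathbb{Z}$; for $\lambda\in\mathbb{Z}$ it converges for $\Re s>1$ and $L(\lambda,\alpha,s)$ is the analytically continued Hurwitz zeta-function $\zeta(s,\alpha)$). Write $\psi_z(w)=e^{i\Re(z\overline{w})}$ and $|dz|=(2\pi)^{-1}dx\,dy$. Let $S$ be the set of all $\alpha\in(0,1]$ such that (1) the numbers $\log(n+\alpha)$, $n\ge 0$, are linearly independent over $\mathbb{Q}$, and (2) there are constants $\Omega(\alpha)>0$ and $X(\alpha)$ such that for all $X\ge X(\alpha)$, all $N$, all integers $0\le n_1,\dots,n_N\le X$ and all $\epsilon_j\in\{1,-1\}$ with $\sum_{j}\epsilon_j\log(n_j+\alpha)\ne 0$ we have $\bigl|\sum_{j=1}^N\epsilon_j\log(n_j+\alpha)\bigr|\ge X^{-\Omega(\alpha)N^2}$. For $0<\alpha\le 1$ and $\sigma>1/2$ let $\phi_n$ be the uniform probability distribution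 on the circle $|z|=(n+\alpha)^{-\sigma}$. Then $\phi_0*\phi_1*\cdots*\phi_n$ converges weakly, as $n\to\infty$, to a probability measure which has a non-negative continuous density $M_\sigma(z;\alpha)$ with respect to $|dz|$, and the Fourier transform $\tilde M_\sigma(z;\alpha)=\int_{\mathbb{C}}M_\sigma(w;\alpha)\psi_z(w)\,|dw|$ satisfies \[\tilde M_\sigma(z;\alpha)=\prod_{n=0}^\infty J_0\bigl(|z|(n+\alpha)^{-\sigma}\bigr)\qquad(z\in\mathbb{C}),\] where $J_0$ is the Bessel function of order $0$. Theorem. Let $\lambda\in\mathbb{R}$, $\alpha\in S$, $\sigma_1>0$, and $\theta,\delta>0$ with $\theta+\delta<1/4$. Then there exists $T_0=T_0(\alpha,\theta,\delta)>0$ such that for all $T\ge T_0$, all $\sigma\in[1/2+(\log T)^{-\theta},\sigma_1]$ and all $z=x+iy$ with $|x|\le(\log T)^\delta$ and $|y|\le(\log T)^\delta$, \[\frac1T\int_0^T\psi_z\bigl(L(\lambda,\alpha,\sigma+it)\bigr)\,dt=\tilde M_\sigma(z;\alpha)+O\Bigl(\exp\bigl(-\tfrac12(\log T)^{\theta/2}\bigr)\Bigr),\]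 where the implied constant depends only on $\lambda$ and $\sigma_1$. -/

import Mathlib

open MeasureTheory Filter Topology

namespace LerchDensity

/-- The admissible set of parameters `α ∈ (0, 1]`: the numbers `log (n + α)` are linearly
independent over `ℚ`, and their nonzero signed sums of length `N` with `n ≤ X` are at least
`X ^ (-Ω N²)` in absolute value, for all `X` from some point on (uniformly in `N`). -/
structure Admissible (α : ℝ) : Prop where
  pos : 0 < α
  le_one : α ≤ 1
  independent : LinearIndependent ℚ (fun n : ℕ => Real.log ((n : ℝ) + α))
  spacing : ∃ Ω : ℝ, 0 < Ω ∧ ∃ X₀ : ℝ, ∀ X : ℝ, X₀ ≤ X →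
    ∀ (N : ℕ) (n : Fin N → ℕ) (ε : Fin N → ℝ),
      (∀ j, (n j : ℝ) ≤ X) → (∀ j, ε j = 1 ∨ ε j = -1) →
      ∑ j, ε j * Real.log ((n j : ℝ) + α) ≠ 0 →
      X ^ (-(Ω * (N : ℝ) ^ 2)) ≤ |∑ j, ε j * Real.log ((n j : ℝ) + α)|

open Classical in
/-- The Lerch zeta-function `L(lam, α, s)` for `0 < α ≤ 1`. If `lam` is an integer, it is the
(analytically continued) Hurwitz zeta-function `ζ(s, α)`. If `lam` is not an integer, it is the sum
`∑_{n ≥ 0} e^{2 π i lam n} (n + α)^{-s}`, the limit of the partial sums, which exists in the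
half-plane `Re s > 0`; the function is only used there. -/
noncomputable def lerchZeta (lam α : ℝ) (s : ℂ) : ℂ :=
  if ∃ k : ℤ, (k : ℝ) = lam then HurwitzZeta.hurwitzZeta (α : UnitAddCircle) s
  else limUnder atTop (fun N : ℕ => ∑ n ∈ Finset.range N,
    Complex.exp (2 * Real.pi * Complex.I * lam * n) / ((n : ℂ) + α) ^ s)

/-- The additive character `ψ_z(w) = exp(i Re(z w̄))`. -/
noncomputable def psi (z w : ℂ) : ℂ :=
  Complex.exp (Complex.I * ((z * (starRingEnd ℂ) w).re : ℂ))

/-- The Bessel function of the first kind of order zero. -/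
noncomputable def besselJ0 (x : ℝ) : ℝ :=
  ∑' k : ℕ, (-1 : ℝ) ^ k / ((k.factorial : ℝ) ^ 2) * (x / 2) ^ (2 * k)

/-- The equidistribution on the circle `|z| = r`: the law of `r e^{2 π i u}` with `u` uniform in
`(0, 1]`. -/
noncomputable def circleEquidistribution (r : ℝ) : ProbabilityMeasure ℂ :=
  ⟨(volume.restrict (Set.Ioc (0 : ℝ) 1)).map
      (fun u : ℝ => (r : ℂ) * Complex.exp (2 * Real.pi * Complex.I * u)), by
    have : IsProbabilityMeasure (volume.restrict (Set.Ioc (0 : ℝ) 1)) := ⟨by simp⟩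
    exact Measure.isProbabilityMeasure_map (by fun_prop)⟩

/-- The convolution `φ₀ ∗ φ₁ ∗ ⋯ ∗ φ_n`, where `φ_n` is the equidistribution on the circle
`|z| = (n + α)^{-σ}`. -/
noncomputable def partialConvolution (σ α : ℝ) : ℕ → ProbabilityMeasure ℂ
  | 0 => circleEquidistribution (α ^ (-σ))
  | n + 1 =>
    ⟨(partialConvolution σ α n : Measure ℂ) ∗
      (circleEquidistribution ((((n + 1 : ℕ) : ℝ) + α) ^ (-σ)) : Measure ℂ), inferInstance⟩

/-- The measure `|dz| = (2 π)⁻¹ dx dy` on the complex plane. -/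
noncomputable def planeMeasure : Measure ℂ :=
  ENNReal.ofReal (2 * Real.pi)⁻¹ • (volume : Measure ℂ)

/-- `M` is a nonnegative continuous density with respect to `|dz|` of the infinite convolution
`φ₀ ∗ φ₁ ∗ ⋯`, the weak limit of the partial convolutions. There is at most one such `M`. -/
def IsLimitDensity (σ α : ℝ) (M : ℂ → ℝ) : Prop :=
  Continuous M ∧ (∀ z, 0 ≤ M z) ∧
    ∃ φ : ProbabilityMeasure ℂ, Tendsto (partialConvolution σ α) atTop (𝓝 φ) ∧
      (φ : Measure ℂ) = planeMeasure.withDensity (fun z => ENNReal.ofReal (M z))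

open Classical in
/-- The density function `M_σ(z; α)`. -/
noncomputable def densityM (σ α : ℝ) : ℂ → ℝ :=
  if h : ∃ M : ℂ → ℝ, IsLimitDensity σ α M then h.choose else 0

/-- The Fourier transform `M̃_σ(z; α) = ∫ M_σ(w; α) ψ_z(w) |dw|`. -/
noncomputable def fourierM (σ α : ℝ) (z : ℂ) : ℂ :=
  ∫ w, (densityM σ α w : ℂ) * psi z w ∂planeMeasure

end LerchDensity

/-! Since the frequencies log(n+α) are linearly independent, the phases t log(n+α), 0 ≤ t ≤ T,
behave for large T like independent uniform phases. The average of ψ_z over a circle of radius r is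
J₀(|z|r), so the mean of ψ_z along a partial sum of the Lerch series should be near a product of
J₀'s. The work is to make this quantitative for a partial sum long enough to represent L.

Density. Each factor J₀(|z|(n+α)^(-σ)) is the characteristic function of φ_n. From |J₀(x) - 1| ≤
x²/2 and ∑ (n+α)^(-2σ) < ∞ the product converges and is continuous at 0, so Lévy's criterion gives
the weak limit (`exists_limit_partialConvolution`). The decay J₀(x) ≪ x^(-1/3) makes the product
integrable on the plane (`integrable_besselProduct`), and Fourier inversion produces the density
(`exists_continuous_density`).

Truncation. For M ≥ A·T, summation by parts shows that the partial sum of length M approximates L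
(`exists_norm_lerchZeta_sub_sum_le`). If λ is not an integer, this rests on the ratio of consecutive
terms staying away from 1; if it is, the integral of the tail is added first, and the limit is
identified with the Hurwitz zeta-function by the identity theorem. The block N ≤ n < M is small in
mean by a mean square estimate that saves N^(1/2-σ). As ψ_z is Lipschitz, L may be replaced by its
first N terms (`norm_mean_psi_lerchZeta_sub_le`).

Partial sum. Write ψ_z of the partial sum as exp(iS) and expand to order 2K. The moments of S are
combinations of exponentials e^(-itΛ), with Λ a signed sum of at most 2K logarithms. By linear
independence Λ = 0 exactly when the corresponding torus character is trivial, and the spacing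
condition makes every other time mean tiny. The Taylor remainder is a 2K-th moment, controlled by
the sub-Gaussian bound for the torus model (`norm_mean_cexp_sub_prod_le`).

Parameters. With x = log T, take N about exp(x^(3θ/2)) and K about x^(2δ+9θ/8). As σ - 1/2 ≥ x^(-θ),
N^(1/2-σ) ≤ exp(-x^(θ/2)); K exceeds the variance, of order x^(2δ+θ); and K² log N has order
x^(4δ+15θ/4), which is o(x) because θ + δ < 1/4. -/

namespace LerchDensity

/-! ### Circle averages and the Bessel function J₀ -/

/-- Orthogonality of the characters of the circle. -/
theorem integral_cexp_two_pi_int (k : ℤ) :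
    ∫ u in (0 : ℝ)..1, Complex.exp (2 * Real.pi * Complex.I * k * u) = if k = 0 then 1 else 0 := by
  split_ifs with h
  · simp [h]
  · have hk : (2 * Real.pi * Complex.I * k : ℂ) ≠ 0 := by
      simp [Real.pi_ne_zero, h]
    rw [integral_exp_mul_complex hk]
    have : Complex.exp (2 * Real.pi * Complex.I * k * (1 : ℝ)) = 1 := by
      rw [Complex.exp_eq_one_iff]
      exact ⟨k, by push_cast; ring⟩
    rw [this]; simp

theorem hasSum_cexp (z : ℂ) : HasSum (fun n : ℕ => z ^ n / (n.factorial : ℂ)) (Complex.exp z) := by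
  rw [Complex.exp_eq_exp_ℂ]
  exact NormedSpace.expSeries_div_hasSum_exp z

theorem summable_norm_pow_div_factorial (z : ℂ) :
    Summable fun n : ℕ => ‖z ^ n / (n.factorial : ℂ)‖ := by
  simpa using Real.summable_pow_div_factorial ‖z‖

theorem conj_cexp_two_pi (u : ℝ) : starRingEnd ℂ (Complex.exp (2 * Real.pi * Complex.I * u))
    = Complex.exp (-(2 * Real.pi * Complex.I * u)) := by
  rw [← Complex.exp_conj]
  simp only [map_mul, Complex.conj_ofReal, Complex.conj_I, Complex.conj_ofNat]
  congr 1; ring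

/-- The constant Fourier coefficient of `exp (a e(u) + b e(-u))`. -/
theorem hasSum_integral_cexp_circle (a b : ℂ) :
    HasSum (fun j : ℕ => (a * b) ^ j / ((j.factorial : ℂ) ^ 2))
      (∫ u in (0 : ℝ)..1, Complex.exp (a * Complex.exp (2 * Real.pi * Complex.I * u)
        + b * Complex.exp (-(2 * Real.pi * Complex.I * u)))) := by
  -- Multiply the two exponential series; the term (i, j) carries the character e((i - j)u), so only
  -- the diagonal survives integration.
  set F : ℕ × ℕ → ℝ → ℂ := fun p u =>
    (a ^ p.1 / (p.1.factorial : ℂ)) * (b ^ p.2 / (p.2.factorial : ℂ)) *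
      Complex.exp (2 * Real.pi * Complex.I * ((p.1 : ℤ) - (p.2 : ℤ) : ℤ) * u) with hF
  have hsum (u : ℝ) : ∑' p, F p u = Complex.exp (a * Complex.exp (2 * Real.pi * Complex.I * u)
        + b * Complex.exp (-(2 * Real.pi * Complex.I * u))) := by
    rw [Complex.exp_add, ← (hasSum_cexp _).tsum_eq, ← (hasSum_cexp (b * _)).tsum_eq,
      tsum_mul_tsum_of_summable_norm (summable_norm_pow_div_factorial _)
        (summable_norm_pow_div_factorial _)]
    refine tsum_congr fun p => ?_
    simp only [hF, mul_pow, ← Complex.exp_nat_mul]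
    have : Complex.exp (2 * Real.pi * Complex.I * (((p.1 : ℤ) - (p.2 : ℤ) : ℤ) : ℂ) * u)
        = Complex.exp (p.1 * (2 * Real.pi * Complex.I * u))
          * Complex.exp (p.2 * -(2 * Real.pi * Complex.I * u)) := by
      rw [← Complex.exp_add]; congr 1; push_cast; ring
    rw [this]; ring
  have hnorm (p : ℕ × ℕ) (u : ℝ) : ‖F p u‖
      = (‖a‖ ^ p.1 / p.1.factorial) * (‖b‖ ^ p.2 / p.2.factorial) := by
    have : 2 * Real.pi * Complex.I * (((p.1 : ℤ) - (p.2 : ℤ) : ℤ) : ℂ) * u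
      = ((2 * Real.pi * ((p.1 : ℤ) - (p.2 : ℤ) : ℤ) * u : ℝ) : ℂ) * Complex.I := by
      push_cast; ring
    simp only [hF, norm_mul, norm_div, norm_pow, Complex.norm_natCast]
    rw [this, Complex.norm_exp_ofReal_mul_I, mul_one]
  have hint (p : ℕ × ℕ) : IntervalIntegrable (F p) volume 0 1 :=
    Continuous.intervalIntegrable (by fun_prop) _ _
  have key := hasSum_integral_of_summable_integral_norm (μ := volume.restrict (Set.Ioc (0 : ℝ) 1))
    (F := F) (fun p => (intervalIntegrable_iff_integrableOn_Ioc_of_le zero_le_one).1 (hint p)) (by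
      simp_rw [hnorm]
      simpa using (Real.summable_pow_div_factorial ‖a‖).mul_of_nonneg
        (Real.summable_pow_div_factorial ‖b‖) (fun _ => by positivity) (fun _ => by positivity))
  simp_rw [hsum, ← intervalIntegral.integral_of_le (zero_le_one (α := ℝ))] at key
  have hcoef (p : ℕ × ℕ) : ∫ u in (0 : ℝ)..1, F p u = if p.1 = p.2 then
      (a ^ p.1 / (p.1.factorial : ℂ)) * (b ^ p.2 / (p.2.factorial : ℂ)) else 0 := by
    simp only [hF]
    rw [intervalIntegral.integral_const_mul, integral_cexp_two_pi_int]
    simp only [sub_eq_zero, Nat.cast_inj, mul_ite, mul_one, mul_zero]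
  simp_rw [hcoef] at key
  have hinj : Function.Injective (fun j : ℕ => (j, j)) := fun i j h => (Prod.mk.inj h).1
  rw [← hinj.hasSum_iff] at key
  · simpa [Function.comp_def, mul_pow, div_mul_div_comm, sq] using key
  · rintro ⟨i, j⟩ h
    have : i ≠ j := fun hij => h ⟨i, by simp [hij]⟩
    simp [this]

theorem psi_mul_circle (z c : ℂ) (u : ℝ) :
    psi z (c * Complex.exp (2 * Real.pi * Complex.I * u)) =
      Complex.exp ((Complex.I * (starRingEnd ℂ z * c) / 2) * Complex.exp (2 * Real.pi * Complex.I * u)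
        + (Complex.I * (z * starRingEnd ℂ c) / 2) *
          Complex.exp (-(2 * Real.pi * Complex.I * u))) := by
  unfold psi
  congr 1
  rw [Complex.re_eq_add_conj]
  simp only [map_mul, Complex.conj_conj]
  rw [conj_cexp_two_pi]
  ring

/-- The average of `ψ_z` over the circle of radius `‖c‖` is `J₀ (‖z‖ ‖c‖)`. -/
theorem integral_psi_circle (z c : ℂ) :
    ∫ u in (0 : ℝ)..1, psi z (c * Complex.exp (2 * Real.pi * Complex.I * u))
      = (besselJ0 (‖z‖ * ‖c‖) : ℂ) := by
  simp_rw [psi_mul_circle]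
  rw [← (hasSum_integral_cexp_circle _ _).tsum_eq, besselJ0, Complex.ofReal_tsum]
  refine tsum_congr fun k => ?_
  have : Complex.I * (starRingEnd ℂ z * c) / 2 * (Complex.I * (z * starRingEnd ℂ c) / 2)
      = -1 * ((‖z‖ * ‖c‖ / 2 : ℝ) : ℂ) ^ 2 := by
    have h1 := Complex.mul_conj' z
    have h2 := Complex.mul_conj' c
    push_cast
    linear_combination (1 / 4 : ℂ) * (z * starRingEnd ℂ z * (c * starRingEnd ℂ c)) * Complex.I_sq
      - (1 / 4 : ℂ) * (c * starRingEnd ℂ c) * h1 - (1 / 4 : ℂ) * ‖z‖ ^ 2 * h2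
  rw [this, mul_pow, ← pow_mul]
  push_cast
  ring

/-- The moment generating function of a uniformly distributed point on a circle is
sub-Gaussian. -/
theorem integral_exp_re_circle_le (w : ℂ) :
    ∫ u in (0 : ℝ)..1, Real.exp (w * Complex.exp (2 * Real.pi * Complex.I * u)).re
      ≤ Real.exp (‖w‖ ^ 2 / 4) := by
  have h := hasSum_integral_cexp_circle (w / 2) (starRingEnd ℂ w / 2)
  have hval : ∫ u in (0 : ℝ)..1, Complex.exp (w / 2 * Complex.exp (2 * Real.pi * Complex.I * u)
      + starRingEnd ℂ w / 2 * Complex.exp (-(2 * Real.pi * Complex.I * u)))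
      = ((∫ u in (0 : ℝ)..1, Real.exp (w * Complex.exp (2 * Real.pi * Complex.I * u)).re : ℝ)
        : ℂ) := by
    rw [← intervalIntegral.integral_ofReal]
    refine intervalIntegral.integral_congr fun u _ => ?_
    simp only [Complex.ofReal_exp]
    congr 1
    rw [Complex.re_eq_add_conj, map_mul, conj_cexp_two_pi]
    ring
  rw [hval] at h
  have hab : w / 2 * (starRingEnd ℂ w / 2) = ((‖w‖ ^ 2 / 4 : ℝ) : ℂ) := by
    have := Complex.mul_conj' w
    push_cast; linear_combination this / 4
  rw [hab] at h
  have h' : HasSum (fun j : ℕ => (‖w‖ ^ 2 / 4) ^ j / ((j.factorial : ℝ) ^ 2))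
      (∫ u in (0 : ℝ)..1, Real.exp (w * Complex.exp (2 * Real.pi * Complex.I * u)).re) := by
    rw [← Complex.hasSum_ofReal]
    convert h using 2 with j
    push_cast; ring
  have hexp : HasSum (fun j : ℕ => (‖w‖ ^ 2 / 4) ^ j / (j.factorial : ℝ))
      (Real.exp (‖w‖ ^ 2 / 4)) := by
    rw [Real.exp_eq_exp_ℝ]
    exact NormedSpace.expSeries_div_hasSum_exp _
  -- The left series has (j!)² where the exponential series has j!.
  refine hasSum_le (fun j => ?_) h' hexp
  have : (1 : ℝ) ≤ j.factorial := by exact_mod_cast j.factorial_pos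
  gcongr
  nlinarith

theorem besselJ0_abs (x : ℝ) : besselJ0 |x| = besselJ0 x := by
  unfold besselJ0
  refine tsum_congr fun k => ?_
  simp only [pow_mul, div_pow, sq_abs]

/-- Real part of `integral_psi_circle` with z = x and c = 1. The bounds for J₀ that follow are all
read off this integral. -/
theorem besselJ0_eq_integral_cos (x : ℝ) :
    besselJ0 x = ∫ u in (0 : ℝ)..1, Real.cos (x * Real.cos (2 * Real.pi * u)) := by
  have h := integral_psi_circle x 1
  rw [norm_one, mul_one, Complex.norm_real, Real.norm_eq_abs, besselJ0_abs] at h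
  have h2 : ∀ u : ℝ, psi x (1 * Complex.exp (2 * Real.pi * Complex.I * u))
      = Complex.exp ((x * Real.cos (2 * Real.pi * u) : ℝ) * Complex.I) := by
    intro u
    unfold psi
    have : (Complex.exp (2 * Real.pi * Complex.I * u)).re = Real.cos (2 * Real.pi * u) := by
      rw [show (2 * Real.pi * Complex.I * u : ℂ) = ((2 * Real.pi * u : ℝ) : ℂ) * Complex.I by
        push_cast; ring, Complex.exp_ofReal_mul_I_re]
    rw [one_mul, Complex.re_ofReal_mul, Complex.conj_re, this, mul_comm]
  simp_rw [h2] at h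
  have h3 : ∫ u in (0 : ℝ)..1, Complex.reCLM
      (Complex.exp ((x * Real.cos (2 * Real.pi * u) : ℝ) * Complex.I)) = besselJ0 x := by
    rw [ContinuousLinearMap.intervalIntegral_comp_comm, h]
    · simp
    · exact Continuous.intervalIntegrable (by fun_prop) _ _
  rw [← h3]
  refine intervalIntegral.integral_congr fun u _ => ?_
  simp only [Complex.reCLM_apply, Complex.exp_ofReal_mul_I_re]

theorem abs_besselJ0_le_one (x : ℝ) : |besselJ0 x| ≤ 1 := by
  rw [besselJ0_eq_integral_cos]
  have := intervalIntegral.norm_integral_le_of_norm_le_const (a := 0) (b := 1) (C := 1)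
    (f := fun u : ℝ => Real.cos (x * Real.cos (2 * Real.pi * u)))
    (fun u _ => Real.abs_cos_le_one _)
  simpa using this

theorem abs_besselJ0_sub_one_le (x : ℝ) : |besselJ0 x - 1| ≤ x ^ 2 / 2 := by
  have h : besselJ0 x - 1
      = ∫ u in (0 : ℝ)..1, (Real.cos (x * Real.cos (2 * Real.pi * u)) - 1) := by
    rw [intervalIntegral.integral_sub (Continuous.intervalIntegrable (by fun_prop) _ _) (by simp),
      besselJ0_eq_integral_cos]
    simp
  rw [h]
  have := intervalIntegral.norm_integral_le_of_norm_le_const (a := 0) (b := 1) (C := x ^ 2 / 2)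
    (f := fun u : ℝ => Real.cos (x * Real.cos (2 * Real.pi * u)) - 1)
    (fun u _ => by
      set y := x * Real.cos (2 * Real.pi * u) with hy
      have h1 := Real.one_sub_sq_div_two_le_cos (x := y)
      have h2 := Real.cos_le_one y
      have h3 : y ^ 2 ≤ x ^ 2 := by
        rw [hy, mul_pow]
        exact mul_le_of_le_one_right (sq_nonneg _) (Real.cos_sq_le_one _)
      rw [Real.norm_eq_abs, abs_le]
      constructor <;> linarith)
  simpa using this

/-- A nonstationary-phase estimate for the integrand of `J₀`. -/
theorem abs_integral_cos_mul_cos_le {a b x s : ℝ} (hab : a ≤ b) (hb : b ≤ a + 1) (hx : 0 < x)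
    (hs : 0 < s) (hs1 : s ≤ 1) (hsin : ∀ u ∈ Set.Icc a b, s ≤ |Real.sin (2 * Real.pi * u)|) :
    |∫ u in a..b, Real.cos (x * Real.cos (2 * Real.pi * u))| ≤ 2 / (x * s ^ 2) := by
  have hpi := Real.pi_gt_three
  have hne : ∀ u ∈ Set.Icc a b, Real.sin (2 * Real.pi * u) ≠ 0 := fun u hu h0 => by
    have := hsin u hu; rw [h0, abs_zero] at this; linarith
  -- Integrate by parts with V = sin(x cos 2πu) and U = -(2πx sin 2πu)⁻¹, whose product U·V' is the
  -- integrand. Each boundary term costs at most 1/(2xs²), the remaining integral 1/(xs²).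
  have hU : ∀ u ∈ Set.uIcc a b, HasDerivAt
      (fun u => -(2 * Real.pi * x)⁻¹ * (Real.sin (2 * Real.pi * u))⁻¹)
      (Real.cos (2 * Real.pi * u) / (x * Real.sin (2 * Real.pi * u) ^ 2)) u := by
    intro u hu
    rw [Set.uIcc_of_le hab] at hu
    have h1 : HasDerivAt (fun u : ℝ => 2 * Real.pi * u) (2 * Real.pi) u := by
      simpa using (hasDerivAt_id u).const_mul (2 * Real.pi)
    have := ((h1.sin.inv (hne u hu)).const_mul (-(2 * Real.pi * x)⁻¹))
    refine HasDerivAt.congr_deriv this ?_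
    have := hne u hu
    field_simp
  have hV : ∀ u ∈ Set.uIcc a b, HasDerivAt
      (fun u => Real.sin (x * Real.cos (2 * Real.pi * u)))
      (Real.cos (x * Real.cos (2 * Real.pi * u)) * (x * (-Real.sin (2 * Real.pi * u) * (2 * Real.pi)))) u := by
    intro u hu
    have h1 : HasDerivAt (fun u : ℝ => 2 * Real.pi * u) (2 * Real.pi) u := by
      simpa using (hasDerivAt_id u).const_mul (2 * Real.pi)
    exact (h1.cos.const_mul x).sin
  have hU' : ContinuousOn (fun u => Real.cos (2 * Real.pi * u) / (x * Real.sin (2 * Real.pi * u) ^ 2))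
      (Set.uIcc a b) := by
    rw [Set.uIcc_of_le hab]
    refine ContinuousOn.div (by fun_prop) (by fun_prop) fun u hu => ?_
    have := hne u hu
    positivity
  have hparts := intervalIntegral.integral_mul_deriv_eq_deriv_mul hU hV
    hU'.intervalIntegrable (Continuous.intervalIntegrable (by fun_prop) _ _)
  have hcongr : ∫ u in a..b, Real.cos (x * Real.cos (2 * Real.pi * u)) =
      ∫ u in a..b, -(2 * Real.pi * x)⁻¹ * (Real.sin (2 * Real.pi * u))⁻¹ *
        (Real.cos (x * Real.cos (2 * Real.pi * u)) * (x * (-Real.sin (2 * Real.pi * u) * (2 * Real.pi)))) := by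
    refine intervalIntegral.integral_congr fun u hu => ?_
    rw [Set.uIcc_of_le hab] at hu
    have := hne u hu
    field_simp
  rw [hcongr, hparts]
  have hbd : ∀ u ∈ Set.Icc a b, |-(2 * Real.pi * x)⁻¹ * (Real.sin (2 * Real.pi * u))⁻¹ *
      Real.sin (x * Real.cos (2 * Real.pi * u))| ≤ 1 / (2 * (x * s ^ 2)) := by
    intro u hu
    have h1 := hsin u hu
    have h2 : |Real.sin (x * Real.cos (2 * Real.pi * u))| ≤ 1 := Real.abs_sin_le_one _
    rw [abs_mul, abs_mul, abs_neg, abs_inv, abs_inv, abs_of_pos (by positivity : 0 < 2 * Real.pi * x)]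
    have h3 : 2 * x ≤ 2 * Real.pi * x := by nlinarith
    calc _ ≤ (2 * x)⁻¹ * s⁻¹ * 1 := by gcongr
      _ ≤ 1 / (2 * (x * s ^ 2)) := by
        rw [mul_one, ← mul_inv, one_div]
        refine inv_anti₀ (by positivity) ?_
        have : s ^ 2 ≤ s := by nlinarith
        nlinarith
  have hI : |∫ u in a..b, Real.cos (2 * Real.pi * u) / (x * Real.sin (2 * Real.pi * u) ^ 2) *
      Real.sin (x * Real.cos (2 * Real.pi * u))| ≤ 1 / (x * s ^ 2) := by
    have := intervalIntegral.norm_integral_le_of_norm_le_const (a := a) (b := b)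
      (C := 1 / (x * s ^ 2))
      (f := fun u => Real.cos (2 * Real.pi * u) / (x * Real.sin (2 * Real.pi * u) ^ 2) *
        Real.sin (x * Real.cos (2 * Real.pi * u))) (fun u hu => by
        rw [Set.uIoc_of_le hab] at hu
        have h1 := hsin u (Set.Ioc_subset_Icc_self hu)
        have h2 : |Real.sin (x * Real.cos (2 * Real.pi * u))| ≤ 1 := Real.abs_sin_le_one _
        have h3 : |Real.cos (2 * Real.pi * u)| ≤ 1 := Real.abs_cos_le_one _
        rw [Real.norm_eq_abs, abs_mul, abs_div, abs_mul, abs_of_pos hx, abs_pow]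
        calc _ ≤ 1 / (x * s ^ 2) * 1 := by gcongr
          _ = _ := mul_one _)
    rw [Real.norm_eq_abs] at this
    refine this.trans (mul_le_of_le_one_right (by positivity) ?_)
    rw [abs_of_nonneg (by linarith)]; linarith
  have ha := hbd a ⟨le_rfl, hab⟩
  have hb := hbd b ⟨hab, le_rfl⟩
  calc _ ≤ 1 / (2 * (x * s ^ 2)) + 1 / (2 * (x * s ^ 2)) + 1 / (x * s ^ 2) := by
        refine (abs_sub _ _).trans (add_le_add ((abs_sub _ _).trans (add_le_add hb ha)) hI)
    _ = 2 / (x * s ^ 2) := by field_simp; norm_num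

/-- Let y = x^(-1/3). The intervals within y/8 of the stationary points 0, 1/2, 1 have total length
y/2 and are bounded trivially; elsewhere |sin 2πu| ≥ y/2, and each of the two long pieces
contributes at most 2/(x(y/2)²) = 8y. The exponent 1/3 balances the two and is not optimal; any
fixed power saving would serve. -/
theorem abs_besselJ0_le_rpow {x : ℝ} (hx : 0 < x) : |besselJ0 x| ≤ 17 * x ^ (-(1 / 3) : ℝ) := by
  rcases lt_or_ge x 1 with h1 | h1
  · have : (1 : ℝ) ≤ x ^ (-(1 / 3) : ℝ) := Real.one_le_rpow_of_pos_of_le_one_of_nonpos hx h1.le (by norm_num)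
    linarith [abs_besselJ0_le_one x]
  set y : ℝ := x ^ (-(1 / 3) : ℝ) with hy
  have hy0 : 0 < y := by positivity
  have hy1 : y ≤ 1 := Real.rpow_le_one_of_one_le_of_nonpos h1 (by norm_num)
  have hy3 : x * y ^ 3 = 1 := by
    rw [hy, ← Real.rpow_natCast, ← Real.rpow_mul hx.le]
    norm_num
    rw [Real.rpow_neg_one, mul_inv_cancel₀ hx.ne']
  have hpi := Real.pi_pos
  have hsin : ∀ u ∈ Set.Icc (y / 8) (1 / 2 - y / 8), y / 2 ≤ Real.sin (2 * Real.pi * u) := by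
    intro u hu
    rcases le_total u (1 / 4) with h | h
    · have := Real.mul_le_sin (x := 2 * Real.pi * u) (by nlinarith [hu.1]) (by nlinarith)
      refine le_trans ?_ this
      field_simp; linarith [hu.1]
    · have := Real.mul_le_sin (x := Real.pi - 2 * Real.pi * u) (by nlinarith [hu.2]) (by nlinarith)
      rw [Real.sin_pi_sub] at this
      refine le_trans ?_ this
      field_simp; linarith [hu.2]
  set f : ℝ → ℝ := fun u => Real.cos (x * Real.cos (2 * Real.pi * u)) with hf
  have hint (a b : ℝ) : IntervalIntegrable f volume a b :=
    Continuous.intervalIntegrable (by fun_prop) _ _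
  have hshort (a b : ℝ) (hab : a ≤ b) : |∫ u in a..b, f u| ≤ b - a := by
    have := intervalIntegral.norm_integral_le_of_norm_le_const (a := a) (b := b) (C := 1)
      (f := f) (fun u _ => Real.abs_cos_le_one _)
    rwa [one_mul, abs_of_nonneg (by linarith)] at this
  have e : besselJ0 x = (∫ u in 0..(y / 8), f u) + (∫ u in (y / 8)..(1 / 2 - y / 8), f u)
      + (∫ u in (1 / 2 - y / 8)..(1 / 2 + y / 8), f u)
      + (∫ u in (1 / 2 + y / 8)..(1 - y / 8), f u) + (∫ u in (1 - y / 8)..1, f u) := by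
    rw [besselJ0_eq_integral_cos]
    simp only [intervalIntegral.integral_add_adjacent_intervals (hint _ _) (hint _ _)]
    rfl
  have b1 := hshort 0 (y / 8) (by linarith)
  have b3 := hshort (1 / 2 - y / 8) (1 / 2 + y / 8) (by linarith)
  have b5 := hshort (1 - y / 8) 1 (by linarith)
  have hval : 2 / (x * (y / 2) ^ 2) = 8 * y := by
    have : x * y ^ 2 * y = 1 := by linarith [hy3]
    field_simp
    linarith
  have hJ : |besselJ0 x| ≤ 17 * y := by
    have b2 := abs_integral_cos_mul_cos_le (a := y / 8) (b := 1 / 2 - y / 8) (x := x) (s := y / 2)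
      (by linarith) (by linarith) hx (by linarith) (by linarith)
      (fun u hu => (hsin u hu).trans (le_abs_self _))
    have b4 := abs_integral_cos_mul_cos_le (a := 1 / 2 + y / 8) (b := 1 - y / 8) (x := x)
      (s := y / 2) (by linarith) (by linarith) hx (by linarith) (by linarith)
      (fun u hu => by
        have := hsin (u - 1 / 2) ⟨by linarith [hu.1], by linarith [hu.2]⟩
        rw [show 2 * Real.pi * (u - 1 / 2) = 2 * Real.pi * u - Real.pi by ring,
          Real.sin_sub_pi] at this
        exact this.trans (neg_le_abs _))
    rw [hval] at b2 b4
    rw [e]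
    have t1 := abs_add_le ((∫ u in 0..(y / 8), f u) + (∫ u in (y / 8)..(1 / 2 - y / 8), f u)
      + (∫ u in (1 / 2 - y / 8)..(1 / 2 + y / 8), f u)
      + (∫ u in (1 / 2 + y / 8)..(1 - y / 8), f u)) (∫ u in (1 - y / 8)..1, f u)
    have t2 := abs_add_le ((∫ u in 0..(y / 8), f u) + (∫ u in (y / 8)..(1 / 2 - y / 8), f u)
      + (∫ u in (1 / 2 - y / 8)..(1 / 2 + y / 8), f u)) (∫ u in (1 / 2 + y / 8)..(1 - y / 8), f u)
    have t3 := abs_add_le ((∫ u in 0..(y / 8), f u) + (∫ u in (y / 8)..(1 / 2 - y / 8), f u))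
      (∫ u in (1 / 2 - y / 8)..(1 / 2 + y / 8), f u)
    have t4 := abs_add_le (∫ u in 0..(y / 8), f u) (∫ u in (y / 8)..(1 / 2 - y / 8), f u)
    linarith
  linarith


/-! ### Fourier inversion for measures with integrable characteristic function -/

section FourierInversion

open scoped FourierTransform ContDiff Manifold ComplexOrder

/-- The inverse Fourier transform of the characteristic function of a measure. -/
noncomputable def charDensity (μ : Measure ℂ) : ℂ → ℂ :=
  𝓕⁻ (fun ξ : ℂ => charFun μ ((-(2 * Real.pi) : ℝ) • ξ))

theorem integrable_charFun_dilation {μ : Measure ℂ} (h : Integrable (charFun μ)) :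
    Integrable (fun ξ : ℂ => charFun μ ((-(2 * Real.pi) : ℝ) • ξ)) :=
  h.comp_smul (by simp [Real.pi_ne_zero])

theorem continuous_neg_innerₗ : Continuous fun p : ℂ × ℂ => (-innerₗ ℂ) p.1 p.2 := by
  have : Continuous fun p : ℂ × ℂ => -inner ℝ p.1 p.2 := by fun_prop
  simpa only [LinearMap.neg_apply, innerₗ_apply_apply] using this

theorem continuous_charDensity {μ : Measure ℂ} (h : Integrable (charFun μ)) : Continuous (charDensity μ) :=
  VectorFourier.fourierIntegral_continuous Real.continuous_fourierChar
    (L := -innerₗ ℂ) continuous_neg_innerₗ (integrable_charFun_dilation h)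

section Density

variable {μ : Measure ℂ} [IsProbabilityMeasure μ]

/-- Parseval, by moving the Fourier transform across a pairing twice. As f is Schwartz, f = 𝓕(𝓕⁻ f),
so ∫ f dμ equals 𝓕⁻ f paired with the transform of μ; moving 𝓕⁻ to the other factor gives f paired
with `charDensity μ`. -/
theorem integral_eq_integral_charDensity (h : Integrable (charFun μ)) {f : ℂ → ℂ}
    (hf : HasCompactSupport f) (hf' : ContDiff ℝ ∞ f) :
    ∫ x, f x ∂μ = ∫ x, f x * charDensity μ x := by
  set S : SchwartzMap ℂ ℂ := hf.toSchwartzMap hf' with hS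
  have hSf : (S : ℂ → ℂ) = f := rfl
  have hA : (fun ξ : ℂ => charFun μ ((-(2 * Real.pi) : ℝ) • ξ))
      = VectorFourier.fourierIntegral 𝐞 μ (innerₗ ℂ) (1 : ℂ → ℂ) := by
    funext ξ
    rw [charFun_eq_fourierIntegral', smul_smul]
    congr 1
    have := Real.pi_ne_zero
    rw [show -(2 * Real.pi)⁻¹ * (-(2 * Real.pi)) = 1 by field_simp, one_smul]
  have hg : Integrable (𝓕⁻ S : SchwartzMap ℂ ℂ) := SchwartzMap.integrable _
  have h1 := VectorFourier.integral_fourierIntegral_smul_eq_flip (e := 𝐞) (μ := μ) (ν := volume)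
    (L := innerₗ ℂ) (f := (1 : ℂ → ℂ)) (g := (𝓕⁻ S : SchwartzMap ℂ ℂ)) Real.continuous_fourierChar
    (by simpa only [innerₗ_apply_apply] using (by fun_prop : Continuous fun p : ℂ × ℂ => inner ℝ p.1 p.2)) (integrable_const 1) hg
  rw [flip_innerₗ] at h1
  have h2 : VectorFourier.fourierIntegral 𝐞 volume (innerₗ ℂ) (𝓕⁻ S : SchwartzMap ℂ ℂ) = f := by
    have : 𝓕 (𝓕⁻ S) = S := FourierTransform.fourier_fourierInv_eq S
    rw [← hSf, ← this, SchwartzMap.fourier_coe]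
    rw [this]
    rfl
  have h3 := VectorFourier.integral_fourierIntegral_smul_eq_flip (e := 𝐞) (μ := volume)
    (ν := volume) (L := -innerₗ ℂ) (f := f)
    (g := (fun ξ : ℂ => charFun μ ((-(2 * Real.pi) : ℝ) • ξ))) Real.continuous_fourierChar
    continuous_neg_innerₗ (hSf ▸ SchwartzMap.integrable S)
    (integrable_charFun_dilation h)
  have hflip : (-innerₗ ℂ).flip = -innerₗ ℂ := by
    ext x y; simp [real_inner_comm]
  rw [hflip] at h3
  have h4 : ((𝓕⁻ S : SchwartzMap ℂ ℂ) : ℂ → ℂ)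
      = VectorFourier.fourierIntegral 𝐞 volume (-innerₗ ℂ) f := by
    rw [SchwartzMap.fourierInv_coe]; rfl
  rw [← hA, h2, h4] at h1
  simp only [Pi.one_apply, one_mul, smul_eq_mul] at h1 h3
  rw [← h1]
  simp_rw [mul_comm (charFun μ _)]
  rw [h3]
  rfl

/-- The inverse Fourier transform of an integrable characteristic function is nonnegative. -/
theorem charDensity_nonneg (h : Integrable (charFun μ)) (x : ℂ) :
    0 ≤ charDensity μ x := by
  have hclosed : IsClosed {w : ℂ | 0 ≤ w} := isClosed_Ici
  -- The value at x is the limit of convolutions with bumps shrinking to 0. By the duality formula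
  -- each convolution is the μ-integral of a nonnegative function.
  let φ : ℕ → ContDiffBump (0 : ℂ) := fun n =>
    ⟨1 / ((n : ℝ) + 1) / 2, 1 / ((n : ℝ) + 1), by positivity, by
      have : 0 < 1 / ((n : ℝ) + 1) := by positivity
      linarith⟩
  have hlim := ContDiffBump.convolution_tendsto_right_of_continuous (φ := φ) (l := atTop)
    (μ := (volume : Measure ℂ)) tendsto_one_div_add_atTop_nhds_zero_nat
    (continuous_charDensity h) x
  refine hclosed.mem_of_tendsto hlim (Eventually.of_forall fun n => ?_)
  rw [Set.mem_ofPred_eq, convolution_eq_swap]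
  set p : ℂ → ℝ := fun t => (φ n).normed volume (x - t) with hp
  have hpc : HasCompactSupport p := by
    have := ((φ n).hasCompactSupport_normed (μ := volume)).comp_homeomorph (Homeomorph.subLeft x)
    exact this
  have hps : ContDiff ℝ ∞ p := (φ n).contDiff_normed.comp (contDiff_const.sub contDiff_id)
  have hint := integral_eq_integral_charDensity h (f := fun t => (p t : ℂ))
    (hpc.comp_left (g := fun r : ℝ => (r : ℂ)) (by simp))
    (Complex.ofRealCLM.contDiff.comp hps)
  have hle : (0 : ℂ) ≤ ∫ t, (p t : ℂ) ∂μ := by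
    rw [integral_complex_ofReal]
    exact_mod_cast integral_nonneg fun t => (φ n).nonneg_normed _
  rw [hint] at hle
  convert hle using 2
  funext t
  simp [hp]

/-- Two measures with the same integrals of smooth compactly supported functions satisfy an
inequality on open sets. -/
theorem measure_open_le_of_integral_contDiff {μ ν : Measure ℂ} [μ.Regular]
    [IsFiniteMeasureOnCompacts ν]
    (h : ∀ f : ℂ → ℝ, HasCompactSupport f → ContDiff ℝ ∞ f → ∫ x, f x ∂μ = ∫ x, f x ∂ν)
    {U : Set ℂ} (hU : IsOpen U) : μ U ≤ ν U := by
  rw [hU.measure_eq_iSup_isCompact]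
  refine iSup_le fun K => iSup_le fun hKU => iSup_le fun hK => ?_
  obtain ⟨V, hVo, hKV, hVU, hVc⟩ := exists_open_between_and_isCompact_closure hK hU hKU
  obtain ⟨f, hf0, hf1, hf⟩ := exists_contMDiffMap_zero_one_of_isClosed 𝓘(ℝ, ℂ) (n := ⊤)
    hVo.isClosed_compl hK.isClosed (Set.disjoint_compl_left_iff_subset.2 hKV)
  have hfs : ContDiff ℝ ∞ (f : ℂ → ℝ) := f.contMDiff.contDiff
  have hfc : HasCompactSupport (f : ℂ → ℝ) := by
    refine HasCompactSupport.of_support_subset_isCompact hVc fun x hx => subset_closure ?_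
    by_contra hxV
    exact hx (hf0 hxV)
  have hi {ρ : Measure ℂ} [IsFiniteMeasureOnCompacts ρ] : Integrable (f : ℂ → ℝ) ρ :=
    hfs.continuous.integrable_of_hasCompactSupport hfc
  have hlin {ρ : Measure ℂ} [IsFiniteMeasureOnCompacts ρ] :
      ∫⁻ x, ENNReal.ofReal (f x) ∂ρ = ENNReal.ofReal (∫ x, f x ∂ρ) :=
    (ofReal_integral_eq_lintegral_ofReal hi (Eventually.of_forall fun x => (hf x).1)).symm
  calc μ K = ∫⁻ x, K.indicator 1 x ∂μ := (lintegral_indicator_one hK.measurableSet).symm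
    _ ≤ ∫⁻ x, ENNReal.ofReal (f x) ∂μ := by
      refine lintegral_mono fun x => ?_
      by_cases hx : x ∈ K
      · simp [hx, hf1 hx]
      · simp [hx]
    _ = ∫⁻ x, ENNReal.ofReal (f x) ∂ν := by rw [hlin (ρ := μ), hlin (ρ := ν), h f hfc hfs]
    _ ≤ ∫⁻ x, U.indicator 1 x ∂ν := by
      refine lintegral_mono fun x => ?_
      by_cases hx : x ∈ V
      · simpa [hVU (subset_closure hx)] using (hf x).2
      · simp [hf0 hx]
    _ = ν U := lintegral_indicator_one hU.measurableSet

theorem exists_continuous_density (h : Integrable (charFun μ)) :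
    ∃ M : ℂ → ℝ, Continuous M ∧ (∀ z, 0 ≤ M z) ∧
      μ = planeMeasure.withDensity (fun z => ENNReal.ofReal (M z)) := by
  set D : ℂ → ℝ := fun z => (charDensity μ z).re with hD
  have hDc : Continuous D := Complex.continuous_re.comp (continuous_charDensity h)
  have hD0 (z : ℂ) : 0 ≤ D z := (Complex.le_def.1 (charDensity_nonneg h z)).1
  have hDD (z : ℂ) : (D z : ℂ) = charDensity μ z := by
    have := (Complex.le_def.1 (charDensity_nonneg h z)).2
    apply Complex.ext <;> simp_all
  set ν : Measure ℂ := volume.withDensity (fun z => ENNReal.ofReal (D z)) with hν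
  have : IsLocallyFiniteMeasure ν :=
    IsLocallyFiniteMeasure.withDensity_ofReal hDc
  have hint : ∀ f : ℂ → ℝ, HasCompactSupport f → ContDiff ℝ ∞ f →
      ∫ x, f x ∂μ = ∫ x, f x ∂ν := by
    intro f hf hf'
    have h1 := integral_eq_integral_charDensity h (f := fun t => (f t : ℂ))
      (hf.comp_left (g := fun r : ℝ => (r : ℂ)) (by simp)) (Complex.ofRealCLM.contDiff.comp hf')
    simp_rw [← hDD, ← Complex.ofReal_mul, integral_complex_ofReal] at h1
    rw [Complex.ofReal_inj.1 h1, hν, integral_withDensity_eq_integral_toReal_smul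
      hDc.measurable.ennreal_ofReal (by simp)]
    refine integral_congr_ae (Eventually.of_forall fun x => ?_)
    simp [ENNReal.toReal_ofReal (hD0 x), mul_comm]
  have hopen : ∀ U : Set ℂ, IsOpen U → μ U = ν U := fun U hU =>
    le_antisymm (measure_open_le_of_integral_contDiff hint hU)
      (measure_open_le_of_integral_contDiff (fun f h1 h2 => (hint f h1 h2).symm) hU)
  have hμν : μ = ν := ext_of_generate_finite {U : Set ℂ | IsOpen U}
    (BorelSpace.measurable_eq) isPiSystem_isOpen (fun U hU => hopen U hU) (hopen _ isOpen_univ)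
  have hpi : 0 < 2 * Real.pi := by positivity
  -- The factor 2π compensates the normalisation (2π)⁻¹ dx dy of `planeMeasure`.
  refine ⟨fun z => 2 * Real.pi * D z, by fun_prop, fun z => mul_nonneg hpi.le (hD0 z), ?_⟩
  rw [hμν, hν, planeMeasure, withDensity_smul_measure,
    ← withDensity_smul _ (by fun_prop)]
  congr 1
  funext z
  simp only [Pi.smul_apply, smul_eq_mul]
  rw [← ENNReal.ofReal_mul (by positivity), ← mul_assoc, inv_mul_cancel₀ hpi.ne', one_mul]

end Density

end FourierInversion


/-! ### The infinite convolution and the infinite Bessel product -/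

/-- Re(z w̄) is the real inner product on ℂ, so the Fourier transforms in question are
characteristic functions. -/
theorem charFun_eq_integral_psi (μ : Measure ℂ) (z : ℂ) : charFun μ z = ∫ w, psi z w ∂μ := by
  rw [charFun_apply]
  refine integral_congr_ae (Eventually.of_forall fun w => ?_)
  simp only [psi, Complex.inner]
  rw [mul_comm, mul_comm z]

theorem continuous_psi (z : ℂ) : Continuous (psi z) := by
  unfold psi
  fun_prop

theorem charFun_circleEquidistribution {r : ℝ} (hr : 0 ≤ r) (z : ℂ) :
    charFun (circleEquidistribution r : Measure ℂ) z = (besselJ0 (‖z‖ * r) : ℂ) := by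
  rw [charFun_eq_integral_psi, circleEquidistribution, ProbabilityMeasure.coe_mk,
    integral_map (by fun_prop) (continuous_psi z).aestronglyMeasurable,
    ← intervalIntegral.integral_of_le zero_le_one, integral_psi_circle, Complex.norm_real,
    Real.norm_of_nonneg hr]

theorem charFun_partialConvolution {σ α : ℝ} (hα : 0 < α) (n : ℕ) (z : ℂ) :
    charFun (partialConvolution σ α n : Measure ℂ) z
      = ∏ k ∈ Finset.range (n + 1), (besselJ0 (‖z‖ * ((k : ℝ) + α) ^ (-σ)) : ℂ) := by
  induction n with
  | zero => simp [partialConvolution, charFun_circleEquidistribution (Real.rpow_nonneg hα.le _)]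
  | succ n ih =>
    rw [Finset.prod_range_succ, ← ih, partialConvolution, ProbabilityMeasure.coe_mk, charFun_conv,
      charFun_circleEquidistribution (by positivity)]

theorem sum_Ico_succ_rpow_le {p : ℝ} (hp : 0 < p) {N M : ℕ} (hN : 1 ≤ N) (hNM : N ≤ M) :
    ∑ n ∈ Finset.Ico N M, ((n + 1 : ℕ) : ℝ) ^ (-(1 + p)) ≤ (N : ℝ) ^ (-p) * (1 / p) := by
  have hN0 : (1 : ℝ) ≤ N := by exact_mod_cast hN
  have hM0 : (N : ℝ) ≤ M := by exact_mod_cast hNM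
  have hanti : AntitoneOn (fun x : ℝ => x ^ (-(1 + p))) (Set.Icc N M) := by
    intro x hx y hy hxy
    exact Real.rpow_le_rpow_of_nonpos (by linarith [hx.1]) hxy (by linarith)
  refine (AntitoneOn.sum_le_integral_Ico hNM hanti).trans ?_
  rw [integral_rpow (Or.inr ⟨by linarith, by
    rw [Set.uIcc_of_le hM0]
    exact fun hx => by linarith [hx.1]⟩)]
  rw [show -(1 + p) + 1 = -p by ring, div_neg, ← neg_div, neg_sub, mul_one_div]
  gcongr
  linarith [Real.rpow_nonneg (by linarith : (0 : ℝ) ≤ M) (-p)]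

/-- An explicit tail bound for the series `∑ (n + α)^(-2σ)`. -/
theorem sum_Ico_rpow_le {σ α : ℝ} (hα : 0 < α) (hσ : 1 / 2 < σ) {N : ℕ} (hN : 1 ≤ N) (M : ℕ) :
    ∑ n ∈ Finset.Ico N M, (((n : ℝ) + α) ^ (-σ)) ^ 2
      ≤ (N : ℝ) ^ (1 - 2 * σ) * (1 + 1 / (2 * σ - 1)) := by
  have hN0 : (1 : ℝ) ≤ N := by exact_mod_cast hN
  have hp : 0 < 2 * σ - 1 := by linarith
  rcases le_or_gt M N with h | h
  · rw [Finset.Ico_eq_empty_of_le h, Finset.sum_empty]; positivity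
  have h1 : ∀ n ∈ Finset.Ico N M, (((n : ℝ) + α) ^ (-σ)) ^ 2 ≤ (n : ℝ) ^ (-(2 * σ)) := by
    intro n hn
    have hn1 : (1 : ℝ) ≤ n := by exact_mod_cast hN.trans (Finset.mem_Ico.1 hn).1
    rw [← Real.rpow_natCast, ← Real.rpow_mul (by positivity),
      show -σ * ((2 : ℕ) : ℝ) = -(2 * σ) by push_cast; ring]
    exact Real.rpow_le_rpow_of_nonpos (by linarith) (by linarith) (by linarith)
  refine (Finset.sum_le_sum h1).trans ?_
  -- The integral comparison covers n ≥ N + 1 only; the term n = N is split off and accounts for the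
  -- 1 in the last factor.
  obtain ⟨k, rfl⟩ : ∃ k, M = N + k + 1 := ⟨M - (N + 1), by omega⟩
  rw [Finset.sum_eq_sum_Ico_succ_bot (by omega)]
  have h2 := sum_Ico_succ_rpow_le hp hN (Nat.le_add_right N k)
  rw [Finset.sum_Ico_add' (fun n : ℕ => (n : ℝ) ^ (-(1 + (2 * σ - 1)))) N (N + k) 1] at h2
  rw [show 1 + (2 * σ - 1) = 2 * σ by ring] at h2
  have h5 : (N : ℝ) ^ (-(2 * σ)) ≤ (N : ℝ) ^ (1 - 2 * σ) :=
    Real.rpow_le_rpow_of_exponent_le hN0 (by linarith)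
  rw [show -(2 * σ - 1) = 1 - 2 * σ by ring] at h2
  linarith

theorem summable_radius_sq {σ α : ℝ} (hα : 0 < α) (hσ : 1 / 2 < σ) :
    Summable fun n : ℕ => (((n : ℝ) + α) ^ (-σ)) ^ 2 := by
  rw [← summable_nat_add_iff 1]
  refine summable_of_sum_range_le (c := ((1 : ℕ) : ℝ) ^ (1 - 2 * σ) * (1 + 1 / (2 * σ - 1)))
    (fun n => sq_nonneg _) fun n => ?_
  have := sum_Ico_rpow_le hα hσ le_rfl (n + 1)
  rwa [Finset.range_eq_Ico, Finset.sum_Ico_add' (fun n : ℕ => (((n : ℝ) + α) ^ (-σ)) ^ 2) 0 n 1,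
    zero_add]

theorem norm_besselJ0_sub_one_le (z : ℂ) (r : ℝ) :
    ‖(besselJ0 (‖z‖ * r) : ℂ) - 1‖ ≤ ‖z‖ ^ 2 * r ^ 2 / 2 := by
  have := abs_besselJ0_sub_one_le (‖z‖ * r)
  rw [← Complex.ofReal_one, ← Complex.ofReal_sub, Complex.norm_real, ← mul_pow]
  exact this

theorem norm_besselJ0_le_one (x : ℝ) : ‖(besselJ0 x : ℂ)‖ ≤ 1 := by
  rw [Complex.norm_real]; exact abs_besselJ0_le_one x

/-- The infinite product of Bessel functions. -/
noncomputable def besselProduct (σ α : ℝ) (z : ℂ) : ℂ :=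
  ∏' n : ℕ, (besselJ0 (‖z‖ * ((n : ℝ) + α) ^ (-σ)) : ℂ)

section Product

variable {σ α : ℝ} (hα : 0 < α) (hσ : 1 / 2 < σ)
include hα hσ

theorem hasProd_besselProduct (z : ℂ) :
    HasProd (fun n : ℕ => (besselJ0 (‖z‖ * ((n : ℝ) + α) ^ (-σ)) : ℂ)) (besselProduct σ α z) := by
  have h := multipliable_one_add_of_summable
    (f := fun n : ℕ => (besselJ0 (‖z‖ * ((n : ℝ) + α) ^ (-σ)) : ℂ) - 1)
    (Summable.of_nonneg_of_le (fun n => norm_nonneg _) (fun n => norm_besselJ0_sub_one_le z _)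
      (((summable_radius_sq hα hσ).mul_left (‖z‖ ^ 2)).div_const 2))
  simp only [add_sub_cancel] at h
  exact h.hasProd

/-- Continuity at 0 is the hypothesis of Lévy's tightness criterion. It follows by dominated
convergence for products, with majorant r_n²/2 on the unit disc, where r_n = (n+α)^(-σ). -/
theorem continuousAt_besselProduct : ContinuousAt (besselProduct σ α) 0 := by
  have h := tendsto_tprod_one_add_of_dominated_convergence (𝓕 := 𝓝 (0 : ℂ))
    (f := fun (z : ℂ) (n : ℕ) => (besselJ0 (‖z‖ * ((n : ℝ) + α) ^ (-σ)) : ℂ) - 1)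
    (g := fun _ => (0 : ℂ)) ((summable_radius_sq hα hσ).div_const 2) (fun n => by
      refine squeeze_zero_norm (fun z => norm_besselJ0_sub_one_le z _) ?_
      have : Continuous fun z : ℂ => ‖z‖ ^ 2 * (((n : ℝ) + α) ^ (-σ)) ^ 2 / 2 := by fun_prop
      simpa using this.tendsto 0) (by
      filter_upwards [Metric.ball_mem_nhds (0 : ℂ) one_pos] with z hz n
      refine (norm_besselJ0_sub_one_le z _).trans ?_
      rw [mem_ball_zero_iff] at hz
      have : ‖z‖ ^ 2 ≤ 1 := pow_le_one₀ (norm_nonneg _) hz.le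
      have h2 := sq_nonneg (((n : ℝ) + α) ^ (-σ))
      nlinarith)
  simp only [add_sub_cancel, add_zero, tprod_one] at h
  have h0 : besselProduct σ α 0 = 1 := by
    have h1 : besselJ0 0 = 1 := by
      have := abs_besselJ0_sub_one_le 0
      rw [zero_pow two_ne_zero, zero_div] at this
      exact sub_eq_zero.1 (abs_nonpos_iff.1 this)
    simp [besselProduct, h1]
  rw [ContinuousAt, h0]
  exact h

theorem tendsto_charFun_partialConvolution (z : ℂ) :
    Tendsto (fun n => charFun (partialConvolution σ α n : Measure ℂ) z) atTop
      (𝓝 (besselProduct σ α z)) := by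
  simp_rw [charFun_partialConvolution hα]
  exact (hasProd_besselProduct hα hσ z).tendsto_prod_nat.comp (tendsto_add_atTop_nat 1)

/-- Lévy's continuity theorem: the characteristic functions converge to a function continuous at 0,
hence the laws are tight; by Prokhorov an ultrafilter on the indices has a limit law, its
characteristic function must be the Bessel product, and this forces convergence of the whole
sequence. -/
theorem exists_limit_partialConvolution : ∃ φ : ProbabilityMeasure ℂ,
    Tendsto (partialConvolution σ α) atTop (𝓝 φ) ∧
      ∀ z, charFun (φ : Measure ℂ) z = besselProduct σ α z := by
  have htight := isTightMeasureSet_of_tendsto_charFun (continuousAt_besselProduct hα hσ)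
    (tendsto_charFun_partialConvolution hα hσ)
  have hcomp := isCompact_closure_of_isTightMeasureSet
    (S := Set.range (partialConvolution σ α)) (by
      convert htight using 1
      ext μ; simp)
  obtain ⟨φ, -, hφ⟩ := hcomp.ultrafilter_le_nhds
    ((Ultrafilter.of atTop).map (partialConvolution σ α)) (by
      rw [le_principal_iff]
      exact Ultrafilter.mem_map.2 (univ_mem' fun n => subset_closure ⟨n, rfl⟩))
  have hchar (z : ℂ) : charFun (φ : Measure ℂ) z = besselProduct σ α z := by
    have h1 := (tendsto_charFun_partialConvolution hα hσ z).mono_left (Ultrafilter.of_le atTop)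
    have h2 : Tendsto (fun n => charFun (partialConvolution σ α n : Measure ℂ) z)
        (Ultrafilter.of atTop : Ultrafilter ℕ) (𝓝 (charFun (φ : Measure ℂ) z)) := by
      have hφ' : Tendsto (partialConvolution σ α) (Ultrafilter.of atTop : Ultrafilter ℕ) (𝓝 φ) := hφ
      have := ProbabilityMeasure.tendsto_iff_forall_integral_rclike_tendsto ℂ |>.1 hφ'
        (BoundedContinuousFunction.innerProbChar z)
      simpa only [charFun_eq_integral_innerProbChar] using this
    exact tendsto_nhds_unique h2 h1
  exact ⟨φ, ProbabilityMeasure.tendsto_of_tendsto_charFun fun z => by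
    rw [hchar]; exact tendsto_charFun_partialConvolution hα hσ z, hchar⟩

/-- Each factor is O((1+|z|)^(-1/3)) and at most 1 in absolute value. Seven factors give the
exponent 7/3, larger than the real dimension 2 of ℂ; the others are discarded. -/
theorem integrable_besselProduct (hm : AEStronglyMeasurable (besselProduct σ α) volume) :
    Integrable (besselProduct σ α) := by
  set r : ℕ → ℝ := fun n => ((n : ℝ) + α) ^ (-σ) with hr
  have hr0 (n : ℕ) : 0 < r n := by positivity
  -- The summand 1 serves |z| ≤ 1, where |J₀| ≤ 1 and (1+|z|)^(-1/3) ≥ 1/2; the other one serves |z|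
  -- ≥ 1, where 1 + |z| ≤ 2|z|.
  set c : ℕ → ℝ := fun n => 2 * (17 * r n ^ (-(1 / 3) : ℝ) + 1) with hc
  have hfac (z : ℂ) (n : ℕ) : ‖(besselJ0 (‖z‖ * r n) : ℂ)‖ ≤ c n * (1 + ‖z‖) ^ (-(1 / 3) : ℝ) := by
    rw [Complex.norm_real, Real.norm_eq_abs]
    have hrp : 0 ≤ r n ^ (-(1 / 3) : ℝ) := Real.rpow_nonneg (hr0 n).le _
    have h2 : (1 : ℝ) / 2 ≤ 2 ^ (-(1 / 3) : ℝ) := by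
      rw [one_div, ← Real.rpow_neg_one]
      exact Real.rpow_le_rpow_of_exponent_le (by norm_num) (by norm_num)
    rcases le_total ‖z‖ 1 with h | h
    · have h1 : (2 : ℝ) ^ (-(1 / 3) : ℝ) ≤ (1 + ‖z‖) ^ (-(1 / 3) : ℝ) :=
        Real.rpow_le_rpow_of_nonpos (by positivity) (by linarith) (by norm_num)
      have := abs_besselJ0_le_one (‖z‖ * r n)
      have h3 : 2 * ((1 : ℝ) / 2) ≤ c n * (1 + ‖z‖) ^ (-(1 / 3) : ℝ) := by
        refine mul_le_mul ?_ (h2.trans h1) (by norm_num) (by positivity)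
        simp only [hc]; linarith
      linarith
    · refine (abs_besselJ0_le_rpow (mul_pos (by linarith) (hr0 n))).trans ?_
      rw [Real.mul_rpow (by linarith) (hr0 n).le]
      have h1 : ((2 : ℝ) * ‖z‖) ^ (-(1 / 3) : ℝ) ≤ (1 + ‖z‖) ^ (-(1 / 3) : ℝ) :=
        Real.rpow_le_rpow_of_nonpos (by positivity) (by linarith) (by norm_num)
      rw [Real.mul_rpow (by norm_num) (by linarith)] at h1
      have hz : 0 ≤ ‖z‖ ^ (-(1 / 3) : ℝ) := by positivity
      have h3 : ‖z‖ ^ (-(1 / 3) : ℝ) ≤ 2 * (1 + ‖z‖) ^ (-(1 / 3) : ℝ) := by nlinarith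
      calc 17 * (‖z‖ ^ (-(1 / 3) : ℝ) * r n ^ (-(1 / 3) : ℝ))
          ≤ 17 * (2 * (1 + ‖z‖) ^ (-(1 / 3) : ℝ) * r n ^ (-(1 / 3) : ℝ)) := by gcongr
        _ ≤ c n * (1 + ‖z‖) ^ (-(1 / 3) : ℝ) := by
          have : 0 ≤ (1 + ‖z‖) ^ (-(1 / 3) : ℝ) := by positivity
          simp only [hc]; nlinarith
  have hbound (z : ℂ) : ‖besselProduct σ α z‖
      ≤ (∏ n ∈ Finset.range 7, c n) * (1 + ‖z‖) ^ (-(7 / 3) : ℝ) := by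
    have hlim := (hasProd_besselProduct hα hσ z).tendsto_prod_nat.norm
    refine le_of_tendsto hlim ?_
    filter_upwards [eventually_ge_atTop 7] with N hN
    rw [norm_prod]
    calc ∏ n ∈ Finset.range N, ‖(besselJ0 (‖z‖ * r n) : ℂ)‖
        ≤ ∏ n ∈ Finset.range 7, ‖(besselJ0 (‖z‖ * r n) : ℂ)‖ := by
          rw [← Finset.prod_range_mul_prod_Ico _ hN]
          exact mul_le_of_le_one_right (Finset.prod_nonneg fun _ _ => norm_nonneg _)
            (Finset.prod_le_one (fun _ _ => norm_nonneg _) fun _ _ => norm_besselJ0_le_one _)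
      _ ≤ ∏ n ∈ Finset.range 7, (c n * (1 + ‖z‖) ^ (-(1 / 3) : ℝ)) :=
          Finset.prod_le_prod (fun _ _ => norm_nonneg _) (fun n _ => hfac z n)
      _ = _ := by
          rw [Finset.prod_mul_distrib, Finset.prod_const, Finset.card_range, ← Real.rpow_natCast,
            ← Real.rpow_mul (by positivity)]
          norm_num
  refine Integrable.mono' ((integrable_one_add_norm (E := ℂ) (μ := volume) (r := 7 / 3)
    (by rw [Complex.finrank_real_complex]; norm_num)).const_mul (∏ n ∈ Finset.range 7, c n)) hm
    (Eventually.of_forall hbound)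

theorem isLimitDensity_densityM : IsLimitDensity σ α (densityM σ α) := by
  obtain ⟨φ, hφ, hchar⟩ := exists_limit_partialConvolution hα hσ
  have hfun : charFun (φ : Measure ℂ) = besselProduct σ α := funext hchar
  have hint : Integrable (charFun (φ : Measure ℂ)) := by
    rw [hfun]
    refine integrable_besselProduct hα hσ ?_
    rw [← hfun]
    exact (measurable_charFun).aestronglyMeasurable
  obtain ⟨M, hM, hM0, hMφ⟩ := exists_continuous_density hint
  have hex : ∃ M : ℂ → ℝ, IsLimitDensity σ α M := ⟨M, hM, hM0, φ, hφ, hMφ⟩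
  rw [densityM, dif_pos hex]
  exact hex.choose_spec

theorem fourierM_eq_besselProduct (z : ℂ) : fourierM σ α z = besselProduct σ α z := by
  obtain ⟨hM, hM0, φ, hφ, hMφ⟩ := isLimitDensity_densityM hα hσ
  have h1 := ProbabilityMeasure.tendsto_iff_tendsto_charFun.1 hφ z
  rw [← tendsto_nhds_unique h1 (tendsto_charFun_partialConvolution hα hσ z),
    charFun_eq_integral_psi, hMφ, fourierM, integral_withDensity_eq_integral_toReal_smul
      hM.measurable.ennreal_ofReal (by simp)]
  refine integral_congr_ae (Eventually.of_forall fun w => ?_)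
  simp [ENNReal.toReal_ofReal (hM0 w)]

end Product


theorem norm_prod_sub_one_le_sum {ι : Type*} (s : Finset ι) (a : ι → ℂ) (ha : ∀ i, ‖a i‖ ≤ 1) :
    ‖∏ i ∈ s, a i - 1‖ ≤ ∑ i ∈ s, ‖a i - 1‖ := by
  classical
  induction s using Finset.induction_on with
  | empty => simp
  | insert i s hi ih =>
    rw [Finset.prod_insert hi, Finset.sum_insert hi]
    calc ‖a i * ∏ j ∈ s, a j - 1‖ = ‖a i * (∏ j ∈ s, a j - 1) + (a i - 1)‖ := by ring_nf
      _ ≤ ‖a i‖ * ‖∏ j ∈ s, a j - 1‖ + ‖a i - 1‖ := by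
        rw [← norm_mul]; exact norm_add_le _ _
      _ ≤ ‖a i - 1‖ + ∑ j ∈ s, ‖a j - 1‖ := by
        nlinarith [ha i, norm_nonneg (a i), norm_nonneg (∏ j ∈ s, a j - 1)]

/-- The infinite product of Bessel functions is close to its partial products. -/
theorem norm_besselProduct_sub_prod_le {σ α : ℝ} (hα : 0 < α) (hσ : 1 / 2 < σ) {N : ℕ}
    (hN : 1 ≤ N) (z : ℂ) :
    ‖besselProduct σ α z - ∏ n ∈ Finset.range N, (besselJ0 (‖z‖ * ((n : ℝ) + α) ^ (-σ)) : ℂ)‖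
      ≤ ‖z‖ ^ 2 * ((N : ℝ) ^ (1 - 2 * σ) * (1 + 1 / (2 * σ - 1))) := by
  have hlim := ((hasProd_besselProduct hα hσ z).tendsto_prod_nat.sub_const
    (∏ n ∈ Finset.range N, (besselJ0 (‖z‖ * ((n : ℝ) + α) ^ (-σ)) : ℂ))).norm
  refine le_of_tendsto hlim ?_
  filter_upwards [eventually_ge_atTop N] with M hM
  rw [← Finset.prod_range_mul_prod_Ico _ hM, ← mul_sub_one, norm_mul]
  have h1 : ‖∏ n ∈ Finset.range N, (besselJ0 (‖z‖ * ((n : ℝ) + α) ^ (-σ)) : ℂ)‖ ≤ 1 := by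
    rw [norm_prod]
    exact Finset.prod_le_one (fun _ _ => norm_nonneg _) fun _ _ => norm_besselJ0_le_one _
  have h2 := norm_prod_sub_one_le_sum (Finset.Ico N M)
    (fun n => (besselJ0 (‖z‖ * ((n : ℝ) + α) ^ (-σ)) : ℂ)) fun _ => norm_besselJ0_le_one _
  have h3 : ∑ n ∈ Finset.Ico N M, ‖(besselJ0 (‖z‖ * ((n : ℝ) + α) ^ (-σ)) : ℂ) - 1‖
      ≤ ‖z‖ ^ 2 * ∑ n ∈ Finset.Ico N M, (((n : ℝ) + α) ^ (-σ)) ^ 2 := by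
    rw [Finset.mul_sum]
    refine Finset.sum_le_sum fun n _ => (norm_besselJ0_sub_one_le z _).trans ?_
    have : 0 ≤ ‖z‖ ^ 2 * (((n : ℝ) + α) ^ (-σ)) ^ 2 := by positivity
    linarith
  calc _ ≤ 1 * ‖∏ n ∈ Finset.Ico N M, (besselJ0 (‖z‖ * ((n : ℝ) + α) ^ (-σ)) : ℂ) - 1‖ := by
        gcongr
    _ ≤ ‖z‖ ^ 2 * ∑ n ∈ Finset.Ico N M, (((n : ℝ) + α) ^ (-σ)) ^ 2 := by
        rw [one_mul]; exact h2.trans h3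
    _ ≤ _ := by
        gcongr
        exact sum_Ico_rpow_le hα hσ hN M

/-! ### Comparing characteristic functions through moments -/

/-- Induction on m: the derivative of the remainder of order m + 1 is i times the remainder of order
m, so the bound integrates from 0. -/
theorem norm_cexp_sub_sum_le_of_nonneg (m : ℕ) {x : ℝ} (hx : 0 ≤ x) :
    ‖Complex.exp (Complex.I * x)
      - ∑ k ∈ Finset.range m, (Complex.I * x) ^ k / (k.factorial : ℂ)‖
      ≤ x ^ m / m.factorial := by
  induction m generalizing x with
  | zero =>
    simp [mul_comm Complex.I, Complex.norm_exp_ofReal_mul_I]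
  | succ m ih =>
    have hderiv : ∀ y : ℝ, HasDerivAt (fun y : ℝ => Complex.exp (Complex.I * y)
        - ∑ k ∈ Finset.range (m + 1), (Complex.I * y) ^ k / (k.factorial : ℂ))
        (Complex.I * (Complex.exp (Complex.I * y)
          - ∑ k ∈ Finset.range m, (Complex.I * y) ^ k / (k.factorial : ℂ))) y := by
      intro y
      have h1 : HasDerivAt (fun y : ℝ => Complex.I * (y : ℂ)) Complex.I y := by
        simpa using (Complex.ofRealCLM.hasDerivAt (x := y)).const_mul Complex.I
      have h2 := h1.cexp
      have h3 : HasDerivAt (fun y : ℝ => ∑ k ∈ Finset.range (m + 1),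
          (Complex.I * y) ^ k / (k.factorial : ℂ))
          (∑ k ∈ Finset.range (m + 1),
            (k * (Complex.I * y) ^ (k - 1) * Complex.I) / (k.factorial : ℂ)) y :=
        HasDerivAt.fun_sum fun k _ => (h1.pow k).div_const _
      refine (h2.sub h3).congr_deriv ?_
      rw [Finset.sum_range_succ', mul_sub, mul_comm Complex.I (Complex.exp _), Finset.mul_sum]
      simp only [Nat.cast_zero, zero_mul, zero_div, add_zero]
      congr 1
      refine Finset.sum_congr rfl fun k _ => ?_
      rw [Nat.add_sub_cancel, Nat.factorial_succ]
      have : ((k : ℂ) + 1) ≠ 0 := by exact_mod_cast Nat.succ_ne_zero k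
      have : (k.factorial : ℂ) ≠ 0 := by exact_mod_cast k.factorial_ne_zero
      push_cast
      field_simp
    have hB : ∀ y : ℝ, HasDerivAt (fun y : ℝ => y ^ (m + 1) / ((m + 1).factorial : ℝ))
        (y ^ m / m.factorial) y := by
      intro y
      refine (((hasDerivAt_id y).pow (m + 1)).div_const _).congr_deriv ?_
      have : (m.factorial : ℝ) ≠ 0 := by exact_mod_cast m.factorial_ne_zero
      rw [Nat.factorial_succ]
      push_cast
      simp only [id]
      field_simp
    refine image_norm_le_of_norm_deriv_right_le_deriv_boundary (a := 0) (b := x)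
      (f := fun y : ℝ => Complex.exp (Complex.I * y)
        - ∑ k ∈ Finset.range (m + 1), (Complex.I * y) ^ k / (k.factorial : ℂ))
      (fun y _ => (hderiv y).continuousAt.continuousWithinAt)
      (fun y _ => (hderiv y).hasDerivWithinAt) ?_ hB (fun y hy => ?_) ⟨hx, le_rfl⟩
    · simp [Finset.sum_range_succ']
    · rw [norm_mul, Complex.norm_I, one_mul]
      exact ih hy.1

/-- Taylor's formula for `exp (i x)` with a remainder uniform in `x`. -/
theorem norm_cexp_sub_sum_le (m : ℕ) (x : ℝ) :
    ‖Complex.exp (Complex.I * x)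
      - ∑ k ∈ Finset.range m, (Complex.I * x) ^ k / (k.factorial : ℂ)‖
      ≤ |x| ^ m / m.factorial := by
  rcases le_total 0 x with hx | hx
  · rw [abs_of_nonneg hx]; exact norm_cexp_sub_sum_le_of_nonneg m hx
  · rw [abs_of_nonpos hx, ← Complex.norm_conj]
    have := norm_cexp_sub_sum_le_of_nonneg m (x := -x) (by linarith)
    convert this using 2
    rw [map_sub, map_sum, ← Complex.exp_conj]
    simp

/-- Two bounded random variables with close moments have close characteristic functions. -/
theorem norm_integral_cexp_sub_le.{u} {X Y : Type u} [MeasurableSpace X] [MeasurableSpace Y]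
    {μ : Measure X} {ν : Measure Y} [IsProbabilityMeasure μ] [IsProbabilityMeasure ν]
    {f : X → ℝ} {g : Y → ℝ} (hf : Measurable f) (hg : Measurable g) {B : ℝ}
    (hfB : ∀ x, |f x| ≤ B) (hgB : ∀ y, |g y| ≤ B) (K : ℕ) {ε : ℝ}
    (hε : ∀ k ≤ 2 * K, |∫ x, f x ^ k ∂μ - ∫ y, g y ^ k ∂ν| ≤ ε) :
    ‖∫ x, Complex.exp (Complex.I * f x) ∂μ - ∫ y, Complex.exp (Complex.I * g y) ∂ν‖
      ≤ (2 * K + 1) * ε + 2 * ((∫ y, g y ^ (2 * K) ∂ν) / (2 * K).factorial) := by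
  have hpow {X : Type u} [MeasurableSpace X] {μ : Measure X} [IsProbabilityMeasure μ]
      {f : X → ℝ} (hf : Measurable f) (hfB : ∀ x, |f x| ≤ B) (k : ℕ) :
      Integrable (fun x => f x ^ k) μ :=
    Integrable.of_bound (hf.pow_const k).aestronglyMeasurable (B ^ k)
      (Eventually.of_forall fun x => by
        rw [norm_pow, Real.norm_eq_abs]
        exact pow_le_pow_left₀ (abs_nonneg _) (hfB x) k)
  have hexp {X : Type u} [MeasurableSpace X] {μ : Measure X} [IsProbabilityMeasure μ]
      {f : X → ℝ} (hf : Measurable f) :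
      Integrable (fun x => Complex.exp (Complex.I * f x)) μ :=
    Integrable.of_bound (by fun_prop) 1
      (Eventually.of_forall fun x => by
        rw [mul_comm, Complex.norm_exp_ofReal_mul_I])
  -- The order 2K is even so that |f|^(2K) = f^(2K): the Taylor error is itself a moment.
  have key {X : Type u} [MeasurableSpace X] {μ : Measure X} [IsProbabilityMeasure μ]
      {f : X → ℝ} (hf : Measurable f) (hfB : ∀ x, |f x| ≤ B) :
      ‖∫ x, Complex.exp (Complex.I * f x) ∂μ - ∑ k ∈ Finset.range (2 * K),
        Complex.I ^ k / (k.factorial : ℂ) * ((∫ x, f x ^ k ∂μ : ℝ) : ℂ)‖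
        ≤ (∫ x, f x ^ (2 * K) ∂μ) / (2 * K).factorial := by
    have hterm (k : ℕ) : Integrable (fun x => (Complex.I * f x) ^ k / (k.factorial : ℂ)) μ := by
      have : (fun x => (Complex.I * f x) ^ k / (k.factorial : ℂ))
          = fun x => Complex.I ^ k / (k.factorial : ℂ) * ((f x ^ k : ℝ) : ℂ) := by
        funext x; push_cast; ring
      rw [this]
      exact ((hpow hf hfB k).ofReal).const_mul _
    have hsum : ∑ k ∈ Finset.range (2 * K),
        Complex.I ^ k / (k.factorial : ℂ) * ((∫ x, f x ^ k ∂μ : ℝ) : ℂ)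
        = ∫ x, ∑ k ∈ Finset.range (2 * K), (Complex.I * f x) ^ k / (k.factorial : ℂ) ∂μ := by
      rw [integral_finsetSum _ fun k _ => hterm k]
      refine Finset.sum_congr rfl fun k _ => ?_
      rw [← integral_complex_ofReal, ← integral_const_mul]
      congr 1
      funext x; push_cast; ring
    rw [hsum, ← integral_sub (hexp hf) (integrable_finsetSum _ fun k _ => hterm k), ← integral_div]
    refine norm_integral_le_of_norm_le ((hpow hf hfB _).div_const _)
      (Eventually.of_forall fun x => ?_)
    have := norm_cexp_sub_sum_le (2 * K) (f x)
    rwa [pow_mul, sq_abs, ← pow_mul] at this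
  have h1 := key (μ := μ) hf hfB
  have h2 := key (μ := ν) hg hgB
  have hfact (k : ℕ) : (1 : ℝ) ≤ k.factorial := by exact_mod_cast k.factorial_pos
  have h3 : ‖∑ k ∈ Finset.range (2 * K),
        Complex.I ^ k / (k.factorial : ℂ) * ((∫ x, f x ^ k ∂μ : ℝ) : ℂ)
      - ∑ k ∈ Finset.range (2 * K),
        Complex.I ^ k / (k.factorial : ℂ) * ((∫ y, g y ^ k ∂ν : ℝ) : ℂ)‖ ≤ 2 * K * ε := by
    rw [← Finset.sum_sub_distrib]
    have hconst : ∑ _k ∈ Finset.range (2 * K), ε = 2 * K * ε := by simp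
    rw [← hconst]
    refine norm_sum_le_of_le _ fun k hk => ?_
    rw [← mul_sub, norm_mul, norm_div, norm_pow, Complex.norm_I, one_pow, Complex.norm_natCast,
      ← Complex.ofReal_sub, Complex.norm_real]
    have := hε k (Finset.mem_range.1 hk).le
    calc _ ≤ 1 * |∫ x, f x ^ k ∂μ - ∫ y, g y ^ k ∂ν| := by
          rw [Real.norm_eq_abs]
          gcongr
          exact div_le_one_of_le₀ (hfact k) (by positivity)
      _ ≤ ε := by linarith
  -- Only the 2K-th moment of g will be estimated directly; that of f is traded for it at the price
  -- of one more ε.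
  have h4 : (∫ x, f x ^ (2 * K) ∂μ) / (2 * K).factorial
      ≤ (∫ y, g y ^ (2 * K) ∂ν) / (2 * K).factorial + ε := by
    have h := (abs_le.1 (hε (2 * K) le_rfl)).2
    have hε0 : 0 ≤ ε := (abs_nonneg _).trans (hε 0 (Nat.zero_le _))
    have : ε / (2 * K).factorial ≤ ε := div_le_self hε0 (hfact _)
    calc _ ≤ ((∫ y, g y ^ (2 * K) ∂ν) + ε) / (2 * K).factorial := by gcongr; linarith
      _ ≤ _ := by rw [add_div]; gcongr
  set a := ∫ x, Complex.exp (Complex.I * f x) ∂μ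
  set b := ∫ y, Complex.exp (Complex.I * g y) ∂ν
  set p := ∑ k ∈ Finset.range (2 * K),
        Complex.I ^ k / (k.factorial : ℂ) * ((∫ x, f x ^ k ∂μ : ℝ) : ℂ)
  set q := ∑ k ∈ Finset.range (2 * K),
        Complex.I ^ k / (k.factorial : ℂ) * ((∫ y, g y ^ k ∂ν : ℝ) : ℂ)
  calc ‖a - b‖ = ‖(a - p) + (p - q) - (b - q)‖ := by ring_nf
    _ ≤ ‖a - p‖ + ‖p - q‖ + ‖b - q‖ := (norm_sub_le _ _).trans (by gcongr; exact norm_add_le _ _)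
    _ ≤ _ := by linarith


/-! ### Trigonometric sums: time averages against torus averages -/

/-- The real trigonometric sum `∑ Re (w_n e^{i θ_n})`. -/
noncomputable def trigSum {N : ℕ} (w : Fin N → ℂ) (θ : Fin N → ℝ) : ℝ :=
  ∑ n, (w n * Complex.exp (Complex.I * θ n)).re

/-- The coefficients of `trigSum` as a sum of characters. -/
noncomputable def trigCoeff {N : ℕ} (w : Fin N → ℂ) (p : Fin N × Bool) : ℂ :=
  (bif p.2 then w p.1 else starRingEnd ℂ (w p.1)) / 2

/-- The sign attached to a boolean. -/
def boolSign (b : Bool) : ℤ := bif b then 1 else -1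

theorem trigSum_eq_sum {N : ℕ} (w : Fin N → ℂ) (θ : Fin N → ℝ) :
    (trigSum w θ : ℂ) = ∑ p : Fin N × Bool,
      trigCoeff w p * Complex.exp (Complex.I * ((boolSign p.2 * θ p.1 : ℝ) : ℂ)) := by
  rw [trigSum, Fintype.sum_prod_type, Complex.ofReal_sum]
  refine Finset.sum_congr rfl fun n _ => ?_
  rw [Fintype.sum_bool, Complex.re_eq_add_conj, map_mul, ← Complex.exp_conj]
  simp [trigCoeff, boolSign]
  ring

theorem sum_norm_trigCoeff {N : ℕ} (w : Fin N → ℂ) : ∑ p, ‖trigCoeff w p‖ = ∑ n, ‖w n‖ := by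
  rw [Fintype.sum_prod_type]
  refine Finset.sum_congr rfl fun n _ => ?_
  simp [trigCoeff]

theorem trigSum_pow {N : ℕ} (w : Fin N → ℂ) (θ : Fin N → ℝ) (k : ℕ) :
    ((trigSum w θ ^ k : ℝ) : ℂ) = ∑ p : Fin k → Fin N × Bool, (∏ i, trigCoeff w (p i)) *
      Complex.exp (Complex.I * ((∑ i, boolSign (p i).2 * θ (p i).1 : ℝ) : ℂ)) := by
  rw [Complex.ofReal_pow, trigSum_eq_sum, Fintype.sum_pow]
  refine Finset.sum_congr rfl fun p _ => ?_
  rw [Finset.prod_mul_distrib, ← Complex.exp_sum, ← Finset.mul_sum, ← Complex.ofReal_sum]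

theorem abs_trigSum_le {N : ℕ} (w : Fin N → ℂ) (θ : Fin N → ℝ) :
    |trigSum w θ| ≤ ∑ n, ‖w n‖ := by
  refine (Finset.abs_sum_le_sum_abs _ _).trans (Finset.sum_le_sum fun n _ => ?_)
  refine (Complex.abs_re_le_norm _).trans ?_
  rw [norm_mul, mul_comm Complex.I, Complex.norm_exp_ofReal_mul_I, mul_one]

theorem continuous_trigSum {N : ℕ} (w : Fin N → ℂ) : Continuous (trigSum w) := by
  unfold trigSum
  fun_prop

/-- The uniform probability measure on the torus `(0, 1]^N`. -/
noncomputable def torusMeasure (N : ℕ) : Measure (Fin N → ℝ) :=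
  Measure.pi fun _ => volume.restrict (Set.Ioc (0 : ℝ) 1)

instance : IsProbabilityMeasure (volume.restrict (Set.Ioc (0 : ℝ) 1)) := ⟨by simp⟩

instance (N : ℕ) : IsProbabilityMeasure (torusMeasure N) := by
  unfold torusMeasure; infer_instance

/-- The uniform probability measure on `(0, T]`. -/
noncomputable def timeMeasure (T : ℝ) : Measure ℝ :=
  ENNReal.ofReal (1 / T) • volume.restrict (Set.Ioc (0 : ℝ) T)

theorem isProbabilityMeasure_timeMeasure {T : ℝ} (hT : 0 < T) :
    IsProbabilityMeasure (timeMeasure T) := by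
  constructor
  rw [timeMeasure, Measure.smul_apply, Measure.restrict_apply_univ, Real.volume_Ioc, smul_eq_mul,
    sub_zero, ← ENNReal.ofReal_mul (by positivity), one_div_mul_cancel hT.ne', ENNReal.ofReal_one]

theorem integral_timeMeasure {T : ℝ} (hT : 0 < T) (f : ℝ → ℂ) :
    ∫ t, f t ∂(timeMeasure T) = ((1 / T : ℝ) : ℂ) * ∫ t in (0 : ℝ)..T, f t := by
  rw [timeMeasure, integral_smul_measure, ENNReal.toReal_ofReal (by positivity),
    intervalIntegral.integral_of_le hT.le, Complex.real_smul]

theorem integral_torus_prod {N : ℕ} (f : Fin N → ℝ → ℂ) :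
    ∫ u, ∏ n, f n (u n) ∂(torusMeasure N) = ∏ n, ∫ x in (0 : ℝ)..1, f n x := by
  rw [torusMeasure, integral_fintype_prod_eq_prod]
  simp_rw [intervalIntegral.integral_of_le (zero_le_one (α := ℝ))]

theorem integral_torus_prod_real {N : ℕ} (f : Fin N → ℝ → ℝ) :
    ∫ u, ∏ n, f n (u n) ∂(torusMeasure N) = ∏ n, ∫ x in (0 : ℝ)..1, f n x := by
  rw [torusMeasure, integral_fintype_prod_eq_prod]
  simp_rw [intervalIntegral.integral_of_le (zero_le_one (α := ℝ))]

theorem integral_torus_character {N : ℕ} (c : Fin N → ℤ) :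
    ∫ u, Complex.exp (Complex.I * ((∑ n, c n * (2 * Real.pi * u n) : ℝ) : ℂ)) ∂(torusMeasure N)
      = if c = 0 then 1 else 0 := by
  have h (u : Fin N → ℝ) : Complex.exp (Complex.I * ((∑ n, c n * (2 * Real.pi * u n) : ℝ) : ℂ))
      = ∏ n, Complex.exp (2 * Real.pi * Complex.I * c n * u n) := by
    rw [← Complex.exp_sum]
    congr 1
    push_cast
    rw [Finset.mul_sum]
    exact Finset.sum_congr rfl fun n _ => by ring
  simp_rw [h]
  rw [integral_torus_prod (fun n x => Complex.exp (2 * Real.pi * Complex.I * c n * x))]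
  simp_rw [integral_cexp_two_pi_int]
  split_ifs with hc
  · simp [hc]
  · obtain ⟨n, hn⟩ := Function.ne_iff.1 hc
    exact Finset.prod_eq_zero (Finset.mem_univ n) (if_neg hn)

theorem norm_integral_time_character_le {T Λ : ℝ} (hT : 0 < T) (hΛ : Λ ≠ 0) :
    ‖∫ t, Complex.exp (Complex.I * ((-(t * Λ) : ℝ) : ℂ)) ∂(timeMeasure T)‖ ≤ 2 / (T * |Λ|) := by
  rw [integral_timeMeasure hT]
  have hc : (-(Complex.I * Λ) : ℂ) ≠ 0 := by simpa using hΛ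
  have h (t : ℝ) : Complex.exp (Complex.I * ((-(t * Λ) : ℝ) : ℂ))
      = Complex.exp (-(Complex.I * Λ) * t) := by
    congr 1; push_cast; ring
  simp_rw [h]
  rw [integral_exp_mul_complex hc, norm_mul, norm_div, norm_neg, norm_mul, Complex.norm_I, one_mul,
    Complex.norm_real, Complex.norm_real, Real.norm_eq_abs, Real.norm_eq_abs,
    abs_of_pos (by positivity)]
  have h2 : ‖Complex.exp (-(Complex.I * Λ) * T) - Complex.exp (-(Complex.I * Λ) * (0 : ℝ))‖
      ≤ 2 := by
    refine (norm_sub_le _ _).trans ?_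
    rw [← h, ← h, mul_comm, Complex.norm_exp_ofReal_mul_I, mul_comm,
      Complex.norm_exp_ofReal_mul_I]
    norm_num
  calc _ ≤ 1 / T * (2 / |Λ|) := by gcongr
    _ = _ := by field_simp

section Moments

variable {N : ℕ} {l : Fin N → ℝ} (hl : LinearIndependent ℚ l) {T D : ℝ} (hT : 0 < T) (hD : 0 < D)
include hl hT hD

/-- Both means are 1 when the frequency Λ vanishes, since by linear independence Λ = 0 forces every
net coefficient to be 0. Otherwise the torus mean is 0 and the time mean is at most 2/(T|Λ|). -/
theorem norm_character_mean_sub_le {k : ℕ} (p : Fin k → Fin N × Bool)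
    (hgap : ∑ i, boolSign (p i).2 * l (p i).1 ≠ 0 →
      1 / D ≤ |∑ i, boolSign (p i).2 * l (p i).1|) :
    ‖∫ t, Complex.exp (Complex.I * ((∑ i, boolSign (p i).2 * (-(t * l (p i).1)) : ℝ) : ℂ))
        ∂(timeMeasure T)
      - ∫ u, Complex.exp (Complex.I * ((∑ i, boolSign (p i).2 * (2 * Real.pi * u (p i).1) : ℝ) : ℂ))
        ∂(torusMeasure N)‖ ≤ 2 * D / T := by
  have := isProbabilityMeasure_timeMeasure hT
  -- Net multiplicity of each frequency after collecting repetitions.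
  set c : Fin N → ℤ := fun n => ∑ i, if (p i).1 = n then boolSign (p i).2 else 0 with hc
  have hgroup (x : Fin N → ℝ) : ∑ i, boolSign (p i).2 * x (p i).1 = ∑ n, c n * x n := by
    simp only [hc]
    push_cast
    simp_rw [Finset.sum_mul]
    rw [Finset.sum_comm]
    refine Finset.sum_congr rfl fun i _ => ?_
    simp
  set Λ := ∑ i, boolSign (p i).2 * l (p i).1 with hΛ
  have htime (t : ℝ) : ∑ i, boolSign (p i).2 * (-(t * l (p i).1)) = -(t * Λ) := by
    rw [hΛ, Finset.mul_sum, ← Finset.sum_neg_distrib]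
    exact Finset.sum_congr rfl fun i _ => by ring
  have htorus (u : Fin N → ℝ) : ∑ i, boolSign (p i).2 * (2 * Real.pi * u (p i).1)
      = ∑ n, c n * (2 * Real.pi * u n) := hgroup fun n => 2 * Real.pi * u n
  simp_rw [htime, htorus, integral_torus_character]
  by_cases h0 : Λ = 0
  · have hc0 : c = 0 := by
      rw [Fintype.linearIndependent_iff] at hl
      have := hl (fun n => (c n : ℚ)) (by
        rw [← h0, hΛ, hgroup]
        exact Finset.sum_congr rfl fun n _ => by rw [Rat.smul_def, Rat.cast_intCast])
      funext n
      exact_mod_cast this n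
    rw [if_pos hc0, h0]
    simp
    positivity
  · have hc0 : c ≠ 0 := fun h => h0 (by rw [hΛ, hgroup]; simp [h])
    rw [if_neg hc0, sub_zero]
    refine (norm_integral_time_character_le hT h0).trans ?_
    have h1 := hgap h0
    have h2 : 1 ≤ |Λ| * D := by rwa [div_le_iff₀ hD] at h1
    have h3 : 0 < |Λ| := abs_pos.2 h0
    rw [div_le_div_iff₀ (by positivity) hT]
    nlinarith

/-- Expanding the k-th power into characters, the absolute values of the coefficients sum to (∑ ‖w
n‖)^k, and every character obeys the same bound. -/
theorem abs_moment_sub_le (w : Fin N → ℂ) (k : ℕ)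
    (hgap : ∀ p : Fin k → Fin N × Bool, ∑ i, boolSign (p i).2 * l (p i).1 ≠ 0 →
      1 / D ≤ |∑ i, boolSign (p i).2 * l (p i).1|) :
    |∫ t, trigSum w (fun n => -(t * l n)) ^ k ∂(timeMeasure T)
      - ∫ u, trigSum w (fun n => 2 * Real.pi * u n) ^ k ∂(torusMeasure N)|
      ≤ (∑ n, ‖w n‖) ^ k * (2 * D / T) := by
  have := isProbabilityMeasure_timeMeasure hT
  rw [← Real.norm_eq_abs, ← Complex.norm_real, Complex.ofReal_sub, ← integral_complex_ofReal,
    ← integral_complex_ofReal]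
  simp_rw [trigSum_pow]
  have hint {X : Type} [TopologicalSpace X] [MeasurableSpace X] [BorelSpace X] {μ : Measure X}
      [IsProbabilityMeasure μ] {g : X → ℝ} (hg : Continuous g) (a : ℂ) :
      Integrable (fun x => a * Complex.exp (Complex.I * (g x : ℂ))) μ :=
    (Integrable.of_bound (Continuous.aestronglyMeasurable (by fun_prop)) 1
      (Eventually.of_forall fun x => by
        rw [mul_comm, Complex.norm_exp_ofReal_mul_I])).const_mul a
  rw [integral_finsetSum _ fun p _ => hint (by fun_prop) _,
    integral_finsetSum _ fun p _ => hint (by fun_prop) _, ← Finset.sum_sub_distrib]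
  simp_rw [integral_const_mul, ← mul_sub]
  rw [← sum_norm_trigCoeff, Fintype.sum_pow, Finset.sum_mul]
  refine norm_sum_le_of_le _ fun p _ => ?_
  rw [norm_mul, norm_prod]
  gcongr
  exact norm_character_mean_sub_le hl hT hD p (hgap p)

end Moments

theorem trigSum_smul {N : ℕ} (w : Fin N → ℂ) (y : ℝ) (θ : Fin N → ℝ) :
    trigSum (fun n => y * w n) θ = y * trigSum w θ := by
  simp only [trigSum, Finset.mul_sum, mul_assoc, Complex.re_ofReal_mul]

/-- On the torus the summands are independent, so the sub-Gaussian bounds for single circles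
multiply. -/
theorem integral_exp_trigSum_le {N : ℕ} (w : Fin N → ℂ) :
    ∫ u, Real.exp (trigSum w (fun n => 2 * Real.pi * u n)) ∂(torusMeasure N)
      ≤ Real.exp ((∑ n, ‖w n‖ ^ 2) / 4) := by
  have h (u : Fin N → ℝ) : Real.exp (trigSum w (fun n => 2 * Real.pi * u n))
      = ∏ n, Real.exp (w n * Complex.exp (2 * Real.pi * Complex.I * u n)).re := by
    rw [← Real.exp_sum, trigSum]
    congr 1
    refine Finset.sum_congr rfl fun n _ => ?_
    congr 3
    push_cast; ring
  simp_rw [h]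
  rw [integral_torus_prod_real
    (fun n x => Real.exp (w n * Complex.exp (2 * Real.pi * Complex.I * x)).re),
    Finset.sum_div, Real.exp_sum]
  refine Finset.prod_le_prod (fun n _ => ?_) fun n _ => integral_exp_re_circle_le (w n)
  exact intervalIntegral.integral_nonneg zero_le_one fun x _ => (Real.exp_pos _).le

theorem integral_cexp_trigSum {N : ℕ} (w : Fin N → ℂ) :
    ∫ u, Complex.exp (Complex.I * trigSum w (fun n => 2 * Real.pi * u n)) ∂(torusMeasure N)
      = ∏ n, (besselJ0 ‖w n‖ : ℂ) := by
  have h (u : Fin N → ℝ) : Complex.exp (Complex.I * trigSum w (fun n => 2 * Real.pi * u n))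
      = ∏ n, psi 1 (w n * Complex.exp (2 * Real.pi * Complex.I * u n)) := by
    simp only [psi]
    rw [← Complex.exp_sum, ← Finset.mul_sum, ← Complex.ofReal_sum, trigSum]
    congr 3
    refine Finset.sum_congr rfl fun n _ => ?_
    rw [one_mul, Complex.conj_re]
    congr 3
    push_cast; ring
  simp_rw [h]
  rw [integral_torus_prod (fun n x => psi 1 (w n * Complex.exp (2 * Real.pi * Complex.I * x)))]
  simp_rw [integral_psi_circle, norm_one, one_mul]

/-- Chernoff's method: (yS)^(2K)/(2K)! ≤ e^|yS| ≤ e^(yS) + e^(-yS), and both exponential moments are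
sub-Gaussian. The scale y is left free, to be chosen at the end. -/
theorem integral_trigSum_pow_le {N : ℕ} (w : Fin N → ℂ) (K : ℕ) {y : ℝ} (hy : 0 < y) :
    (∫ u, trigSum w (fun n => 2 * Real.pi * u n) ^ (2 * K) ∂(torusMeasure N)) / (2 * K).factorial
      ≤ 2 * (y ^ (2 * K))⁻¹ * Real.exp (y ^ 2 * (∑ n, ‖w n‖ ^ 2) / 4) := by
  set S : (Fin N → ℝ) → ℝ := fun u => trigSum w (fun n => 2 * Real.pi * u n) with hS
  have hSc : Continuous S := (continuous_trigSum w).comp (by fun_prop)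
  have hSB (u : Fin N → ℝ) : |S u| ≤ ∑ n, ‖w n‖ := abs_trigSum_le w _
  have hi (a : ℝ) : Integrable (fun u => Real.exp (a * S u)) (torusMeasure N) :=
    Integrable.of_bound (Continuous.aestronglyMeasurable (by fun_prop))
      (Real.exp (|a| * ∑ n, ‖w n‖)) (Eventually.of_forall fun u => by
        rw [Real.norm_eq_abs, Real.abs_exp]
        refine Real.exp_le_exp.2 ((le_abs_self _).trans ?_)
        rw [abs_mul]
        exact mul_le_mul_of_nonneg_left (hSB u) (abs_nonneg _))
  have hE (a : ℝ) (ha : a ^ 2 = y ^ 2) : ∫ u, Real.exp (a * S u) ∂(torusMeasure N)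
      ≤ Real.exp (y ^ 2 * (∑ n, ‖w n‖ ^ 2) / 4) := by
    have := integral_exp_trigSum_le (fun n => (a : ℂ) * w n)
    simp_rw [trigSum_smul, norm_mul, Complex.norm_real, mul_pow, Real.norm_eq_abs, sq_abs, ha,
      ← Finset.mul_sum] at this
    exact this
  have hpt (u : Fin N → ℝ) : S u ^ (2 * K) / (2 * K).factorial
      ≤ (y ^ (2 * K))⁻¹ * (Real.exp (y * S u) + Real.exp (-y * S u)) := by
    have h1 := Real.pow_div_factorial_le_exp (|y * S u|) (abs_nonneg _) (2 * K)
    have h2 : Real.exp |y * S u| ≤ Real.exp (y * S u) + Real.exp (-y * S u) := by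
      rcases abs_cases (y * S u) with ⟨h, -⟩ | ⟨h, -⟩ <;> rw [h]
      · linarith [Real.exp_pos (-y * S u)]
      · rw [← neg_mul]; linarith [Real.exp_pos (y * S u)]
    rw [pow_mul, sq_abs, ← pow_mul, mul_pow] at h1
    have h3 := h1.trans h2
    rw [← div_eq_inv_mul, le_div_iff₀ (by positivity)]
    calc _ = y ^ (2 * K) * S u ^ (2 * K) / (2 * K).factorial := by ring
      _ ≤ _ := h3
  rw [← integral_div]
  calc _ ≤ ∫ u, (y ^ (2 * K))⁻¹ * (Real.exp (y * S u) + Real.exp (-y * S u)) ∂(torusMeasure N) := by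
        refine integral_mono_of_nonneg (Eventually.of_forall fun u => ?_)
          (((hi y).add (hi (-y))).const_mul _) (Eventually.of_forall hpt)
        show 0 ≤ S u ^ (2 * K) / _
        rw [pow_mul]
        positivity
    _ ≤ _ := by
        rw [integral_const_mul, integral_add (hi y) (hi (-y))]
        have h1 := hE y rfl
        have h2 := hE (-y) (neg_sq y)
        calc _ ≤ (y ^ (2 * K))⁻¹ * (Real.exp (y ^ 2 * (∑ n, ‖w n‖ ^ 2) / 4)
              + Real.exp (y ^ 2 * (∑ n, ‖w n‖ ^ 2) / 4)) := by gcongr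
          _ = _ := by ring

/-- The mean of `exp (i ∑ Re (w_n e^{-i t l_n}))` over `[0, T]` is close to the product of Bessel
functions, if short signed sums of the frequencies are not too small. -/
theorem norm_mean_cexp_sub_prod_le {N : ℕ} {l : Fin N → ℝ} (hl : LinearIndependent ℚ l) {T D : ℝ}
    (hT : 0 < T) (hD : 0 < D) (w : Fin N → ℂ) (K : ℕ) {y : ℝ} (hy : 0 < y)
    (hgap : ∀ k ≤ 2 * K, ∀ p : Fin k → Fin N × Bool, ∑ i, boolSign (p i).2 * l (p i).1 ≠ 0 →
      1 / D ≤ |∑ i, boolSign (p i).2 * l (p i).1|) :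
    ‖((1 / T : ℝ) : ℂ) * (∫ t in (0 : ℝ)..T,
        Complex.exp (Complex.I * trigSum w (fun n => -(t * l n)))) - ∏ n, (besselJ0 ‖w n‖ : ℂ)‖
      ≤ (2 * K + 1) * ((1 + ∑ n, ‖w n‖) ^ (2 * K) * (2 * D / T))
        + 2 * (2 * (y ^ (2 * K))⁻¹ * Real.exp (y ^ 2 * (∑ n, ‖w n‖ ^ 2) / 4)) := by
  have := isProbabilityMeasure_timeMeasure hT
  rw [← integral_timeMeasure hT, ← integral_cexp_trigSum]
  have hw : 0 ≤ ∑ n, ‖w n‖ := Finset.sum_nonneg fun _ _ => norm_nonneg _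
  refine (norm_integral_cexp_sub_le (f := fun t : ℝ => trigSum w (fun n => -(t * l n)))
    (g := fun u : Fin N → ℝ => trigSum w (fun n => 2 * Real.pi * u n))
    ((continuous_trigSum w).comp (by fun_prop)).measurable
    ((continuous_trigSum w).comp (by fun_prop)).measurable (B := ∑ n, ‖w n‖)
    (fun _ => abs_trigSum_le w _) (fun _ => abs_trigSum_le w _) K
    (ε := (1 + ∑ n, ‖w n‖) ^ (2 * K) * (2 * D / T)) fun k hk => ?_).trans ?_
  · refine (abs_moment_sub_le hl hT hD w k (hgap k hk)).trans ?_
    gcongr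
    -- Adding 1 makes the base at least 1, so one bound serves all k ≤ 2K.
    calc (∑ n, ‖w n‖) ^ k ≤ (1 + ∑ n, ‖w n‖) ^ k := by gcongr; linarith
      _ ≤ _ := pow_le_pow_right₀ (by linarith) hk
  · gcongr
    exact integral_trigSum_pow_le w K hy


/-! ### Terms of the Lerch series; convergence for non-integral λ -/

/-- The general term `e^{2πi lam n} (n + α)^{-s}` of the Lerch series. -/
noncomputable def lerchTerm (lam α : ℝ) (s : ℂ) (n : ℕ) : ℂ :=
  Complex.exp (2 * Real.pi * Complex.I * lam * n - s * Real.log ((n : ℝ) + α))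

/-- The increment `log (n + 1 + α) - log (n + α)`. -/
noncomputable def logStep (α : ℝ) (n : ℕ) : ℝ :=
  Real.log ((n : ℝ) + 1 + α) - Real.log ((n : ℝ) + α)

theorem lerchTerm_eq {lam α : ℝ} (hα : 0 < α) (s : ℂ) (n : ℕ) :
    Complex.exp (2 * Real.pi * Complex.I * lam * n) / ((n : ℂ) + α) ^ s = lerchTerm lam α s n := by
  have hx : (0 : ℝ) < (n : ℝ) + α := by positivity
  have hx' : ((n : ℂ) + α) = (((n : ℝ) + α : ℝ) : ℂ) := by push_cast; rfl
  rw [lerchTerm, hx', Complex.cpow_def_of_ne_zero (by exact_mod_cast hx.ne'), ← Complex.ofReal_log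
    hx.le, Complex.exp_sub, mul_comm s]

theorem norm_lerchTerm {lam α : ℝ} (hα : 0 < α) (s : ℂ) (n : ℕ) :
    ‖lerchTerm lam α s n‖ = ((n : ℝ) + α) ^ (-s.re) := by
  have hx : (0 : ℝ) < (n : ℝ) + α := by positivity
  rw [lerchTerm, Complex.norm_exp, Real.rpow_def_of_pos hx]
  congr 1
  simp
  ring

theorem norm_lerchTerm_le {lam α : ℝ} (hα : 0 < α) {s : ℂ} (hs : 0 ≤ s.re) {n : ℕ} (hn : 1 ≤ n) :
    ‖lerchTerm lam α s n‖ ≤ (n : ℝ) ^ (-s.re) := by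
  rw [norm_lerchTerm hα]
  exact Real.rpow_le_rpow_of_nonpos (by exact_mod_cast hn) (by linarith) (by linarith)

theorem lerchTerm_succ (lam α : ℝ) (s : ℂ) (n : ℕ) :
    lerchTerm lam α s (n + 1) = Complex.exp (2 * Real.pi * Complex.I * lam - s * logStep α n)
      * lerchTerm lam α s n := by
  rw [lerchTerm, lerchTerm, ← Complex.exp_add, logStep]
  congr 1
  push_cast
  ring

section LogStep

variable {α : ℝ} (hα : 0 < α) (n : ℕ)
include hα

theorem inv_le_logStep : ((n : ℝ) + α + 1)⁻¹ ≤ logStep α n := by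
  have hx : (0 : ℝ) < (n : ℝ) + α := by positivity
  rw [logStep, show (n : ℝ) + 1 + α = (n : ℝ) + α + 1 by ring,
    ← Real.log_div (by positivity) hx.ne']
  have := Real.one_sub_inv_le_log_of_pos (x := ((n : ℝ) + α + 1) / ((n : ℝ) + α)) (by positivity)
  refine le_trans (le_of_eq ?_) this
  field_simp
  ring

theorem logStep_le_inv : logStep α n ≤ ((n : ℝ) + α)⁻¹ := by
  have hx : (0 : ℝ) < (n : ℝ) + α := by positivity
  rw [logStep, show (n : ℝ) + 1 + α = (n : ℝ) + α + 1 by ring,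
    ← Real.log_div (by positivity) hx.ne']
  have := Real.log_le_sub_one_of_pos (x := ((n : ℝ) + α + 1) / ((n : ℝ) + α)) (by positivity)
  refine this.trans (le_of_eq ?_)
  field_simp
  ring

theorem logStep_pos : 0 < logStep α n :=
  lt_of_lt_of_le (by positivity) (inv_le_logStep hα n)

/-- The second difference is the logarithm of one quotient, so 1 - 1/q ≤ log q ≤ q - 1 bounds it on
both sides. -/
theorem logStep_sub_eq : logStep α n - logStep α (n + 1)
    = Real.log (((n : ℝ) + α + 1) ^ 2 / (((n : ℝ) + α) * ((n : ℝ) + α + 2))) := by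
  have hx : (0 : ℝ) < (n : ℝ) + α := by positivity
  rw [Real.log_div (by positivity) (by positivity), Real.log_mul (by positivity) (by positivity),
    Real.log_pow, logStep, logStep]
  push_cast
  rw [show (n : ℝ) + 1 + α = (n : ℝ) + α + 1 by ring,
    show (n : ℝ) + 1 + 1 + α = (n : ℝ) + α + 2 by ring]
  ring

theorem logStep_sub_le :
    logStep α n - logStep α (n + 1) ≤ (((n : ℝ) + α) * ((n : ℝ) + α + 2))⁻¹ := by
  have hx : (0 : ℝ) < (n : ℝ) + α := by positivity
  rw [logStep_sub_eq hα]
  refine (Real.log_le_sub_one_of_pos (by positivity)).trans (le_of_eq ?_)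
  field_simp
  ring

theorem inv_sq_le_logStep_sub :
    (((n : ℝ) + α + 1) ^ 2)⁻¹ ≤ logStep α n - logStep α (n + 1) := by
  have hx : (0 : ℝ) < (n : ℝ) + α := by positivity
  rw [logStep_sub_eq hα]
  refine le_trans (le_of_eq ?_) (Real.one_sub_inv_le_log_of_pos (by positivity))
  field_simp
  ring

theorem logStep_succ_le : logStep α (n + 1) ≤ logStep α n := by
  have := inv_sq_le_logStep_sub hα n
  have h2 : 0 ≤ (((n : ℝ) + α + 1) ^ 2)⁻¹ := by positivity
  linarith

/-- The increments of `1 / log (1 + 1 / x)` are close to `1`. -/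
theorem abs_inv_logStep_sub_le :
    |(logStep α (n + 1))⁻¹ - (logStep α n)⁻¹ - 1| ≤ ((n : ℝ) + α)⁻¹ := by
  have hx : (0 : ℝ) < (n : ℝ) + α := by positivity
  set x : ℝ := (n : ℝ) + α with hxdef
  set a := logStep α n with ha
  set b := logStep α (n + 1) with hb
  have ha0 : 0 < a := logStep_pos hα n
  have hb0 : 0 < b := logStep_pos hα (n + 1)
  have ha1 : (x + 1)⁻¹ ≤ a := inv_le_logStep hα n
  have ha2 : a ≤ x⁻¹ := logStep_le_inv hα n
  have hb1 : (x + 2)⁻¹ ≤ b := by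
    have := inv_le_logStep hα (n + 1)
    push_cast at this
    rwa [show (n : ℝ) + 1 + α + 1 = x + 2 by rw [hxdef]; ring] at this
  have hb2 : b ≤ (x + 1)⁻¹ := by
    have := logStep_le_inv hα (n + 1)
    push_cast at this
    rwa [show (n : ℝ) + 1 + α = x + 1 by rw [hxdef]; ring] at this
  have hd1 : a - b ≤ (x * (x + 2))⁻¹ := logStep_sub_le hα n
  have hd2 : ((x + 1) ^ 2)⁻¹ ≤ a - b := inv_sq_le_logStep_sub hα n
  have hab1 : (x + 1)⁻¹ * (x + 2)⁻¹ ≤ a * b := by gcongr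
  have hab2 : a * b ≤ x⁻¹ * (x + 1)⁻¹ := by gcongr
  have e : b⁻¹ - a⁻¹ = (a - b) / (a * b) := by field_simp
  rw [e, abs_le]
  constructor
  · have : 1 - x⁻¹ ≤ (a - b) / (a * b) := by
      rw [le_div_iff₀ (by positivity)]
      rcases le_total x 1 with h1 | h1
      · have : 1 - x⁻¹ ≤ 0 := by rw [sub_nonpos]; exact (one_le_inv₀ hx).2 h1
        have h3 : 0 ≤ ((x + 1) ^ 2)⁻¹ := by positivity
        nlinarith [mul_pos ha0 hb0]
      · have h3 : 0 ≤ 1 - x⁻¹ := by rw [sub_nonneg]; exact inv_le_one_of_one_le₀ h1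
        calc (1 - x⁻¹) * (a * b) ≤ (1 - x⁻¹) * (x⁻¹ * (x + 1)⁻¹) := by gcongr
          _ ≤ ((x + 1) ^ 2)⁻¹ := by
            rw [← sub_nonneg]
            have : ((x + 1) ^ 2)⁻¹ - (1 - x⁻¹) * (x⁻¹ * (x + 1)⁻¹) = 1 / (x ^ 2 * (x + 1) ^ 2) := by
              field_simp; ring
            rw [this]; positivity
          _ ≤ a - b := hd2
    linarith
  · have : (a - b) / (a * b) ≤ 1 + x⁻¹ := by
      rw [div_le_iff₀ (by positivity)]
      calc a - b ≤ (x * (x + 2))⁻¹ := hd1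
        _ = (1 + x⁻¹) * ((x + 1)⁻¹ * (x + 2)⁻¹) := by field_simp
        _ ≤ (1 + x⁻¹) * (a * b) := by gcongr
    linarith

end LogStep

theorem sum_mul_sub_succ_eq (G b : ℕ → ℂ) {M N : ℕ} (h : M ≤ N) :
    ∑ n ∈ Finset.Ico M N, G n * (b n - b (n + 1)) = G M * b M - G N * b N
      + ∑ n ∈ Finset.Ico M N, (G (n + 1) - G n) * b (n + 1) := by
  induction N, h using Nat.le_induction with
  | base => simp
  | succ N hN ih =>
    rw [Finset.sum_Ico_succ_top hN, Finset.sum_Ico_succ_top hN, ih]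
    ring

/-- Summation by parts against a sequence of slow variation. -/
theorem norm_sum_mul_sub_succ_le {G b : ℕ → ℂ} {A σ : ℝ} (hσ : 1 / 2 ≤ σ) {M N : ℕ} (hM : 1 ≤ M)
    (h : M ≤ N) (hb : ∀ n, M ≤ n → ‖b n‖ ≤ (n : ℝ) ^ (-σ)) (hG : ∀ n, M ≤ n → ‖G n‖ ≤ A)
    (hG' : ∀ n, M ≤ n → ‖G (n + 1) - G n‖ ≤ A / ((n + 1 : ℕ) : ℝ)) :
    ‖∑ n ∈ Finset.Ico M N, G n * (b n - b (n + 1))‖ ≤ 4 * A * (M : ℝ) ^ (-σ) := by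
  have hA : 0 ≤ A := (norm_nonneg _).trans (hG M le_rfl)
  have hM0 : (1 : ℝ) ≤ M := by exact_mod_cast hM
  rw [sum_mul_sub_succ_eq G b h]
  have h1 : ‖G M * b M‖ ≤ A * (M : ℝ) ^ (-σ) := by
    rw [norm_mul]; gcongr
    · exact hG M le_rfl
    · exact hb M le_rfl
  have h2 : ‖G N * b N‖ ≤ A * (M : ℝ) ^ (-σ) := by
    rw [norm_mul]
    have : (N : ℝ) ^ (-σ) ≤ (M : ℝ) ^ (-σ) :=
      Real.rpow_le_rpow_of_nonpos (by linarith) (by exact_mod_cast h) (by linarith)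
    exact mul_le_mul (hG N h) ((hb N h).trans this) (norm_nonneg _) hA
  -- The increments of G gain a factor 1/(n+1), so the sum is compared with ∫ x^(-1-σ) dx; the 2
  -- comes from 1/σ ≤ 2.
  have h3 : ‖∑ n ∈ Finset.Ico M N, (G (n + 1) - G n) * b (n + 1)‖ ≤ 2 * A * (M : ℝ) ^ (-σ) := by
    have hterm : ∀ n ∈ Finset.Ico M N, ‖(G (n + 1) - G n) * b (n + 1)‖
        ≤ A * ((n + 1 : ℕ) : ℝ) ^ (-(1 + σ)) := by
      intro n hn
      have hn' := (Finset.mem_Ico.1 hn).1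
      have hpos : (0 : ℝ) < ((n + 1 : ℕ) : ℝ) := by positivity
      rw [norm_mul]
      refine (mul_le_mul (hG' n hn') (hb (n + 1) (by omega)) (norm_nonneg _)
        (by positivity)).trans (le_of_eq ?_)
      rw [neg_add, Real.rpow_add hpos, Real.rpow_neg_one]
      ring
    refine (norm_sum_le_of_le _ hterm).trans ?_
    rw [← Finset.mul_sum]
    have h4 := sum_Ico_succ_rpow_le (by linarith : 0 < σ) hM h
    have h5 : 1 / σ ≤ 2 := by rw [div_le_iff₀ (by linarith)]; linarith
    have h6 : 0 ≤ (M : ℝ) ^ (-σ) := by positivity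
    calc _ ≤ A * ((M : ℝ) ^ (-σ) * (1 / σ)) := by gcongr
      _ ≤ A * ((M : ℝ) ^ (-σ) * 2) := by gcongr
      _ = _ := by ring
  refine (norm_add_le _ _).trans ?_
  have := norm_sub_le (G M * b M) (G N * b N)
  linarith

theorem norm_cexp_neg_sub_one_le {u : ℂ} (hu : ‖u‖ ≤ 1) : ‖Complex.exp (-u) - 1‖ ≤ 2 * ‖u‖ := by
  simpa using Complex.norm_exp_sub_one_le (x := -u) (by simpa using hu)

theorem norm_cexp_neg_sub_cexp_neg_le {u v : ℂ} (hu : 0 ≤ u.re) (huv : ‖v - u‖ ≤ 1) :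
    ‖Complex.exp (-v) - Complex.exp (-u)‖ ≤ 2 * ‖v - u‖ := by
  have : Complex.exp (-v) - Complex.exp (-u)
      = Complex.exp (-u) * (Complex.exp (-(v - u)) - 1) := by
    rw [mul_sub, ← Complex.exp_add]; ring_nf
  rw [this, norm_mul, Complex.norm_exp]
  have h1 : Real.exp (-u).re ≤ 1 := by simpa using hu
  have h2 := norm_cexp_neg_sub_one_le huv
  calc _ ≤ 1 * (2 * ‖v - u‖) := by gcongr
    _ = _ := one_mul _

section NonInteger

variable {lam α : ℝ} (hα : 0 < α) {s : ℂ} (hs : 1 / 2 ≤ s.re) {c : ℝ} (hc : 0 < c)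
  (hlam : c ≤ ‖1 - Complex.exp (2 * Real.pi * Complex.I * lam)‖)
include hα hs hc hlam

/-- The series is nearly geometric: b(n+1) = ρ(n) b(n), where ρ(n) is close to e^(2πiλ) ≠ 1 once n
is large against ‖s‖. Hence b(n) = (1 - ρ(n))⁻¹ (b(n) - b(n+1)) with a slowly varying factor, to
which summation by parts applies. -/
theorem norm_sum_lerchTerm_le {M N : ℕ} (hM : 1 ≤ M) (hMs : 4 * ‖s‖ / c ≤ M) (h : M ≤ N) :
    ‖∑ n ∈ Finset.Ico M N, lerchTerm lam α s n‖ ≤ 16 / c * (M : ℝ) ^ (-s.re) := by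
  set e := Complex.exp (2 * Real.pi * Complex.I * lam) with he
  have hnorm : ‖e‖ = 1 := by
    rw [he, show (2 * Real.pi * Complex.I * lam : ℂ) = ((2 * Real.pi * lam : ℝ) : ℂ) * Complex.I by
      push_cast; ring, Complex.norm_exp_ofReal_mul_I]
  have hc2 : c ≤ 2 := hlam.trans ((norm_sub_le _ _).trans (by rw [hnorm, norm_one]; norm_num))
  set ρ : ℕ → ℂ := fun n => e * Complex.exp (-(s * logStep α n)) with hρ
  have hstep (n : ℕ) : lerchTerm lam α s (n + 1) = ρ n * lerchTerm lam α s n := by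
    rw [lerchTerm_succ, hρ, he]
    simp only
    rw [← Complex.exp_add, sub_eq_add_neg]
  -- With c/4 here, ρ(n) is within c/2 of its limit, which keeps it at distance at least c/2 from 1.
  have hu (n : ℕ) (hn : M ≤ n) : ‖s * logStep α n‖ ≤ c / 4 := by
    have hn0 : (0 : ℝ) < n := by exact_mod_cast hM.trans hn
    have h1 := logStep_le_inv hα n
    have h2 : ((n : ℝ) + α)⁻¹ ≤ (n : ℝ)⁻¹ := by gcongr; linarith
    have h3 : 4 * ‖s‖ / c ≤ n := hMs.trans (by exact_mod_cast hn)
    rw [norm_mul, Complex.norm_real, Real.norm_of_nonneg (logStep_pos hα n).le]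
    calc ‖s‖ * logStep α n ≤ ‖s‖ * (n : ℝ)⁻¹ := by gcongr; exact h1.trans h2
      _ ≤ c / 4 := by
        rw [div_le_iff₀ hc] at h3
        rw [← div_eq_mul_inv, div_le_iff₀ hn0]
        linarith
  have hre (n : ℕ) : 0 ≤ (s * logStep α n).re := by
    rw [Complex.re_mul_ofReal]
    exact mul_nonneg (by linarith) (logStep_pos hα n).le
  have hlow (n : ℕ) (hn : M ≤ n) : c / 2 ≤ ‖1 - ρ n‖ := by
    have h1 := norm_cexp_neg_sub_one_le (u := s * logStep α n) (by linarith [hu n hn])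
    have h2 : ‖ρ n - e‖ ≤ c / 2 := by
      rw [show ρ n - e = e * (Complex.exp (-(s * logStep α n)) - 1) by simp only [hρ]; ring,
        norm_mul, hnorm, one_mul]
      linarith [hu n hn]
    have h3 : ‖1 - e‖ ≤ ‖1 - ρ n‖ + ‖ρ n - e‖ := by
      calc ‖1 - e‖ = ‖(1 - ρ n) + (ρ n - e)‖ := by ring_nf
        _ ≤ _ := norm_add_le _ _
    linarith
  have hne (n : ℕ) (hn : M ≤ n) : 1 - ρ n ≠ 0 := fun h0 => by
    have := hlow n hn
    rw [h0, norm_zero] at this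
    linarith
  have hsum : ∑ n ∈ Finset.Ico M N, lerchTerm lam α s n = ∑ n ∈ Finset.Ico M N,
      (1 - ρ n)⁻¹ * (lerchTerm lam α s n - lerchTerm lam α s (n + 1)) := by
    refine Finset.sum_congr rfl fun n hn => ?_
    rw [hstep, ← one_sub_mul, ← mul_assoc, inv_mul_cancel₀ (hne n (Finset.mem_Ico.1 hn).1), one_mul]
  rw [hsum, show 16 / c = 4 * (4 / c) by ring]
  refine norm_sum_mul_sub_succ_le hs hM h (fun n hn => norm_lerchTerm_le hα (by linarith)
    (hM.trans hn)) (fun n hn => ?_) fun n hn => ?_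
  · rw [norm_inv]
    calc ‖1 - ρ n‖⁻¹ ≤ (c / 2)⁻¹ := by gcongr; exact hlow n hn
      _ ≤ 4 / c := by rw [inv_div]; gcongr; norm_num
  · have hn0 : (1 : ℝ) ≤ n := by exact_mod_cast hM.trans hn
    have hd0 := logStep_succ_le hα n
    have hdiff : ‖s * logStep α (n + 1) - s * logStep α n‖ ≤ c / (4 * n) := by
      rw [← mul_sub, norm_mul, ← Complex.ofReal_sub, Complex.norm_real, Real.norm_eq_abs,
        abs_sub_comm, abs_of_nonneg (by linarith)]
      have h1 := logStep_sub_le hα n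
      have h2 : (((n : ℝ) + α) * ((n : ℝ) + α + 2))⁻¹ ≤ ((n : ℝ) * n)⁻¹ := by
        gcongr <;> linarith
      have h3 : 4 * ‖s‖ / c ≤ n := hMs.trans (by exact_mod_cast hn)
      rw [div_le_iff₀ hc] at h3
      calc ‖s‖ * (logStep α n - logStep α (n + 1)) ≤ (n * c / 4) * ((n : ℝ) * n)⁻¹ := by
            gcongr
            · linarith
            · exact h1.trans h2
        _ = c / (4 * n) := by field_simp
    have hdiff1 : c / (4 * n) ≤ 1 := by
      rw [div_le_one (by positivity)]; linarith
    have hρd : ‖ρ (n + 1) - ρ n‖ ≤ c / (2 * n) := by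
      simp only [hρ]
      rw [← mul_sub, norm_mul, hnorm, one_mul]
      refine (norm_cexp_neg_sub_cexp_neg_le (hre n) (hdiff.trans hdiff1)).trans ?_
      calc _ ≤ 2 * (c / (4 * n)) := by gcongr
        _ = _ := by field_simp; norm_num
    have heq : (1 - ρ (n + 1))⁻¹ - (1 - ρ n)⁻¹
        = (ρ (n + 1) - ρ n) * ((1 - ρ (n + 1))⁻¹ * (1 - ρ n)⁻¹) := by
      have h1 := hne n hn
      have h2 := hne (n + 1) (by omega)
      field_simp
      ring
    rw [heq, norm_mul, norm_mul, norm_inv, norm_inv]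
    have i1 : ‖1 - ρ (n + 1)‖⁻¹ ≤ (c / 2)⁻¹ := by gcongr; exact hlow (n + 1) (by omega)
    have i2 : ‖1 - ρ n‖⁻¹ ≤ (c / 2)⁻¹ := by gcongr; exact hlow n hn
    calc _ ≤ c / (2 * n) * ((c / 2)⁻¹ * (c / 2)⁻¹) := by gcongr
      _ = 2 / (c * n) := by field_simp
      _ ≤ 4 / c / ((n + 1 : ℕ) : ℝ) := by
        push_cast
        rw [div_div, div_le_div_iff₀ (by positivity) (by positivity)]
        nlinarith

theorem tendsto_sum_lerchTerm : ∃ L, Tendsto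
    (fun N => ∑ n ∈ Finset.range N, lerchTerm lam α s n) atTop (𝓝 L) := by
  refine cauchySeq_tendsto_of_complete ?_
  rw [Metric.cauchySeq_iff']
  intro ε hε
  have hlim : Tendsto (fun M : ℕ => 16 / c * (M : ℝ) ^ (-s.re)) atTop (𝓝 0) := by
    have := ((tendsto_rpow_neg_atTop (by linarith : 0 < s.re)).comp
      tendsto_natCast_atTop_atTop).const_mul (16 / c)
    simpa using this
  obtain ⟨M, h1, h2, h3⟩ := ((hlim.eventually (gt_mem_nhds hε)).and
    ((eventually_ge_atTop 1).and
      (tendsto_natCast_atTop_atTop.eventually_ge_atTop (4 * ‖s‖ / c)))).exists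
  refine ⟨M, fun N hN => ?_⟩
  rw [dist_eq_norm, ← Finset.sum_Ico_eq_sub _ hN]
  exact (norm_sum_lerchTerm_le hα hs hc hlam h2 h3 hN).trans_lt h1

theorem norm_limit_sub_sum_le {L : ℂ} (hL : Tendsto
    (fun N => ∑ n ∈ Finset.range N, lerchTerm lam α s n) atTop (𝓝 L)) {M : ℕ} (hM : 1 ≤ M)
    (hMs : 4 * ‖s‖ / c ≤ M) :
    ‖L - ∑ n ∈ Finset.range M, lerchTerm lam α s n‖ ≤ 16 / c * (M : ℝ) ^ (-s.re) := by
  refine le_of_tendsto (hL.sub_const _).norm ?_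
  filter_upwards [eventually_ge_atTop M] with N hN
  rw [← Finset.sum_Ico_eq_sub _ hN]
  exact norm_sum_lerchTerm_le hα hs hc hlam hM hMs hN

end NonInteger


/-! ### The Hurwitz case: partial sums completed by the integral of the tail -/

/-- The entire function `(1 - e^{-u}) / u`, away from `0`. -/
noncomputable def expQuot (u : ℂ) : ℂ := (1 - Complex.exp (-u)) / u

theorem norm_cexp_neg_sub_one_add_le {u : ℂ} (hu : ‖u‖ ≤ 1) :
    ‖Complex.exp (-u) - 1 + u‖ ≤ ‖u‖ ^ 2 := by
  simpa using Complex.norm_exp_sub_one_sub_id_le (x := -u) (by simpa using hu)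

theorem norm_expQuot_sub_one_le {u : ℂ} (hu0 : u ≠ 0) (hu : ‖u‖ ≤ 1) : ‖expQuot u - 1‖ ≤ ‖u‖ := by
  have h : expQuot u - 1 = -(Complex.exp (-u) - 1 + u) / u := by
    rw [expQuot]; field_simp; ring
  rw [h, norm_div, norm_neg, div_le_iff₀ (norm_pos_iff.2 hu0), ← sq]
  exact norm_cexp_neg_sub_one_add_le hu

theorem half_le_norm_expQuot {u : ℂ} (hu0 : u ≠ 0) (hu : ‖u‖ ≤ 1 / 2) : 1 / 2 ≤ ‖expQuot u‖ := by
  have h1 := norm_expQuot_sub_one_le hu0 (by linarith)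
  have h2 : ‖(1 : ℂ)‖ ≤ ‖expQuot u‖ + ‖expQuot u - 1‖ := by
    calc ‖(1 : ℂ)‖ = ‖expQuot u - (expQuot u - 1)‖ := by ring_nf
      _ ≤ _ := norm_sub_le _ _
  rw [norm_one] at h2
  linarith

/-- A Lipschitz bound without derivatives: with d = u - v, the difference over the common
denominator uv involves only e^v - 1 - v and e^(-d) - 1 + d, which are quadratically small. -/
theorem norm_expQuot_sub_le {u v : ℂ} (hu : ‖u‖ ≤ 1) (hv0 : v ≠ 0) (hvre : 0 ≤ v.re)
    (hvu : ‖v‖ ≤ ‖u‖) (hd : ‖u - v‖ ≤ ‖u‖) : ‖expQuot u - expQuot v‖ ≤ 2 * ‖u - v‖ := by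
  have hu0 : u ≠ 0 := fun h => hv0 (by
    rw [h, norm_zero] at hvu; exact norm_le_zero_iff.1 hvu)
  set d := u - v with hdd
  have hud : u = v + d := by rw [hdd]; ring
  have hexp : Complex.exp (-u) = Complex.exp (-v) * Complex.exp (-d) := by
    rw [← Complex.exp_add, hud]; ring_nf
  have hinv : Complex.exp (-v) * Complex.exp v = 1 := by
    rw [← Complex.exp_add]; simp
  have h : expQuot u - expQuot v = Complex.exp (-v) *
      (-(d * (Complex.exp v - 1 - v)) - v * (Complex.exp (-d) - 1 + d)) / (u * v) := by
    rw [expQuot, expQuot, div_sub_div _ _ hu0 hv0, hexp]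
    congr 1
    rw [hud]
    linear_combination d * hinv
  have hev : ‖Complex.exp (-v)‖ ≤ 1 := by
    rw [Complex.norm_exp]; simpa using hvre
  have h1 : ‖Complex.exp v - 1 - v‖ ≤ ‖v‖ ^ 2 :=
    Complex.norm_exp_sub_one_sub_id_le (hvu.trans hu)
  have h2 : ‖Complex.exp (-d) - 1 + d‖ ≤ ‖d‖ ^ 2 := norm_cexp_neg_sub_one_add_le (hd.trans hu)
  have hup : 0 < ‖u‖ := norm_pos_iff.2 hu0
  have hvp : 0 < ‖v‖ := norm_pos_iff.2 hv0
  rw [h, norm_div, norm_mul, norm_mul, div_le_iff₀ (by positivity)]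
  calc _ ≤ 1 * (‖d‖ * ‖v‖ ^ 2 + ‖v‖ * ‖d‖ ^ 2) := by
        gcongr
        refine (norm_sub_le _ _).trans ?_
        rw [norm_neg, norm_mul, norm_mul]
        gcongr
    _ = ‖d‖ * ‖v‖ * (‖v‖ + ‖d‖) := by ring
    _ ≤ ‖d‖ * ‖v‖ * (‖u‖ + ‖u‖) := by gcongr
    _ = _ := by ring

/-- The correction term in the comparison of the Hurwitz series with its integral. -/
noncomputable def eulerCorrection (α : ℝ) (s : ℂ) (n : ℕ) : ℂ :=
  s / (1 - Complex.exp (-(s * logStep α n))) - ((n : ℝ) + α : ℝ) - 1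

theorem half_le_norm_of_half_le_re {s : ℂ} (hs : 1 / 2 ≤ s.re) : 1 / 2 ≤ ‖s‖ :=
  hs.trans (Complex.re_le_norm s)

theorem norm_mul_logStep_le {α : ℝ} (hα : 0 < α) (s : ℂ) {n : ℕ} (hn : 1 ≤ n) :
    ‖s * logStep α n‖ ≤ ‖s‖ / n := by
  have hn0 : (0 : ℝ) < n := by exact_mod_cast hn
  have h1 := logStep_le_inv hα n
  have h2 : ((n : ℝ) + α)⁻¹ ≤ (n : ℝ)⁻¹ := by gcongr; linarith
  rw [norm_mul, Complex.norm_real, Real.norm_of_nonneg (logStep_pos hα n).le, div_eq_mul_inv]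
  gcongr
  exact h1.trans h2

theorem mul_logStep_ne_zero {α : ℝ} (hα : 0 < α) {s : ℂ} (hs : 1 / 2 ≤ s.re) {n : ℕ} :
    s * logStep α n ≠ 0 := by
  have h1 : s ≠ 0 := fun h => by rw [h, Complex.zero_re] at hs; linarith
  exact mul_ne_zero h1 (by exact_mod_cast (logStep_pos hα n).ne')

/-- Separates the two causes of the correction: `expQuot` is not exactly 1, and the inverse log
increment is not exactly n + α + 1. Each is bounded on its own. -/
theorem eulerCorrection_eq {α : ℝ} (hα : 0 < α) (s : ℂ) (n : ℕ) : eulerCorrection α s n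
    = ((expQuot (s * logStep α n))⁻¹ - 1) * ((logStep α n)⁻¹ : ℝ)
      + (((logStep α n)⁻¹ - ((n : ℝ) + α) - 1 : ℝ) : ℂ) := by
  have h0 : (logStep α n : ℂ) ≠ 0 := by exact_mod_cast (logStep_pos hα n).ne'
  rw [eulerCorrection, expQuot, inv_div]
  push_cast
  field_simp
  ring

theorem norm_mul_logStep_le_half {α : ℝ} (hα : 0 < α) {s : ℂ} {n : ℕ} (hn : 1 ≤ n)
    (hns : 2 * ‖s‖ ≤ n) : ‖s * logStep α n‖ ≤ 1 / 2 := by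
  refine (norm_mul_logStep_le hα s hn).trans ?_
  have hn0 : (0 : ℝ) < n := by exact_mod_cast hn
  rw [div_le_iff₀ hn0]
  linarith

section Correction

variable {α : ℝ} (hα : 0 < α) {s : ℂ} (hs : 1 / 2 ≤ s.re) {n : ℕ} (hn : 1 ≤ n)
  (hns : 2 * ‖s‖ ≤ n)
include hα hs hn hns

theorem one_sub_cexp_ne_zero : 1 - Complex.exp (-(s * logStep α n)) ≠ 0 := by
  have h1 := half_le_norm_expQuot (mul_logStep_ne_zero hα hs)
    (norm_mul_logStep_le_half hα hn hns)
  intro h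
  rw [expQuot, h, zero_div, norm_zero] at h1
  linarith

theorem norm_inv_expQuot_sub_one_le :
    ‖(expQuot (s * logStep α n))⁻¹ - 1‖ ≤ 2 * ‖s * logStep α n‖ := by
  set u := s * logStep α n
  have hu0 : u ≠ 0 := mul_logStep_ne_zero hα hs
  have hu : ‖u‖ ≤ 1 / 2 := norm_mul_logStep_le_half hα hn hns
  have hP := half_le_norm_expQuot hu0 hu
  have hP0 : expQuot u ≠ 0 := norm_pos_iff.1 (by linarith)
  rw [show (expQuot u)⁻¹ - 1 = -(expQuot u - 1) * (expQuot u)⁻¹ by field_simp; ring, norm_mul,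
    norm_neg, norm_inv, mul_comm]
  have : ‖expQuot u‖⁻¹ ≤ 2 := by
    rw [inv_le_comm₀ (by linarith) (by norm_num)]; linarith
  gcongr
  exact norm_expQuot_sub_one_le hu0 (by linarith)

/-- The argument gives 2‖s‖ + 1. The constant 28 is the one needed for the increments, since
`norm_sum_mul_sub_succ_le` uses a single constant for both. -/
theorem norm_eulerCorrection_le : ‖eulerCorrection α s n‖ ≤ 28 * ‖s‖ := by
  have hs' := half_le_norm_of_half_le_re hs
  have hL := logStep_pos hα n
  rw [eulerCorrection_eq hα s]
  have h1 : ‖((expQuot (s * logStep α n))⁻¹ - 1) * ((logStep α n)⁻¹ : ℝ)‖ ≤ 2 * ‖s‖ := by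
    rw [norm_mul, Complex.norm_real, norm_inv, Real.norm_of_nonneg hL.le]
    have h := norm_inv_expQuot_sub_one_le hα hs hn hns
    rw [norm_mul, Complex.norm_real, Real.norm_of_nonneg hL.le] at h
    calc _ ≤ 2 * (‖s‖ * logStep α n) * (logStep α n)⁻¹ := by gcongr
      _ = 2 * ‖s‖ := by field_simp
  have h2 : ‖(((logStep α n)⁻¹ - ((n : ℝ) + α) - 1 : ℝ) : ℂ)‖ ≤ 1 := by
    rw [Complex.norm_real, Real.norm_eq_abs, abs_le]
    have a1 := inv_le_logStep hα n
    have a2 := logStep_le_inv hα n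
    have b1 : (logStep α n)⁻¹ ≤ (n : ℝ) + α + 1 := by
      rwa [inv_le_comm₀ hL (by positivity)]
    have b2 : (n : ℝ) + α ≤ (logStep α n)⁻¹ := by
      rwa [le_inv_comm₀ (by positivity) hL]
    constructor <;> linarith
  refine (norm_add_le _ _).trans ?_
  linarith

/-- Three changes occur: of 1/`expQuot`, of the inverse log increment multiplying 1/`expQuot` - 1,
and of the inverse log increment minus its main value 1. They cost 8, 4 and 2 times ‖s‖/n, and
passing from n to n + 1 doubles the total 14. -/
theorem norm_eulerCorrection_succ_sub_le :
    ‖eulerCorrection α s (n + 1) - eulerCorrection α s n‖ ≤ 28 * ‖s‖ / ((n + 1 : ℕ) : ℝ) := by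
  have hs' := half_le_norm_of_half_le_re hs
  have hn0 : (1 : ℝ) ≤ n := by exact_mod_cast hn
  have hns' : 2 * ‖s‖ ≤ ((n + 1 : ℕ) : ℝ) := by push_cast; linarith
  have hn' : 1 ≤ n + 1 := by omega
  have hx : (0 : ℝ) < (n : ℝ) + α := by positivity
  rw [eulerCorrection_eq hα s, eulerCorrection_eq hα s]
  have hφ := abs_inv_logStep_sub_le hα n
  have hd := logStep_sub_le hα n
  have hd0 := logStep_succ_le hα n
  have hu := norm_mul_logStep_le_half hα hn hns
  have hv := norm_mul_logStep_le_half hα hn' hns'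
  have hu0 := mul_logStep_ne_zero hα hs (n := n)
  have hv0 := mul_logStep_ne_zero hα hs (n := n + 1)
  have hPu := half_le_norm_expQuot hu0 hu
  have hPv := half_le_norm_expQuot hv0 hv
  have hp := norm_inv_expQuot_sub_one_le hα hs hn hns
  have hle := norm_mul_logStep_le hα s hn
  have ha0 := logStep_pos hα n
  have hb0 := logStep_pos hα (n + 1)
  have hb1 : (logStep α (n + 1))⁻¹ ≤ (n : ℝ) + α + 2 := by
    have := inv_le_logStep hα (n + 1)
    rw [inv_le_comm₀ hb0 (by positivity)]
    push_cast at this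
    rwa [show (n : ℝ) + 1 + α + 1 = (n : ℝ) + α + 2 by ring] at this
  set a := logStep α n with ha
  set b := logStep α (n + 1) with hb
  set P := expQuot (s * a) with hPdef
  set Q := expQuot (s * b) with hQdef
  have hdiff : ‖s * (a : ℂ) - s * b‖ = ‖s‖ * (a - b) := by
    rw [← mul_sub, norm_mul, ← Complex.ofReal_sub, Complex.norm_real,
      Real.norm_of_nonneg (by linarith)]
  have hPQ : ‖P - Q‖ ≤ 2 * (‖s‖ * (a - b)) := by
    rw [← hdiff]
    refine norm_expQuot_sub_le (by linarith) hv0 ?_ ?_ ?_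
    · rw [Complex.re_mul_ofReal]; exact mul_nonneg (by linarith) hb0.le
    · rw [norm_mul, norm_mul, Complex.norm_real, Complex.norm_real, Real.norm_of_nonneg ha0.le,
        Real.norm_of_nonneg hb0.le]
      gcongr
    · rw [hdiff, norm_mul, Complex.norm_real, Real.norm_of_nonneg ha0.le]
      gcongr
      linarith
  have hP0 : P ≠ 0 := norm_pos_iff.1 (by linarith)
  have hQ0 : Q ≠ 0 := norm_pos_iff.1 (by linarith)
  have hinv : ‖Q⁻¹ - P⁻¹‖ ≤ 8 * (‖s‖ * (a - b)) := by
    rw [show Q⁻¹ - P⁻¹ = (P - Q) * (P⁻¹ * Q⁻¹) by field_simp, norm_mul, norm_mul, norm_inv, norm_inv]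
    have i1 : ‖P‖⁻¹ ≤ 2 := by rw [inv_le_comm₀ (by linarith) (by norm_num)]; linarith
    have i2 : ‖Q‖⁻¹ ≤ 2 := by rw [inv_le_comm₀ (by linarith) (by norm_num)]; linarith
    have hab : 0 ≤ a - b := by linarith
    calc _ ≤ 2 * (‖s‖ * (a - b)) * (2 * 2) := by gcongr
      _ = _ := by ring
  have hx1 : ((n : ℝ) + α)⁻¹ ≤ (n : ℝ)⁻¹ := by gcongr; linarith
  have hn1 : (n : ℝ)⁻¹ ≤ 1 := inv_le_one_of_one_le₀ hn0
  have t1 : ‖(Q⁻¹ - P⁻¹) * ((b⁻¹ : ℝ) : ℂ)‖ ≤ 8 * ‖s‖ * (n : ℝ)⁻¹ := by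
    rw [norm_mul, Complex.norm_real, norm_inv, Real.norm_of_nonneg hb0.le]
    have hab : 0 ≤ a - b := by linarith
    calc _ ≤ 8 * (‖s‖ * (((n : ℝ) + α) * ((n : ℝ) + α + 2))⁻¹) * ((n : ℝ) + α + 2) := by
          gcongr
          refine hinv.trans ?_
          gcongr
      _ = 8 * ‖s‖ * ((n : ℝ) + α)⁻¹ := by field_simp
      _ ≤ _ := by gcongr
  have hba : |b⁻¹ - a⁻¹| ≤ 2 := by
    have := abs_le.1 hφ
    rw [abs_le]; constructor <;> linarith
  have t2 : ‖(P⁻¹ - 1) * ((b⁻¹ - a⁻¹ : ℝ) : ℂ)‖ ≤ 4 * ‖s‖ * (n : ℝ)⁻¹ := by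
    rw [norm_mul, Complex.norm_real, Real.norm_eq_abs]
    calc _ ≤ 2 * (‖s‖ / n) * 2 := by
          gcongr
          exact hp.trans (by gcongr)
      _ = _ := by rw [div_eq_mul_inv]; ring
  have t3 : ‖((b⁻¹ - a⁻¹ - 1 : ℝ) : ℂ)‖ ≤ 2 * ‖s‖ * (n : ℝ)⁻¹ := by
    rw [Complex.norm_real, Real.norm_eq_abs]
    refine (hφ.trans hx1).trans ?_
    have : 0 < (n : ℝ)⁻¹ := by positivity
    nlinarith
  have heq : (Q⁻¹ - 1) * ((b⁻¹ : ℝ) : ℂ) + ((b⁻¹ - (((n + 1 : ℕ) : ℝ) + α) - 1 : ℝ) : ℂ)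
      - ((P⁻¹ - 1) * ((a⁻¹ : ℝ) : ℂ) + ((a⁻¹ - ((n : ℝ) + α) - 1 : ℝ) : ℂ))
      = (Q⁻¹ - P⁻¹) * ((b⁻¹ : ℝ) : ℂ) + (P⁻¹ - 1) * ((b⁻¹ - a⁻¹ : ℝ) : ℂ)
        + ((b⁻¹ - a⁻¹ - 1 : ℝ) : ℂ) := by
    push_cast; ring
  rw [heq]
  calc _ ≤ 8 * ‖s‖ * (n : ℝ)⁻¹ + 4 * ‖s‖ * (n : ℝ)⁻¹ + 2 * ‖s‖ * (n : ℝ)⁻¹ :=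
        (norm_add_le _ _).trans (add_le_add ((norm_add_le _ _).trans (add_le_add t1 t2)) t3)
    _ = 14 * ‖s‖ / n := by rw [div_eq_mul_inv]; ring
    _ ≤ _ := by
      push_cast
      rw [div_le_div_iff₀ (by positivity) (by positivity)]
      nlinarith

end Correction

/-- Partial sums of the Hurwitz series, completed by the integral of the tail. -/
noncomputable def hurwitzApprox (α : ℝ) (N : ℕ) (s : ℂ) : ℂ :=
  ∑ n ∈ Finset.range N, lerchTerm 0 α s n + ((N : ℝ) + α : ℝ) * lerchTerm 0 α s N / (s - 1)

section Hurwitz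

variable {α : ℝ} (hα : 0 < α) {s : ℂ} (hs : 1 / 2 ≤ s.re)
include hα hs

/-- `eulerCorrection` is defined so that this identity holds. Writing b(n+1) = ρ b(n) and s b(n) = s
(1 - ρ)⁻¹ (b(n) - b(n+1)), the increment of the completed sum becomes a slowly varying multiple of
b(n) - b(n+1), as in the non-integral case. -/
theorem hurwitzApprox_succ_sub (hs1 : s ≠ 1) {n : ℕ} (hn : 1 ≤ n) (hns : 2 * ‖s‖ ≤ n) :
    hurwitzApprox α (n + 1) s - hurwitzApprox α n s = (s - 1)⁻¹ *
      (eulerCorrection α s n * (lerchTerm 0 α s n - lerchTerm 0 α s (n + 1))) := by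
  have h0 := one_sub_cexp_ne_zero hα hs hn hns
  have h1 : s - 1 ≠ 0 := sub_ne_zero.2 hs1
  have hstep : lerchTerm 0 α s (n + 1)
      = Complex.exp (-(s * logStep α n)) * lerchTerm 0 α s n := by
    rw [lerchTerm_succ]; simp
  rw [hurwitzApprox, hurwitzApprox, Finset.sum_range_succ, eulerCorrection, hstep]
  push_cast
  field_simp
  ring

theorem norm_hurwitzApprox_sub_le (hs1 : s ≠ 1) {M N : ℕ} (hM : 1 ≤ M) (hMs : 2 * ‖s‖ ≤ M)
    (h : M ≤ N) : ‖hurwitzApprox α N s - hurwitzApprox α M s‖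
      ≤ 112 * (‖s‖ / ‖s - 1‖) * (M : ℝ) ^ (-s.re) := by
  have hsum : hurwitzApprox α N s - hurwitzApprox α M s = (s - 1)⁻¹ * ∑ n ∈ Finset.Ico M N,
      eulerCorrection α s n * (lerchTerm 0 α s n - lerchTerm 0 α s (n + 1)) := by
    rw [Finset.mul_sum, ← Finset.sum_Ico_sub (fun n => hurwitzApprox α n s) h]
    refine Finset.sum_congr rfl fun n hn => ?_
    have hn' := (Finset.mem_Ico.1 hn).1
    exact hurwitzApprox_succ_sub hα hs hs1 (hM.trans hn') (hMs.trans (by exact_mod_cast hn'))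
  rw [hsum, norm_mul, norm_inv]
  have := norm_sum_mul_sub_succ_le (G := eulerCorrection α s) (b := lerchTerm 0 α s)
    (A := 28 * ‖s‖) hs hM h (fun n hn => norm_lerchTerm_le hα (by linarith) (hM.trans hn))
    (fun n hn => norm_eulerCorrection_le hα hs (hM.trans hn) (hMs.trans (by exact_mod_cast hn)))
    (fun n hn => norm_eulerCorrection_succ_sub_le hα hs (hM.trans hn)
      (hMs.trans (by exact_mod_cast hn)))
  calc _ ≤ ‖s - 1‖⁻¹ * (4 * (28 * ‖s‖) * (M : ℝ) ^ (-s.re)) := by gcongr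
    _ = _ := by rw [div_eq_mul_inv]; ring

theorem exists_tendsto_hurwitzApprox (hs1 : s ≠ 1) :
    ∃ L, Tendsto (fun N => hurwitzApprox α N s) atTop (𝓝 L) := by
  refine cauchySeq_tendsto_of_complete ?_
  rw [Metric.cauchySeq_iff']
  intro ε hε
  have hlim : Tendsto (fun M : ℕ => 112 * (‖s‖ / ‖s - 1‖) * (M : ℝ) ^ (-s.re)) atTop (𝓝 0) := by
    have := ((tendsto_rpow_neg_atTop (by linarith : 0 < s.re)).comp
      tendsto_natCast_atTop_atTop).const_mul (112 * (‖s‖ / ‖s - 1‖))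
    simpa using this
  obtain ⟨M, h1, h2, h3⟩ := ((hlim.eventually (gt_mem_nhds hε)).and
    ((eventually_ge_atTop 1).and
      (tendsto_natCast_atTop_atTop.eventually_ge_atTop (2 * ‖s‖)))).exists
  refine ⟨M, fun N hN => ?_⟩
  rw [dist_eq_norm]
  exact (norm_hurwitzApprox_sub_le hα hs hs1 h2 h3 hN).trans_lt h1

theorem norm_limit_sub_hurwitzApprox_le (hs1 : s ≠ 1) {L : ℂ}
    (hL : Tendsto (fun N => hurwitzApprox α N s) atTop (𝓝 L)) {M : ℕ} (hM : 1 ≤ M)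
    (hMs : 2 * ‖s‖ ≤ M) :
    ‖L - hurwitzApprox α M s‖ ≤ 112 * (‖s‖ / ‖s - 1‖) * (M : ℝ) ^ (-s.re) := by
  refine le_of_tendsto (hL.sub_const _).norm ?_
  filter_upwards [eventually_ge_atTop M] with N hN
  exact norm_hurwitzApprox_sub_le hα hs hs1 hM hMs hN

end Hurwitz

theorem tendsto_hurwitzApprox_of_one_lt_re {α : ℝ} (hα : 0 < α) (hα1 : α ≤ 1) {s : ℂ}
    (hs : 1 < s.re) : Tendsto (fun N => hurwitzApprox α N s) atTop
      (𝓝 (HurwitzZeta.hurwitzZeta (α : UnitAddCircle) s)) := by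
  have h1 := (HurwitzZeta.hasSum_hurwitzZeta_of_one_lt_re (a := α) ⟨hα.le, hα1⟩ hs).tendsto_sum_nat
  have hterm (n : ℕ) : 1 / ((n : ℂ) + α) ^ s = lerchTerm 0 α s n := by
    rw [← lerchTerm_eq hα]; simp
  simp_rw [hterm] at h1
  have h2 : Tendsto (fun N : ℕ => (((N : ℝ) + α : ℝ) : ℂ) * lerchTerm 0 α s N / (s - 1)) atTop
      (𝓝 0) := by
    rw [tendsto_zero_iff_norm_tendsto_zero]
    have hn (N : ℕ) : ‖(((N : ℝ) + α : ℝ) : ℂ) * lerchTerm 0 α s N / (s - 1)‖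
        = ((N : ℝ) + α) ^ (-(s.re - 1)) / ‖s - 1‖ := by
      have hx : (0 : ℝ) < (N : ℝ) + α := by positivity
      rw [norm_div, norm_mul, norm_lerchTerm hα, Complex.norm_real, Real.norm_of_nonneg hx.le,
        show -(s.re - 1) = 1 + -s.re by ring, Real.rpow_add hx, Real.rpow_one]
    simp_rw [hn]
    have h3 : Tendsto (fun N : ℕ => (N : ℝ) + α) atTop atTop :=
      tendsto_atTop_add_const_right _ _ tendsto_natCast_atTop_atTop
    simpa using ((tendsto_rpow_neg_atTop (by linarith : 0 < s.re - 1)).comp h3).div_const ‖s - 1‖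
  have := h1.add h2
  rwa [add_zero] at this

theorem differentiable_lerchTerm (lam α : ℝ) (n : ℕ) :
    Differentiable ℂ fun s => lerchTerm lam α s n := by
  unfold lerchTerm
  fun_prop

/-- The completed partial sums converge to the Hurwitz zeta-function to the right of the line
`Re s = 1 / 2` in the upper half-plane. -/
theorem tendsto_hurwitzApprox {α : ℝ} (hα : 0 < α) (hα1 : α ≤ 1) {s : ℂ} (hs : 1 / 2 < s.re)
    (him : 0 < s.im) : Tendsto (fun N => hurwitzApprox α N s) atTop
      (𝓝 (HurwitzZeta.hurwitzZeta (α : UnitAddCircle) s)) := by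
  -- A convex region that avoids the pole s = 1 and meets Re s > 1, where the limit is known.
  set U : Set ℂ := {s | 1 / 2 < s.re} ∩ {s | 0 < s.im} with hU
  have hUo : IsOpen U :=
    (isOpen_lt continuous_const Complex.continuous_re).inter
      (isOpen_lt continuous_const Complex.continuous_im)
  have hUc : IsPreconnected U :=
    ((convex_halfSpace_re_gt (1 / 2)).inter (convex_halfSpace_im_gt 0)).isPreconnected
  have hne1 : ∀ s ∈ U, s ≠ 1 := by
    rintro s ⟨-, h⟩ rfl
    simp at h
  have hex : ∀ s : ℂ, ∃ L, s ∈ U → Tendsto (fun N => hurwitzApprox α N s) atTop (𝓝 L) := by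
    intro s
    by_cases h : s ∈ U
    · obtain ⟨L, hL⟩ := exists_tendsto_hurwitzApprox hα (le_of_lt h.1) (hne1 s h)
      exact ⟨L, fun _ => hL⟩
    · exact ⟨0, fun h' => absurd h' h⟩
  choose F hF using hex
  have hunif : TendstoLocallyUniformlyOn (hurwitzApprox α) F atTop U := by
    rw [Metric.tendstoLocallyUniformlyOn_iff]
    intro ε hε s₀ hs₀
    have him0 : 0 < s₀.im := hs₀.2
    set R := ‖s₀‖ + 1
    set C := 112 * (R / (s₀.im / 2))
    refine ⟨U ∩ ({s | ‖s‖ < R} ∩ {s | s₀.im / 2 < s.im}), ?_, ?_⟩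
    · refine inter_mem self_mem_nhdsWithin (mem_nhdsWithin_of_mem_nhds ?_)
      refine ((isOpen_lt continuous_norm continuous_const).inter
        (isOpen_lt continuous_const Complex.continuous_im)).mem_nhds ⟨?_, ?_⟩
      · show ‖s₀‖ < ‖s₀‖ + 1
        linarith
      · show s₀.im / 2 < s₀.im
        linarith
    have hlim : Tendsto (fun M : ℕ => C * (M : ℝ) ^ (-(1 / 2) : ℝ)) atTop (𝓝 0) := by
      have := ((tendsto_rpow_neg_atTop (by norm_num : (0 : ℝ) < 1 / 2)).comp
        tendsto_natCast_atTop_atTop).const_mul C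
      simpa using this
    filter_upwards [hlim.eventually (gt_mem_nhds hε), eventually_ge_atTop 1,
      tendsto_natCast_atTop_atTop.eventually_ge_atTop (2 * R)] with M h1 h2 h3
    rintro s ⟨hsU, hsR, hsI⟩
    have hsR' : ‖s‖ < R := hsR
    have hsI' : s₀.im / 2 < s.im := hsI
    have hM1 : (1 : ℝ) ≤ M := by exact_mod_cast h2
    rw [dist_eq_norm]
    refine lt_of_le_of_lt ?_ h1
    refine (norm_limit_sub_hurwitzApprox_le hα (le_of_lt hsU.1) (hne1 s hsU) (hF s hsU) h2
      (by linarith)).trans ?_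
    have h4 : s₀.im / 2 ≤ ‖s - 1‖ := by
      have := Complex.abs_im_le_norm (s - 1)
      rw [Complex.sub_im, Complex.one_im, sub_zero] at this
      linarith [le_abs_self s.im]
    have h5 : (M : ℝ) ^ (-s.re) ≤ (M : ℝ) ^ (-(1 / 2) : ℝ) :=
      Real.rpow_le_rpow_of_exponent_le hM1 (by have : 1 / 2 < s.re := hsU.1; linarith)
    have h6 : ‖s‖ / ‖s - 1‖ ≤ R / (s₀.im / 2) := by gcongr
    exact mul_le_mul (mul_le_mul_of_nonneg_left h6 (by norm_num)) h5 (by positivity) (by positivity)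
  have hdiff : ∀ N, DifferentiableOn ℂ (hurwitzApprox α N) U := by
    intro N
    unfold hurwitzApprox
    refine DifferentiableOn.add
      (DifferentiableOn.fun_sum fun n _ => (differentiable_lerchTerm 0 α n).differentiableOn) ?_
    refine DifferentiableOn.div ?_ (by fun_prop) fun s hs => sub_ne_zero.2 (hne1 s hs)
    exact ((differentiable_lerchTerm 0 α N).const_mul _).differentiableOn
  have hFd : DifferentiableOn ℂ F U :=
    hunif.differentiableOn (Eventually.of_forall hdiff) hUo
  have hZd : DifferentiableOn ℂ (HurwitzZeta.hurwitzZeta (α : UnitAddCircle)) U := fun s hs =>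
    (HurwitzZeta.differentiableAt_hurwitzZeta _ (hne1 s hs)).differentiableWithinAt
  -- Identity theorem: the locally uniform limit F is holomorphic on U and agrees with the
  -- zeta-function near 2 + i, where the series converges absolutely.
  have heq : Set.EqOn F (HurwitzZeta.hurwitzZeta (α : UnitAddCircle)) U := by
    refine (hFd.analyticOnNhd hUo).eqOn_of_preconnected_of_eventuallyEq (hZd.analyticOnNhd hUo) hUc
      (z₀ := 2 + Complex.I) (by constructor <;> simp; norm_num) ?_
    have hV : IsOpen ({s : ℂ | 1 < s.re} ∩ {s | 0 < s.im}) :=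
      (isOpen_lt continuous_const Complex.continuous_re).inter
        (isOpen_lt continuous_const Complex.continuous_im)
    filter_upwards [hV.mem_nhds (x := 2 + Complex.I) (by constructor <;> simp)] with s hs
    have hsU : s ∈ U := ⟨lt_trans (by norm_num) hs.1.out, hs.2⟩
    exact tendsto_nhds_unique (hF s hsU) (tendsto_hurwitzApprox_of_one_lt_re hα hα1 hs.1)
  have hsU : s ∈ U := ⟨hs, him⟩
  rw [← heq hsU]
  exact hF s hsU

/-- The completing integral is dropped again and becomes the second error term; it is small only
when Im s is large. For Im s ≥ 1 one has ‖s‖ ≤ 2‖s - 1‖, whence 224 = 2·112. -/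
theorem norm_hurwitzZeta_sub_sum_le {α : ℝ} (hα : 0 < α) (hα1 : α ≤ 1) {s : ℂ} (hs : 1 / 2 < s.re)
    (him : 1 ≤ s.im) {M : ℕ} (hM : 1 ≤ M) (hMs : 2 * ‖s‖ ≤ M) :
    ‖HurwitzZeta.hurwitzZeta (α : UnitAddCircle) s - ∑ n ∈ Finset.range M, lerchTerm 0 α s n‖
      ≤ 224 * (M : ℝ) ^ (-s.re) + 2 * M * (M : ℝ) ^ (-s.re) / s.im := by
  have hM0 : (1 : ℝ) ≤ M := by exact_mod_cast hM
  have him1 : s.im ≤ ‖s - 1‖ := by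
    have := Complex.abs_im_le_norm (s - 1)
    rw [Complex.sub_im, Complex.one_im, sub_zero] at this
    linarith [le_abs_self s.im]
  have hne : s ≠ 1 := by
    rintro rfl
    simp at him
    linarith
  have h1 := norm_limit_sub_hurwitzApprox_le hα hs.le hne
    (tendsto_hurwitzApprox hα hα1 hs (by linarith)) hM hMs
  have h2 : ‖s‖ / ‖s - 1‖ ≤ 2 := by
    rw [div_le_iff₀ (by linarith)]
    calc ‖s‖ = ‖(s - 1) + 1‖ := by ring_nf
      _ ≤ ‖s - 1‖ + 1 := (norm_add_le _ _).trans (by rw [norm_one])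
      _ ≤ _ := by linarith
  have h3 : ‖(((M : ℝ) + α : ℝ) : ℂ) * lerchTerm 0 α s M / (s - 1)‖
      ≤ 2 * M * (M : ℝ) ^ (-s.re) / s.im := by
    rw [norm_div, norm_mul, Complex.norm_real, Real.norm_of_nonneg (by positivity)]
    have := norm_lerchTerm_le (lam := 0) hα (by linarith : 0 ≤ s.re) hM
    gcongr
    linarith
  rw [hurwitzApprox] at h1
  set Z := HurwitzZeta.hurwitzZeta (α : UnitAddCircle) s
  set S := ∑ n ∈ Finset.range M, lerchTerm 0 α s n
  set B := (((M : ℝ) + α : ℝ) : ℂ) * lerchTerm 0 α s M / (s - 1)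
  calc ‖Z - S‖ = ‖(Z - (S + B)) + B‖ := by ring_nf
    _ ≤ ‖Z - (S + B)‖ + ‖B‖ := norm_add_le _ _
    _ ≤ 112 * 2 * (M : ℝ) ^ (-s.re) + 2 * M * (M : ℝ) ^ (-s.re) / s.im := by
      gcongr
      exact h1.trans (by gcongr)
    _ = _ := by ring


/-! ### Mean square of a block of the Lerch series -/

theorem norm_psi (z w : ℂ) : ‖psi z w‖ = 1 := by
  rw [psi, mul_comm, Complex.norm_exp_ofReal_mul_I]

theorem norm_psi_sub_le (z w w' : ℂ) : ‖psi z w - psi z w'‖ ≤ ‖z‖ * ‖w - w'‖ := by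
  set a := (z * (starRingEnd ℂ) w).re with ha
  set b := (z * (starRingEnd ℂ) w').re with hb
  have h : psi z w - psi z w'
      = Complex.exp (b * Complex.I) * (Complex.exp (Complex.I * ((a - b : ℝ) : ℂ)) - 1) := by
    rw [psi, psi, mul_sub, ← Complex.exp_add, ← ha, ← hb, mul_one, mul_comm (b : ℂ)]
    congr 2
    push_cast; ring
  rw [h, norm_mul, Complex.norm_exp_ofReal_mul_I, one_mul]
  refine Real.norm_exp_I_mul_ofReal_sub_one_le.trans ?_
  rw [Real.norm_eq_abs, ha, hb, ← Complex.sub_re, ← mul_sub, ← map_sub]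
  refine (Complex.abs_re_le_norm _).trans ?_
  rw [norm_mul, Complex.norm_conj]

theorem lerchTerm_add_mul_I (lam α σ t : ℝ) (n : ℕ) :
    lerchTerm lam α ((σ : ℂ) + (t : ℂ) * Complex.I) n = lerchTerm lam α σ n *
      Complex.exp (Complex.I * ((-(t * Real.log ((n : ℝ) + α)) : ℝ) : ℂ)) := by
  rw [lerchTerm, lerchTerm, ← Complex.exp_add]
  congr 1
  push_cast
  ring

theorem continuous_lerchTerm (lam α σ : ℝ) (n : ℕ) :
    Continuous fun t : ℝ => lerchTerm lam α ((σ : ℂ) + (t : ℂ) * Complex.I) n := by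
  unfold lerchTerm
  fun_prop

section Kernel

theorem sum_range_inv_succ_le (M : ℕ) :
    ∑ k ∈ Finset.range M, ((k : ℝ) + 1)⁻¹ ≤ 1 + Real.log M := by
  have := harmonic_le_one_add_log M
  simpa [harmonic] using this

theorem sum_range_inv_le (M : ℕ) : ∑ k ∈ Finset.range M, (k : ℝ)⁻¹ ≤ 1 + Real.log M := by
  refine le_trans ?_ (sum_range_inv_succ_le M)
  cases M with
  | zero => simp
  | succ M =>
    rw [Finset.sum_range_succ', Finset.sum_range_succ]
    simp only [Nat.cast_zero, inv_zero, add_zero, Nat.cast_add, Nat.cast_one]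
    have : 0 ≤ ((M : ℝ) + 1)⁻¹ := by positivity
    linarith

/-- One harmonic sum on each side of n; the diagonal term is 0 by the convention 0⁻¹ = 0. -/
theorem sum_range_inv_abs_sub_le {M n : ℕ} (hn : n < M) :
    ∑ m ∈ Finset.range M, |(m : ℝ) - n|⁻¹ ≤ 2 * (1 + Real.log M) := by
  have hmono {k : ℕ} (hk : k ≤ M) : ∑ j ∈ Finset.range k, ((j : ℝ) + 1)⁻¹ ≤ 1 + Real.log M := by
    refine le_trans ?_ (sum_range_inv_succ_le M)
    exact Finset.sum_le_sum_of_subset_of_nonneg (by simpa using hk) fun _ _ _ => by positivity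
  rw [← Finset.sum_range_add_sum_Ico _ hn.le]
  have h1 : ∑ m ∈ Finset.range n, |(m : ℝ) - n|⁻¹ = ∑ j ∈ Finset.range n, ((j : ℝ) + 1)⁻¹ := by
    rw [← Finset.sum_range_reflect]
    refine Finset.sum_congr rfl fun j hj => ?_
    have hj' := Finset.mem_range.1 hj
    rw [show n - 1 - j = n - (j + 1) by omega, Nat.cast_sub (by omega)]
    push_cast
    rw [show (n : ℝ) - (j + 1) - n = -((j : ℝ) + 1) by ring, abs_neg, abs_of_pos (by positivity)]
  have h2 : ∑ m ∈ Finset.Ico n M, |(m : ℝ) - n|⁻¹ ≤ 1 + Real.log M := by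
    rw [Finset.sum_Ico_eq_sum_range]
    have : ∀ j ∈ Finset.range (M - n), |((n + j : ℕ) : ℝ) - n|⁻¹ = (j : ℝ)⁻¹ := by
      intro j _
      push_cast
      rw [add_sub_cancel_left, abs_of_nonneg (by positivity)]
    rw [Finset.sum_congr rfl this]
    refine le_trans ?_ (sum_range_inv_le M)
    exact Finset.sum_le_sum_of_subset_of_nonneg (by simp) fun _ _ _ => by positivity
  rw [h1]
  linarith [hmono hn.le]

/-- A bound for the off-diagonal kernel of the mean square of a Dirichlet polynomial. -/
theorem inv_sqrt_mul_log_le {x y : ℝ} (hx : 0 < x) (hxy : x < y) :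
    (√x * √y * (Real.log y - Real.log x))⁻¹ ≤ 2 * ((y - x)⁻¹ + x⁻¹) := by
  have hy : 0 < y := hx.trans hxy
  have hd : 0 < y - x := by linarith
  have hlog : (y - x) / y ≤ Real.log y - Real.log x := by
    rw [← Real.log_div hy.ne' hx.ne']
    refine le_trans (le_of_eq ?_) (Real.one_sub_inv_le_log_of_pos (by positivity))
    field_simp
  have hsx : 0 < √x := Real.sqrt_pos.2 hx
  have hsy : 0 < √y := Real.sqrt_pos.2 hy
  have hsd : 0 < √(y - x) := Real.sqrt_pos.2 hd
  have hx2 : √x * √x = x := Real.mul_self_sqrt hx.le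
  have hy2 : √y * √y = y := Real.mul_self_sqrt hy.le
  have hd2 : √(y - x) * √(y - x) = y - x := Real.mul_self_sqrt hd.le
  -- This splits the kernel into 1/(y - x) and the mixed term 1/√(x(y - x)), which the
  -- arithmetic-geometric mean inequality handles.
  have hsum : √y ≤ √x + √(y - x) := by
    refine Real.sqrt_le_iff.2 ⟨by positivity, ?_⟩
    nlinarith
  have hamgm : (√x * √(y - x))⁻¹ ≤ (x⁻¹ + (y - x)⁻¹) / 2 := by
    have h1 := two_mul_le_add_sq (√x)⁻¹ (√(y - x))⁻¹
    rw [inv_pow, inv_pow, Real.sq_sqrt hx.le, Real.sq_sqrt hd.le] at h1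
    rw [mul_inv]
    linarith
  calc (√x * √y * (Real.log y - Real.log x))⁻¹ ≤ (√x * √y * ((y - x) / y))⁻¹ := by
        gcongr
    _ = √y / (√x * (y - x)) := by
        have e : y / (√y * (y - x)) = √y / (y - x) := by
          rw [div_eq_div_iff (by positivity) (by positivity)]
          linear_combination (-(y - x)) * hy2
        calc _ = (√x)⁻¹ * (y / (√y * (y - x))) := by field_simp
          _ = _ := by rw [e]; field_simp
    _ ≤ (√x + √(y - x)) / (√x * (y - x)) := by gcongr
    _ = (y - x)⁻¹ + (√x * √(y - x))⁻¹ := by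
        have e : √x * (y - x) = √x * √(y - x) * √(y - x) := by rw [mul_assoc, hd2]
        have e1 : √x / (√x * (y - x)) = (y - x)⁻¹ := by field_simp
        have e2 : √(y - x) / (√x * √(y - x) * √(y - x)) = (√x * √(y - x))⁻¹ := by field_simp
        rw [add_div, e1, e, e2]
    _ ≤ _ := by
        have : 0 < x⁻¹ := by positivity
        have : 0 < (y - x)⁻¹ := by positivity
        linarith

end Kernel

section MeanSquare

variable {lam α σ T : ℝ} (hα : 0 < α) (hσ : 1 / 2 ≤ σ) (hT : 0 < T) {N M : ℕ} (hN : 1 ≤ N)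
include hα hσ hN

/-- Extracts the whole saving N^(1/2-σ) and leaves the weights of the line σ = 1/2, so that only one
kernel has to be estimated. -/
theorem norm_lerchTerm_le_rpow_mul {n : ℕ} (hn : N ≤ n) :
    ‖lerchTerm lam α σ n‖ ≤ (N : ℝ) ^ (1 / 2 - σ) * (√((n : ℝ) + α))⁻¹ := by
  have hN0 : (1 : ℝ) ≤ N := by exact_mod_cast hN
  have hn0 : (N : ℝ) ≤ n := by exact_mod_cast hn
  have hx : 0 < (n : ℝ) + α := by positivity
  rw [norm_lerchTerm hα, Complex.ofReal_re, show -σ = (1 / 2 - σ) + -(1 / 2) by ring,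
    Real.rpow_add hx, Real.rpow_neg hx.le, Real.sqrt_eq_rpow]
  gcongr ?_ * _
  exact Real.rpow_le_rpow_of_nonpos (by linarith) (by linarith) (by linarith)

include hT

/-- The diagonal is a constant of size about 1/n. Off it, the time mean is at most 2/(T|Λ|) with Λ
the difference of logarithms, and the kernel bound converts 1/|Λ| with its weights into 1/|m - n| +
1/m + 1/n. -/
theorem norm_correlation_le {m n : ℕ} (hm : N ≤ m) (hn : N ≤ n) :
    ‖∫ t, lerchTerm lam α ((σ : ℂ) + (t : ℂ) * Complex.I) m *
        starRingEnd ℂ (lerchTerm lam α ((σ : ℂ) + (t : ℂ) * Complex.I) n) ∂(timeMeasure T)‖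
      ≤ (N : ℝ) ^ (1 - 2 * σ) * ((if m = n then (n : ℝ)⁻¹ else 0)
        + 4 / T * (|(m : ℝ) - n|⁻¹ + (m : ℝ)⁻¹ + (n : ℝ)⁻¹)) := by
  have := isProbabilityMeasure_timeMeasure hT
  have hN0 : (1 : ℝ) ≤ N := by exact_mod_cast hN
  have hm0 : (0 : ℝ) < m := by exact_mod_cast hN.trans hm
  have hn0 : (0 : ℝ) < n := by exact_mod_cast hN.trans hn
  have hxm : 0 < (m : ℝ) + α := by positivity
  have hxn : 0 < (n : ℝ) + α := by positivity
  set Λ := Real.log ((m : ℝ) + α) - Real.log ((n : ℝ) + α) with hΛ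
  have heq (t : ℝ) : lerchTerm lam α ((σ : ℂ) + (t : ℂ) * Complex.I) m *
        starRingEnd ℂ (lerchTerm lam α ((σ : ℂ) + (t : ℂ) * Complex.I) n)
      = lerchTerm lam α σ m * starRingEnd ℂ (lerchTerm lam α σ n) *
        Complex.exp (Complex.I * ((-(t * Λ) : ℝ) : ℂ)) := by
    rw [lerchTerm_add_mul_I, lerchTerm_add_mul_I, map_mul, ← Complex.exp_conj,
      show Complex.exp (Complex.I * ((-(t * Λ) : ℝ) : ℂ))
        = Complex.exp (Complex.I * ((-(t * Real.log ((m : ℝ) + α)) : ℝ) : ℂ))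
          * Complex.exp (starRingEnd ℂ
            (Complex.I * ((-(t * Real.log ((n : ℝ) + α)) : ℝ) : ℂ))) by
        rw [← Complex.exp_add, map_mul, Complex.conj_I, Complex.conj_ofReal, hΛ]
        congr 1; push_cast; ring]
    ring
  simp_rw [heq]
  rw [integral_const_mul, norm_mul, norm_mul, Complex.norm_conj]
  have hcm := norm_lerchTerm_le_rpow_mul (lam := lam) hα hσ hN hm
  have hcn := norm_lerchTerm_le_rpow_mul (lam := lam) hα hσ hN hn
  have hpow : (N : ℝ) ^ (1 / 2 - σ) * (N : ℝ) ^ (1 / 2 - σ) = (N : ℝ) ^ (1 - 2 * σ) := by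
    rw [← Real.rpow_add (by linarith)]; ring_nf
  have hprod : ‖lerchTerm lam α σ m‖ * ‖lerchTerm lam α σ n‖
      ≤ (N : ℝ) ^ (1 - 2 * σ) * (√((m : ℝ) + α) * √((n : ℝ) + α))⁻¹ := by
    calc _ ≤ ((N : ℝ) ^ (1 / 2 - σ) * (√((m : ℝ) + α))⁻¹)
          * ((N : ℝ) ^ (1 / 2 - σ) * (√((n : ℝ) + α))⁻¹) := by gcongr
      _ = _ := by rw [← hpow, mul_inv]; ring
  have hN2 : 0 ≤ (N : ℝ) ^ (1 - 2 * σ) := by positivity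
  rcases eq_or_ne m n with rfl | hmn
  · have hΛ0 : Λ = 0 := by rw [hΛ]; ring
    rw [if_pos rfl, hΛ0]
    simp only [mul_zero, neg_zero, Complex.ofReal_zero, Complex.exp_zero, integral_const,
      probReal_univ, one_smul, norm_one, mul_one]
    refine hprod.trans ?_
    gcongr
    rw [Real.mul_self_sqrt hxm.le]
    have h1 : ((m : ℝ) + α)⁻¹ ≤ (m : ℝ)⁻¹ := by gcongr; linarith
    have h2 : 0 ≤ 4 / T * (|(m : ℝ) - m|⁻¹ + (m : ℝ)⁻¹ + (m : ℝ)⁻¹) := by positivity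
    linarith
  · rw [if_neg hmn, zero_add]
    have hΛ0 : Λ ≠ 0 := by
      rw [hΛ, sub_ne_zero]
      intro h
      have := Real.log_injOn_pos hxm hxn h
      exact hmn (by exact_mod_cast add_right_cancel this)
    have hmean := norm_integral_time_character_le hT hΛ0
    have hker : (√((m : ℝ) + α) * √((n : ℝ) + α))⁻¹ * |Λ|⁻¹
        ≤ 2 * (|(m : ℝ) - n|⁻¹ + (m : ℝ)⁻¹ + (n : ℝ)⁻¹) := by
      have im : ((m : ℝ) + α)⁻¹ ≤ (m : ℝ)⁻¹ := by gcongr; linarith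
      have inn : ((n : ℝ) + α)⁻¹ ≤ (n : ℝ)⁻¹ := by gcongr; linarith
      have pm : 0 < (m : ℝ)⁻¹ := by positivity
      have pn : 0 < (n : ℝ)⁻¹ := by positivity
      rcases lt_or_gt_of_ne hmn with h | h
      · have h' : (m : ℝ) < n := by exact_mod_cast h
        have hk := inv_sqrt_mul_log_le hxm (y := (n : ℝ) + α) (by linarith)
        have hlog : Real.log ((m : ℝ) + α) < Real.log ((n : ℝ) + α) :=
          Real.log_lt_log hxm (by linarith)
        rw [← mul_inv, hΛ, abs_sub_comm, abs_of_pos (by linarith), abs_sub_comm,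
          abs_of_pos (by linarith)]
        refine hk.trans ?_
        rw [show (n : ℝ) + α - (m + α) = n - m by ring]
        linarith
      · have h' : (n : ℝ) < m := by exact_mod_cast h
        have hk := inv_sqrt_mul_log_le hxn (y := (m : ℝ) + α) (by linarith)
        have hlog : Real.log ((n : ℝ) + α) < Real.log ((m : ℝ) + α) :=
          Real.log_lt_log hxn (by linarith)
        rw [← mul_inv, hΛ, abs_of_pos (by linarith), abs_of_pos (by linarith),
          mul_comm (√((m : ℝ) + α))]
        refine hk.trans ?_
        rw [show (m : ℝ) + α - (n + α) = m - n by ring]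
        linarith
    calc _ ≤ (N : ℝ) ^ (1 - 2 * σ) * (√((m : ℝ) + α) * √((n : ℝ) + α))⁻¹ * (2 / (T * |Λ|)) := by
          gcongr
      _ = (N : ℝ) ^ (1 - 2 * σ) * (2 / T *
          ((√((m : ℝ) + α) * √((n : ℝ) + α))⁻¹ * |Λ|⁻¹)) := by
          rw [div_mul_eq_div_div]; ring
      _ ≤ (N : ℝ) ^ (1 - 2 * σ) * (2 / T *
          (2 * (|(m : ℝ) - n|⁻¹ + (m : ℝ)⁻¹ + (n : ℝ)⁻¹))) := by gcongr
      _ = _ := by ring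

/-- The mean square of a tail of the Lerch series. -/
theorem integral_norm_sq_sum_lerchTerm_le :
    ∫ t, ‖∑ n ∈ Finset.Ico N M, lerchTerm lam α ((σ : ℂ) + (t : ℂ) * Complex.I) n‖ ^ 2
        ∂(timeMeasure T)
      ≤ (N : ℝ) ^ (1 - 2 * σ) * (16 * (1 + M / T) * (1 + Real.log M)) := by
  have := isProbabilityMeasure_timeMeasure hT
  set b : ℕ → ℝ → ℂ := fun n t => lerchTerm lam α ((σ : ℂ) + (t : ℂ) * Complex.I) n with hb
  have hbc (n : ℕ) : Continuous (b n) := continuous_lerchTerm lam α σ n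
  have hbn (n : ℕ) (t : ℝ) : ‖b n t‖ = ((n : ℝ) + α) ^ (-σ) := by
    simp only [hb]
    rw [norm_lerchTerm hα]; simp
  have hint (m n : ℕ) : Integrable (fun t => b m t * starRingEnd ℂ (b n t)) (timeMeasure T) := by
    refine Integrable.of_bound (Continuous.aestronglyMeasurable ?_)
      (((m : ℝ) + α) ^ (-σ) * ((n : ℝ) + α) ^ (-σ)) (Eventually.of_forall fun t => ?_)
    · exact (hbc m).mul (Complex.continuous_conj.comp (hbc n))
    · rw [norm_mul, Complex.norm_conj, hbn, hbn]
  have hexp (t : ℝ) : ((‖∑ n ∈ Finset.Ico N M, b n t‖ ^ 2 : ℝ) : ℂ)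
      = ∑ m ∈ Finset.Ico N M, ∑ n ∈ Finset.Ico N M, b m t * starRingEnd ℂ (b n t) := by
    rw [Complex.ofReal_pow, ← Complex.mul_conj', map_sum, Finset.sum_mul_sum]
  have hval : ((∫ t, ‖∑ n ∈ Finset.Ico N M, b n t‖ ^ 2 ∂(timeMeasure T) : ℝ) : ℂ)
      = ∑ m ∈ Finset.Ico N M, ∑ n ∈ Finset.Ico N M,
        ∫ t, b m t * starRingEnd ℂ (b n t) ∂(timeMeasure T) := by
    rw [← integral_complex_ofReal]
    simp_rw [hexp]
    rw [integral_finsetSum _ fun m _ => integrable_finsetSum _ fun n _ => hint m n]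
    refine Finset.sum_congr rfl fun m _ => ?_
    rw [integral_finsetSum _ fun n _ => hint m n]
  refine (le_abs_self _).trans ?_
  rw [← Real.norm_eq_abs, ← Complex.norm_real, hval]
  set H := 1 + Real.log M with hH
  have hH0 : 0 ≤ H := by
    have := Real.log_natCast_nonneg M
    linarith
  have hsub : Finset.Ico N M ⊆ Finset.range M := fun n hn =>
    Finset.mem_range.2 (Finset.mem_Ico.1 hn).2
  have hinv : ∑ n ∈ Finset.Ico N M, (n : ℝ)⁻¹ ≤ H :=
    (Finset.sum_le_sum_of_subset_of_nonneg hsub fun _ _ _ => by positivity).trans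
      (sum_range_inv_le M)
  have hcard : ((Finset.Ico N M).card : ℝ) ≤ M := by
    rw [Nat.card_Ico]; exact_mod_cast Nat.sub_le M N
  have hN2 : 0 ≤ (N : ℝ) ^ (1 - 2 * σ) := by positivity
  have hM0 : (0 : ℝ) ≤ M := by positivity
  -- Plain row sums replace Hilbert's inequality; the logarithm H that this loses is harmless.
  -- Summed over m, the off-diagonal part is (4/T)·4MH, hence the 16.
  have hrow : ∀ m ∈ Finset.Ico N M, ∑ n ∈ Finset.Ico N M,
      ((if m = n then (n : ℝ)⁻¹ else 0) + 4 / T * (|(m : ℝ) - n|⁻¹ + (m : ℝ)⁻¹ + (n : ℝ)⁻¹))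
      ≤ (m : ℝ)⁻¹ + 4 / T * (2 * H + M * (m : ℝ)⁻¹ + H) := by
    intro m hm
    rw [Finset.sum_add_distrib, Finset.sum_ite_eq, if_pos hm, ← Finset.mul_sum,
      Finset.sum_add_distrib, Finset.sum_add_distrib, Finset.sum_const, nsmul_eq_mul]
    have h1 : ∑ n ∈ Finset.Ico N M, |(m : ℝ) - n|⁻¹ ≤ 2 * H := by
      simp_rw [abs_sub_comm (m : ℝ)]
      exact (Finset.sum_le_sum_of_subset_of_nonneg hsub fun _ _ _ => by positivity).trans
        (sum_range_inv_abs_sub_le (Finset.mem_Ico.1 hm).2)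
    gcongr
  calc _ ≤ ∑ m ∈ Finset.Ico N M, ∑ n ∈ Finset.Ico N M, (N : ℝ) ^ (1 - 2 * σ) *
        ((if m = n then (n : ℝ)⁻¹ else 0)
          + 4 / T * (|(m : ℝ) - n|⁻¹ + (m : ℝ)⁻¹ + (n : ℝ)⁻¹)) :=
        norm_sum_le_of_le _ fun m hm => norm_sum_le_of_le _ fun n hn =>
          norm_correlation_le hα hσ hT hN (Finset.mem_Ico.1 hm).1 (Finset.mem_Ico.1 hn).1
    _ ≤ (N : ℝ) ^ (1 - 2 * σ) * ∑ m ∈ Finset.Ico N M,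
        ((m : ℝ)⁻¹ + 4 / T * (2 * H + M * (m : ℝ)⁻¹ + H)) := by
        simp_rw [← Finset.mul_sum]
        gcongr with m hm
        exact hrow m hm
    _ ≤ (N : ℝ) ^ (1 - 2 * σ) * (16 * (1 + M / T) * H) := by
        gcongr
        simp only [Finset.sum_add_distrib, ← Finset.mul_sum, Finset.sum_const, nsmul_eq_mul]
        have h1 : 4 / T * ((Finset.Ico N M).card * (2 * H) + M * ∑ i ∈ Finset.Ico N M, (i : ℝ)⁻¹
            + (Finset.Ico N M).card * H) ≤ 4 / T * (M * (2 * H) + M * H + M * H) := by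
          gcongr
        have h2 : 4 / T * (M * (2 * H) + M * H + M * H) = 16 * (M / T) * H := by ring
        nlinarith

/-- From mean square to first moment by q ≤ a + q²/a with a = N^(1/2-σ), in place of the
Cauchy–Schwarz inequality. -/
theorem integral_norm_sum_lerchTerm_le :
    ∫ t, ‖∑ n ∈ Finset.Ico N M, lerchTerm lam α ((σ : ℂ) + (t : ℂ) * Complex.I) n‖
        ∂(timeMeasure T)
      ≤ (N : ℝ) ^ (1 / 2 - σ) * (1 + 16 * (1 + M / T) * (1 + Real.log M)) := by
  have := isProbabilityMeasure_timeMeasure hT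
  have hN0 : (0 : ℝ) < N := by exact_mod_cast hN
  set Q : ℝ → ℂ := fun t => ∑ n ∈ Finset.Ico N M, lerchTerm lam α ((σ : ℂ) + (t : ℂ) * Complex.I) n
    with hQ
  have hQc : Continuous Q := continuous_finsetSum _ fun n _ => continuous_lerchTerm lam α σ n
  have hQb (t : ℝ) : ‖Q t‖ ≤ ∑ n ∈ Finset.Ico N M, ((n : ℝ) + α) ^ (-σ) :=
    norm_sum_le_of_le _ fun n _ => le_of_eq (by rw [norm_lerchTerm hα]; simp)
  set a := (N : ℝ) ^ (1 / 2 - σ) with ha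
  have ha0 : 0 < a := by positivity
  have haa : a * a = (N : ℝ) ^ (1 - 2 * σ) := by
    rw [ha, ← Real.rpow_add hN0]; ring_nf
  have hpt (t : ℝ) : ‖Q t‖ ≤ a + a⁻¹ * ‖Q t‖ ^ 2 := by
    have h1 : a⁻¹ * ‖Q t‖ ^ 2 - ‖Q t‖ + a = a⁻¹ * ((‖Q t‖ - a / 2) ^ 2 + 3 / 4 * a ^ 2) := by
      field_simp; ring
    have h2 : 0 ≤ a⁻¹ * ((‖Q t‖ - a / 2) ^ 2 + 3 / 4 * a ^ 2) := by positivity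
    linarith
  have hi2 : Integrable (fun t => ‖Q t‖ ^ 2) (timeMeasure T) :=
    Integrable.of_bound (hQc.norm.pow 2).aestronglyMeasurable
      ((∑ n ∈ Finset.Ico N M, ((n : ℝ) + α) ^ (-σ)) ^ 2) (Eventually.of_forall fun t => by
        rw [norm_pow, norm_norm]
        gcongr
        exact hQb t)
  have hms := integral_norm_sq_sum_lerchTerm_le (lam := lam) hα hσ hT hN (M := M)
  calc ∫ t, ‖Q t‖ ∂(timeMeasure T) ≤ ∫ t, (a + a⁻¹ * ‖Q t‖ ^ 2) ∂(timeMeasure T) :=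
        integral_mono_of_nonneg (Eventually.of_forall fun t => norm_nonneg _)
          ((integrable_const _).add (hi2.const_mul _)) (Eventually.of_forall hpt)
    _ = a + a⁻¹ * ∫ t, ‖Q t‖ ^ 2 ∂(timeMeasure T) := by
        rw [integral_add (integrable_const _) (hi2.const_mul _), integral_const_mul]
        simp
    _ ≤ a + a⁻¹ * (a * a * (16 * (1 + M / T) * (1 + Real.log M))) := by
        rw [haa]
        gcongr
    _ = _ := by field_simp

end MeanSquare


/-! ### Replacing the Lerch zeta-function by a short partial sum -/

section Lerch

theorem lerchTerm_intCast (k : ℤ) (α : ℝ) (s : ℂ) (n : ℕ) :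
    lerchTerm k α s n = lerchTerm 0 α s n := by
  rw [lerchTerm, lerchTerm, Complex.exp_sub, Complex.exp_sub]
  congr 1
  have h := Complex.exp_int_mul_two_pi_mul_I (k * n)
  push_cast at h ⊢
  rw [mul_zero, zero_mul, Complex.exp_zero, ← h]
  congr 1
  ring

theorem norm_one_sub_exp_pos {lam : ℝ} (h : ¬ ∃ k : ℤ, (k : ℝ) = lam) :
    0 < ‖1 - Complex.exp (2 * Real.pi * Complex.I * lam)‖ := by
  rw [norm_pos_iff, sub_ne_zero]
  intro he
  obtain ⟨k, hk⟩ := Complex.exp_eq_one_iff.1 he.symm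
  refine h ⟨k, ?_⟩
  have h2 : (2 * Real.pi * Complex.I : ℂ) ≠ 0 := Complex.two_pi_I_ne_zero
  have : (2 * Real.pi * Complex.I : ℂ) * lam = (2 * Real.pi * Complex.I : ℂ) * k := by
    rw [hk]; ring
  exact_mod_cast (mul_left_cancel₀ h2 this).symm

theorem tendsto_lerchZeta {lam α : ℝ} (h : ¬ ∃ k : ℤ, (k : ℝ) = lam) (hα : 0 < α) {s : ℂ}
    (hs : 1 / 2 ≤ s.re) :
    Tendsto (fun N => ∑ n ∈ Finset.range N, lerchTerm lam α s n) atTop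
      (𝓝 (lerchZeta lam α s)) := by
  obtain ⟨L, hL⟩ := tendsto_sum_lerchTerm hα hs (norm_one_sub_exp_pos h) le_rfl
  rw [lerchZeta, if_neg h]
  simp_rw [lerchTerm_eq hα]
  rwa [hL.limUnder_eq]

/-- The Lerch zeta-function is approximated by its partial sums of length proportional to `T`. -/
theorem exists_norm_lerchZeta_sub_sum_le (lam σ₁ : ℝ) : ∃ A : ℝ, 1 ≤ A ∧
    ∀ α σ T t : ℝ, 0 < α → α ≤ 1 → 1 / 2 < σ → σ ≤ σ₁ → 1 ≤ t → t ≤ T →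
      ∀ M : ℕ, A * T ≤ M →
      ‖lerchZeta lam α ((σ : ℂ) + (t : ℂ) * Complex.I)
        - ∑ n ∈ Finset.range M, lerchTerm lam α ((σ : ℂ) + (t : ℂ) * Complex.I) n‖
      ≤ A * (M : ℝ) ^ (-(1 / 2) : ℝ) + 2 * (M : ℝ) ^ (1 / 2 : ℝ) / t := by
  have hnorm {σ T t : ℝ} (hσ : 1 / 2 < σ) (hσ1 : σ ≤ σ₁) (ht : 1 ≤ t) (htT : t ≤ T) :
      ‖(σ : ℂ) + (t : ℂ) * Complex.I‖ ≤ (σ₁ + 1) * T := by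
    refine (norm_add_le _ _).trans ?_
    rw [norm_mul, Complex.norm_I, mul_one, Complex.norm_real, Complex.norm_real,
      Real.norm_of_nonneg (by linarith), Real.norm_of_nonneg (by linarith)]
    nlinarith
  have hre (σ t : ℝ) : ((σ : ℂ) + (t : ℂ) * Complex.I).re = σ := by simp
  have him (σ t : ℝ) : ((σ : ℂ) + (t : ℂ) * Complex.I).im = t := by simp
  by_cases h : ∃ k : ℤ, (k : ℝ) = lam
  -- As ‖s‖ ≤ (σ₁ + 1)T, the second entry ensures 2‖s‖ ≤ M. In both cases A depends on λ and σ₁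
  -- only, as the implied constant requires.
  · refine ⟨max 224 (2 * (σ₁ + 1)), le_max_of_le_left (by norm_num), ?_⟩
    intro α σ T t hα hα1 hσ hσ1 ht htT M hM
    have hA : 224 ≤ max 224 (2 * (σ₁ + 1)) := le_max_left _ _
    have hM1 : (1 : ℝ) ≤ M := le_trans (by nlinarith) hM
    have hM1' : 1 ≤ M := by exact_mod_cast hM1
    have hs := hnorm hσ hσ1 ht htT
    have hMs : 2 * ‖(σ : ℂ) + (t : ℂ) * Complex.I‖ ≤ M := by
      have : 2 * (σ₁ + 1) * T ≤ max 224 (2 * (σ₁ + 1)) * T :=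
        mul_le_mul_of_nonneg_right (le_max_right _ _) (by linarith)
      linarith
    have hb := norm_hurwitzZeta_sub_sum_le hα hα1 (s := (σ : ℂ) + (t : ℂ) * Complex.I)
      (by rwa [hre]) (by rwa [him]) hM1' hMs
    rw [hre, him] at hb
    rw [lerchZeta, if_pos h]
    obtain ⟨k, rfl⟩ := h
    simp_rw [lerchTerm_intCast k]
    refine hb.trans ?_
    have h1 : (M : ℝ) ^ (-σ) ≤ (M : ℝ) ^ (-(1 / 2) : ℝ) :=
      Real.rpow_le_rpow_of_exponent_le hM1 (by linarith)
    have h2 : (M : ℝ) * (M : ℝ) ^ (-(1 / 2) : ℝ) = (M : ℝ) ^ (1 / 2 : ℝ) := by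
      rw [← Real.rpow_one_add' (by linarith) (by norm_num)]; norm_num
    rw [← h2, ← mul_assoc]
    gcongr
  · set c := ‖1 - Complex.exp (2 * Real.pi * Complex.I * lam)‖ with hc
    have hc0 : 0 < c := norm_one_sub_exp_pos h
    refine ⟨max 1 (max (16 / c) (4 * (σ₁ + 1) / c)), le_max_left _ _, ?_⟩
    intro α σ T t hα hα1 hσ hσ1 ht htT M hM
    set A := max 1 (max (16 / c) (4 * (σ₁ + 1) / c)) with hAdef
    have hA1 : 1 ≤ A := le_max_left _ _
    have hM1 : (1 : ℝ) ≤ M := le_trans (by nlinarith) hM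
    have hM1' : 1 ≤ M := by exact_mod_cast hM1
    have hs := hnorm hσ hσ1 ht htT
    have hMs : 4 * ‖(σ : ℂ) + (t : ℂ) * Complex.I‖ / c ≤ M := by
      refine le_trans ?_ hM
      have : 4 * (σ₁ + 1) / c * T ≤ A * T :=
        mul_le_mul_of_nonneg_right ((le_max_right _ _).trans (le_max_right _ _)) (by linarith)
      refine le_trans ?_ this
      rw [div_mul_eq_mul_div]
      exact div_le_div_of_nonneg_right (by linarith) hc0.le
    have hL := tendsto_lerchZeta h hα (s := (σ : ℂ) + (t : ℂ) * Complex.I) (by rw [hre]; linarith)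
    have hb := norm_limit_sub_sum_le hα (by rw [hre]; linarith) hc0 le_rfl hL hM1' hMs
    rw [hre] at hb
    refine hb.trans ?_
    have h1 : (M : ℝ) ^ (-σ) ≤ (M : ℝ) ^ (-(1 / 2) : ℝ) :=
      Real.rpow_le_rpow_of_exponent_le hM1 (by linarith)
    have h2 : 16 / c ≤ A := (le_max_left _ _).trans (le_max_right _ _)
    have h3 : 0 ≤ 2 * (M : ℝ) ^ (1 / 2 : ℝ) / t := by positivity
    have h4 : 16 / c * (M : ℝ) ^ (-σ) ≤ A * (M : ℝ) ^ (-(1 / 2) : ℝ) := by gcongr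
    linarith

/-- For integral λ the function is continuous on (0, T], since the pole s = 1 could be met only at t
= 0; otherwise it is a pointwise limit of continuous partial sums. -/
theorem aestronglyMeasurable_lerchZeta (lam : ℝ) {α σ : ℝ} (hα : 0 < α) (hσ : 1 / 2 < σ) (T : ℝ) :
    AEStronglyMeasurable (fun t : ℝ => lerchZeta lam α ((σ : ℂ) + (t : ℂ) * Complex.I))
      (timeMeasure T) := by
  by_cases h : ∃ k : ℤ, (k : ℝ) = lam
  · refine AEStronglyMeasurable.smul_measure ?_ _
    refine ContinuousOn.aestronglyMeasurable (fun t ht => ?_) measurableSet_Ioc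
    refine ContinuousAt.continuousWithinAt ?_
    have hne : (σ : ℂ) + (t : ℂ) * Complex.I ≠ 1 := by
      intro he
      have := congrArg Complex.im he
      simp at this
      exact ht.1.ne' this
    have hfun : (fun t : ℝ => lerchZeta lam α ((σ : ℂ) + (t : ℂ) * Complex.I))
        = fun t : ℝ => HurwitzZeta.hurwitzZeta (α : UnitAddCircle)
          ((σ : ℂ) + (t : ℂ) * Complex.I) := by
      funext t
      rw [lerchZeta, if_pos h]
    rw [hfun]
    exact ContinuousAt.comp (f := fun t : ℝ => (σ : ℂ) + (t : ℂ) * Complex.I)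
      (HurwitzZeta.differentiableAt_hurwitzZeta _ hne).continuousAt
      (Continuous.continuousAt (by fun_prop))
  · refine aestronglyMeasurable_of_tendsto_ae atTop (f := fun N (t : ℝ) => ∑ n ∈ Finset.range N,
      lerchTerm lam α ((σ : ℂ) + (t : ℂ) * Complex.I) n) (fun N => ?_) ?_
    · exact (continuous_finsetSum _ fun n _ =>
        continuous_lerchTerm lam α σ n).aestronglyMeasurable
    · refine Eventually.of_forall fun t => tendsto_lerchZeta h hα ?_
      simpa using hσ.le

theorem ae_timeMeasure_mem_Ioc (T : ℝ) : ∀ᵐ t ∂(timeMeasure T), t ∈ Set.Ioc 0 T :=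
  Measure.ae_smul_measure (ae_restrict_mem measurableSet_Ioc) _

theorem timeMeasure_real_Iic {T t₀ : ℝ} (hT : 0 < T) (h0 : 0 ≤ t₀) (ht : t₀ ≤ T) :
    (timeMeasure T).real (Set.Iic t₀) = t₀ / T := by
  rw [timeMeasure, measureReal_ennreal_smul_apply, measureReal_restrict_apply measurableSet_Iic,
    Set.Iic_inter_Ioc_of_le ht, Real.volume_real_Ioc_of_le h0, ENNReal.toReal_ofReal (by positivity)]
  ring

/-- For t ≤ t₀, where the approximation is poor, |ψ_z| = 1 gives the trivial bound 2. For t > t₀,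
ψ_z is Lipschitz with constant ‖z‖, and L minus the short sum is the approximation error plus the
block N ≤ n < M, which is small in mean. -/
theorem norm_mean_psi_lerchZeta_sub_le {lam σ₁ A : ℝ}
    (hA : ∀ α σ T t : ℝ, 0 < α → α ≤ 1 → 1 / 2 < σ → σ ≤ σ₁ → 1 ≤ t → t ≤ T →
      ∀ M : ℕ, A * T ≤ M →
      ‖lerchZeta lam α ((σ : ℂ) + (t : ℂ) * Complex.I)
        - ∑ n ∈ Finset.range M, lerchTerm lam α ((σ : ℂ) + (t : ℂ) * Complex.I) n‖
      ≤ A * (M : ℝ) ^ (-(1 / 2) : ℝ) + 2 * (M : ℝ) ^ (1 / 2 : ℝ) / t) (hA1 : 1 ≤ A)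
    {α σ T t₀ : ℝ} (hα : 0 < α) (hα1 : α ≤ 1) (hσ : 1 / 2 < σ) (hσ1 : σ ≤ σ₁) (ht₀ : 1 ≤ t₀)
    (htT : t₀ ≤ T) {N M : ℕ} (hN : 1 ≤ N) (hNM : N ≤ M) (hM : A * T ≤ M) (z : ℂ) :
    ‖((1 / T : ℝ) : ℂ) * (∫ t in (0 : ℝ)..T,
        psi z (lerchZeta lam α ((σ : ℂ) + (t : ℂ) * Complex.I)))
      - ((1 / T : ℝ) : ℂ) * (∫ t in (0 : ℝ)..T,
        psi z (∑ n ∈ Finset.range N, lerchTerm lam α ((σ : ℂ) + (t : ℂ) * Complex.I) n))‖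
    ≤ 2 * (t₀ / T) + ‖z‖ * (A * (M : ℝ) ^ (-(1 / 2) : ℝ) + 2 * (M : ℝ) ^ (1 / 2 : ℝ) / t₀
      + (N : ℝ) ^ (1 / 2 - σ) * (1 + 16 * (1 + M / T) * (1 + Real.log M))) := by
  have hT : 0 < T := by linarith
  have := isProbabilityMeasure_timeMeasure hT
  rw [← integral_timeMeasure hT, ← integral_timeMeasure hT]
  set Q : ℝ → ℂ := fun t => ∑ n ∈ Finset.Ico N M, lerchTerm lam α ((σ : ℂ) + (t : ℂ) * Complex.I) n
    with hQ
  set ε := A * (M : ℝ) ^ (-(1 / 2) : ℝ) + 2 * (M : ℝ) ^ (1 / 2 : ℝ) / t₀ with hε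
  have hε0 : 0 ≤ ε := by positivity
  have hQc : Continuous Q := continuous_finsetSum _ fun n _ => continuous_lerchTerm lam α σ n
  have hQi : Integrable (fun t => ‖Q t‖) (timeMeasure T) :=
    Integrable.of_bound hQc.norm.aestronglyMeasurable
      (∑ n ∈ Finset.Ico N M, ((n : ℝ) + α) ^ (-σ)) (Eventually.of_forall fun t => by
        rw [norm_norm]
        exact norm_sum_le_of_le _ fun n _ => le_of_eq (by rw [norm_lerchTerm hα]; simp))
  have hi1 : Integrable (fun t : ℝ => psi z (lerchZeta lam α ((σ : ℂ) + (t : ℂ) * Complex.I)))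
      (timeMeasure T) :=
    Integrable.of_bound ((continuous_psi z).comp_aestronglyMeasurable
      (aestronglyMeasurable_lerchZeta lam hα hσ T)) 1
      (Eventually.of_forall fun t => (norm_psi _ _).le)
  have hi2 : Integrable (fun t : ℝ => psi z (∑ n ∈ Finset.range N,
      lerchTerm lam α ((σ : ℂ) + (t : ℂ) * Complex.I) n)) (timeMeasure T) :=
    Integrable.of_bound ((continuous_psi z).comp (continuous_finsetSum _ fun n _ =>
      continuous_lerchTerm lam α σ n)).aestronglyMeasurable 1
      (Eventually.of_forall fun t => (norm_psi _ _).le)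
  have hi3 : Integrable (Set.indicator (Set.Iic t₀) fun _ : ℝ => (2 : ℝ)) (timeMeasure T) :=
    (integrable_const _).indicator measurableSet_Iic
  have hi4 : Integrable (fun t => ‖z‖ * (ε + ‖Q t‖)) (timeMeasure T) :=
    ((integrable_const _).add hQi).const_mul _
  rw [← integral_sub hi1 hi2]
  refine (norm_integral_le_of_norm_le (hi3.add hi4) ?_).trans ?_
  · filter_upwards [ae_timeMeasure_mem_Ioc T] with t ht
    simp only [Pi.add_apply]
    by_cases htt : t ≤ t₀
    · rw [Set.indicator_of_mem (Set.mem_Iic.2 htt)]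
      refine (norm_sub_le _ _).trans ?_
      rw [norm_psi, norm_psi]
      have : 0 ≤ ‖z‖ * (ε + ‖Q t‖) := by positivity
      linarith
    · rw [Set.indicator_of_notMem (by simpa using htt), zero_add]
      push Not at htt
      refine (norm_psi_sub_le _ _ _).trans ?_
      gcongr
      have hb := hA α σ T t hα hα1 hσ hσ1 (by linarith) ht.2 M hM
      have hle : A * (M : ℝ) ^ (-(1 / 2) : ℝ) + 2 * (M : ℝ) ^ (1 / 2 : ℝ) / t ≤ ε := by
        rw [hε]; gcongr
      have hsplit := Finset.sum_range_add_sum_Ico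
        (lerchTerm lam α ((σ : ℂ) + (t : ℂ) * Complex.I)) hNM
      calc _ = ‖(lerchZeta lam α ((σ : ℂ) + (t : ℂ) * Complex.I)
          - ∑ n ∈ Finset.range M, lerchTerm lam α ((σ : ℂ) + (t : ℂ) * Complex.I) n) + Q t‖ := by
            rw [← hsplit]; congr 1; simp only [hQ]; ring
        _ ≤ _ := (norm_add_le _ _).trans (by gcongr; exact hb.trans hle)
  · simp only [Pi.add_apply]
    rw [integral_add hi3 hi4, integral_indicator_const _ measurableSet_Iic,
      timeMeasure_real_Iic hT (by linarith) htT, integral_const_mul,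
      integral_add (integrable_const _) hQi, smul_eq_mul]
    have hQm := integral_norm_sum_lerchTerm_le (lam := lam) hα hσ.le hT hN (M := M)
    simp only [integral_const, probReal_univ, one_smul]
    rw [mul_comm (t₀ / T)]
    gcongr

end Lerch


/-! ### Mean along the short partial sum, and the error terms in x = log T -/

section Mean

theorem psi_sum_lerchTerm (lam α σ t : ℝ) (N : ℕ) (z : ℂ) :
    psi z (∑ n ∈ Finset.range N, lerchTerm lam α ((σ : ℂ) + (t : ℂ) * Complex.I) n)
      = Complex.exp (Complex.I * (trigSum
        (fun n : Fin N => starRingEnd ℂ z * lerchTerm lam α σ n)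
        (fun n : Fin N => -(t * Real.log (((n : ℕ) : ℝ) + α))) : ℂ)) := by
  rw [psi, trigSum]
  congr 3
  rw [← Complex.conj_re, map_mul, Complex.conj_conj, Finset.mul_sum, Complex.re_sum,
    Finset.sum_range]
  refine Finset.sum_congr rfl fun n _ => ?_
  rw [lerchTerm_add_mul_I, mul_assoc]

/-- The mean of `ψ_z` along a partial sum of the Lerch series, under the spacing condition. -/
theorem norm_mean_psi_sum_sub_prod_le {α : ℝ} (hα : Admissible α) {Ω X : ℝ} (hΩ : 0 < Ω)
    (hX : 1 ≤ X) (hsp : ∀ (k : ℕ) (n : Fin k → ℕ) (ε : Fin k → ℝ),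
      (∀ j, (n j : ℝ) ≤ X) → (∀ j, ε j = 1 ∨ ε j = -1) →
      ∑ j, ε j * Real.log ((n j : ℝ) + α) ≠ 0 →
      X ^ (-(Ω * (k : ℝ) ^ 2)) ≤ |∑ j, ε j * Real.log ((n j : ℝ) + α)|)
    {T : ℝ} (hT : 0 < T) (lam σ : ℝ) {N : ℕ} (hN : (N : ℝ) ≤ X + 1) (K : ℕ) {y : ℝ} (hy : 0 < y)
    (z : ℂ) :
    ‖((1 / T : ℝ) : ℂ) * (∫ t in (0 : ℝ)..T,
        psi z (∑ n ∈ Finset.range N, lerchTerm lam α ((σ : ℂ) + (t : ℂ) * Complex.I) n))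
      - ∏ n ∈ Finset.range N, (besselJ0 (‖z‖ * ((n : ℝ) + α) ^ (-σ)) : ℂ)‖
    ≤ (2 * K + 1) * ((1 + ‖z‖ * ∑ n ∈ Finset.range N, ((n : ℝ) + α) ^ (-σ)) ^ (2 * K)
        * (2 * X ^ (Ω * (2 * K : ℝ) ^ 2) / T))
      + 2 * (2 * (y ^ (2 * K))⁻¹ * Real.exp
        (y ^ 2 * (‖z‖ ^ 2 * ∑ n ∈ Finset.range N, (((n : ℝ) + α) ^ (-σ)) ^ 2) / 4)) := by
  set w : Fin N → ℂ := fun n => starRingEnd ℂ z * lerchTerm lam α σ n with hw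
  set l : Fin N → ℝ := fun n => Real.log (((n : ℕ) : ℝ) + α) with hl
  have hwn (n : Fin N) : ‖w n‖ = ‖z‖ * (((n : ℕ) : ℝ) + α) ^ (-σ) := by
    simp only [hw]
    rw [norm_mul, Complex.norm_conj, norm_lerchTerm hα.pos, Complex.ofReal_re]
  have hlin : LinearIndependent ℚ l := hα.independent.comp _ Fin.val_injective
  have hX0 : 0 < X := by linarith
  have hgap : ∀ k ≤ 2 * K, ∀ p : Fin k → Fin N × Bool,
      ∑ i, boolSign (p i).2 * l (p i).1 ≠ 0 →
      1 / X ^ (Ω * (2 * K : ℝ) ^ 2) ≤ |∑ i, boolSign (p i).2 * l (p i).1| := by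
    intro k hk p hp
    refine le_trans ?_ (hsp k (fun i => (p i).1) (fun i => boolSign (p i).2) (fun i => ?_)
      (fun i => ?_) hp)
    · rw [one_div, ← Real.rpow_neg hX0.le]
      refine Real.rpow_le_rpow_of_exponent_le hX ?_
      have : (k : ℝ) ≤ 2 * K := by exact_mod_cast hk
      gcongr
    -- The indices run up to N - 1, which is why N ≤ X + 1 suffices for the spacing condition at X.
    · have h1 : (((p i).1 : ℕ) : ℝ) + 1 ≤ N := by exact_mod_cast (p i).1.2
      linarith
    · cases (p i).2 <;> simp [boolSign]
  have h := norm_mean_cexp_sub_prod_le hlin hT (Real.rpow_pos_of_pos hX0 _) w K hy hgap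
  simp_rw [hwn, fun n : Fin N => mul_pow ‖z‖ ((((n : ℕ) : ℝ) + α) ^ (-σ)) 2,
    ← Finset.mul_sum] at h
  simp_rw [psi_sum_lerchTerm]
  rw [Finset.sum_range, Finset.sum_range, Finset.prod_range]
  exact h

end Mean

section Estimates

/-- Used with b = log log T and a = 2σ₁. It separates the dependences: α⁻¹ ≤ log log T is a
condition on T and α, while (log log T)^(2σ₁) ≤ log T is one on T and σ₁. -/
theorem inv_rpow_le {α σ a b : ℝ} (hα : 0 < α) (hα1 : α ≤ 1) (hσ : 0 ≤ σ) (hσa : σ ≤ a)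
    (hb : α⁻¹ ≤ b) : α ^ (-σ) ≤ b ^ a := by
  have h1 : 1 ≤ α⁻¹ := (one_le_inv₀ hα).2 hα1
  rw [Real.rpow_neg hα.le, ← Real.inv_rpow hα.le]
  exact (Real.rpow_le_rpow (by positivity) hb hσ).trans
    (Real.rpow_le_rpow_of_exponent_le (h1.trans hb) hσa)

theorem sum_rpow_le {α σ : ℝ} (hα : 0 < α) (hσ : 0 ≤ σ) (N : ℕ) :
    ∑ n ∈ Finset.range N, ((n : ℝ) + α) ^ (-σ) ≤ N * α ^ (-σ) := by
  refine (Finset.sum_le_card_nsmul _ _ (α ^ (-σ)) fun n _ => ?_).trans (by simp)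
  exact Real.rpow_le_rpow_of_nonpos hα (by linarith [n.cast_nonneg (α := ℝ)]) (by linarith)

theorem sum_sq_rpow_le {α σ : ℝ} (hα : 0 < α) (hσ : 1 / 2 < σ) {N : ℕ} (hN : 1 ≤ N) :
    ∑ n ∈ Finset.range N, (((n : ℝ) + α) ^ (-σ)) ^ 2
      ≤ α ^ (-(2 * σ)) + (1 + 1 / (2 * σ - 1)) := by
  rw [← Finset.sum_range_add_sum_Ico _ hN, Finset.sum_range_one]
  refine add_le_add (le_of_eq ?_) ?_
  · rw [Nat.cast_zero, zero_add, ← Real.rpow_natCast, ← Real.rpow_mul hα.le]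
    norm_num; ring_nf
  · simpa using sum_Ico_rpow_le hα hσ le_rfl N

/-- The contribution of the tail of the Lerch series, in terms of `x = log T`. -/
theorem truncation_error_le {A x σ ζ G : ℝ} {N : ℕ} (hA : 1 ≤ A) (hAx : 4 * A ≤ x)
    (hζ : ζ ≤ x) (hG : 0 < G) (hGx : Real.exp (-(x / 8)) ≤ G)
    (hx2 : x ^ 2 ≤ Real.exp (x / 8)) (hxG : x ^ 4 * G ≤ 1) (hN : (N : ℝ) ^ (1 / 2 - σ) ≤ G ^ 2) :
    2 * (Real.exp (3 * x / 4) / Real.exp x) + ζ * (A * (⌈A * Real.exp x⌉₊ : ℝ) ^ (-(1 / 2) : ℝ)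
      + 2 * (⌈A * Real.exp x⌉₊ : ℝ) ^ (1 / 2 : ℝ) / Real.exp (3 * x / 4)
      + (N : ℝ) ^ (1 / 2 - σ) * (1 + 16 * (1 + ⌈A * Real.exp x⌉₊ / Real.exp x)
        * (1 + Real.log ⌈A * Real.exp x⌉₊))) ≤ 110 * G := by
  have hx4 : 4 ≤ x := by linarith
  have he1 : 1 ≤ Real.exp x := Real.one_le_exp (by linarith)
  set M : ℝ := (⌈A * Real.exp x⌉₊ : ℝ) with hM
  have hM1 : Real.exp x ≤ M := le_trans (by nlinarith) (Nat.le_ceil _)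
  have hM2 : M ≤ x * Real.exp x := by
    have := (Nat.ceil_lt_add_one (by positivity : 0 ≤ A * Real.exp x)).le
    have h3 : A * Real.exp x + 1 ≤ 4 * A * Real.exp x := by nlinarith
    have h4 : 4 * A * Real.exp x ≤ x * Real.exp x := by gcongr
    linarith
  have hM0 : 0 < M := by linarith
  have e1 : Real.exp (3 * x / 4) / Real.exp x = Real.exp (-(x / 8)) ^ 2 := by
    rw [← Real.exp_sub, ← Real.exp_nat_mul]; congr 1; push_cast; ring
  -- u = T^(-1/8). The first three error terms are u² times at most x², so one u absorbs the powers
  -- of x and the other is at most G. Likewise the block N ≤ n < M gives G² times x³, and one G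
  -- absorbs x³.
  set u := Real.exp (-(x / 8)) with hu
  have hu0 : 0 < u := Real.exp_pos _
  have hxu : x ^ 2 * u ≤ 1 := by
    rw [hu, Real.exp_neg, mul_inv_le_iff₀ (Real.exp_pos _)]; linarith
  have hu1 : u ≤ 1 := Real.exp_le_one_iff.2 (by linarith)
  have h1 : M ^ (-(1 / 2) : ℝ) ≤ u ^ 2 := by
    calc M ^ (-(1 / 2) : ℝ) ≤ (Real.exp x) ^ (-(1 / 2) : ℝ) :=
          Real.rpow_le_rpow_of_nonpos (by positivity) hM1 (by norm_num)
      _ = Real.exp (-(x / 2)) := by rw [← Real.exp_mul]; congr 1; ring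
      _ ≤ Real.exp (-(x / 4)) := Real.exp_le_exp.2 (by linarith)
      _ = u ^ 2 := by rw [hu, ← Real.exp_nat_mul]; congr 1; push_cast; ring
  have h2 : M ^ (1 / 2 : ℝ) / Real.exp (3 * x / 4) ≤ x * u ^ 2 := by
    rw [div_le_iff₀ (Real.exp_pos _)]
    calc M ^ (1 / 2 : ℝ) ≤ (x * Real.exp x) ^ (1 / 2 : ℝ) :=
          Real.rpow_le_rpow hM0.le hM2 (by norm_num)
      _ = x ^ (1 / 2 : ℝ) * Real.exp (x / 2) := by
          rw [Real.mul_rpow (by linarith) (by positivity), ← Real.exp_mul]; ring_nf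
      _ ≤ x ^ (1 : ℝ) * Real.exp (x / 2) := by
          gcongr
          · linarith
          · norm_num
      _ = x * u ^ 2 * Real.exp (3 * x / 4) := by
          rw [Real.rpow_one, mul_assoc, hu, ← Real.exp_nat_mul, ← Real.exp_add]
          congr 2; push_cast; ring
  have h3 : M / Real.exp x ≤ x := by rwa [div_le_iff₀ (Real.exp_pos _)]
  have h4 : Real.log M ≤ 2 * x := by
    calc Real.log M ≤ Real.log (x * Real.exp x) := Real.log_le_log hM0 hM2
      _ = Real.log x + x := by rw [Real.log_mul (by linarith) (by positivity), Real.log_exp]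
      _ ≤ 2 * x := by linarith [Real.log_le_self (by linarith : 0 ≤ x)]
  have h4' : 0 ≤ Real.log M := Real.log_nonneg (by linarith)
  have h5 : 1 + 16 * (1 + M / Real.exp x) * (1 + Real.log M) ≤ 97 * x ^ 2 := by
    calc _ ≤ 1 + 16 * (1 + x) * (1 + 2 * x) := by gcongr
      _ ≤ _ := by nlinarith
  have h5' : 0 ≤ 1 + 16 * (1 + M / Real.exp x) * (1 + Real.log M) := by positivity
  rw [e1, mul_div_assoc]
  calc _ ≤ 2 * u ^ 2 + x * (x * u ^ 2 + 2 * (x * u ^ 2) + G ^ 2 * (97 * x ^ 2)) := by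
        gcongr
        linarith
    _ = (2 * u + 3 * (x ^ 2 * u)) * u + 97 * (x ^ 3 * G) * G := by ring
    _ ≤ (2 * 1 + 3 * 1) * G + 97 * 1 * G := by
        gcongr
        refine le_trans ?_ hxG
        gcongr
        · linarith
        · norm_num
    _ ≤ 110 * G := by linarith

/-- The contribution of the moments of the partial sum, in terms of `x = log T`. -/
theorem moment_error_le {Ω x L ζ R G η : ℝ} {K N : ℕ} (hΩ : 0 < Ω) (hL : 1 ≤ L) (hx : 1 ≤ x)
    (hLx : 3 * x ^ 2 ≤ Real.exp L) (hη : 1 ≤ x ^ η) (hKη : x ^ η ≤ K) (hK : K ≤ 2 * x ^ η)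
    (hN : (N : ℝ) ≤ Real.exp L + 1) (hζ0 : 0 ≤ ζ) (hζ : ζ ≤ x) (hR : R ≤ N * x) (hR0 : 0 ≤ R)
    (hexp : 16 * (Ω + 2) * ((x ^ η) ^ 2 * L) ≤ x / 2) (hGx : Real.exp (-(x / 8)) ≤ G) :
    (2 * K + 1) * ((1 + ζ * R) ^ (2 * K)
        * (2 * (Real.exp L) ^ (Ω * (2 * K : ℝ) ^ 2) / Real.exp x)) ≤ 2 * G := by
  have hK1 : (1 : ℝ) ≤ K := hη.trans hKη
  have hE : 1 ≤ Real.exp L := Real.one_le_exp (by linarith)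
  have h1 : 1 + ζ * R ≤ Real.exp (2 * L) := by
    calc 1 + ζ * R ≤ 1 + x * ((Real.exp L + 1) * x) := by
          gcongr
          exact hR.trans (by gcongr)
      _ ≤ 3 * x ^ 2 * Real.exp L := by nlinarith
      _ ≤ Real.exp L * Real.exp L := by gcongr
      _ = _ := by rw [← Real.exp_add]; ring_nf
  have h2 : (2 * K + 1 : ℝ) ≤ Real.exp (2 * K) := Real.add_one_le_exp _
  calc _ ≤ Real.exp (2 * K) * ((Real.exp (2 * L)) ^ (2 * K)
        * (2 * (Real.exp L) ^ (Ω * (2 * K : ℝ) ^ 2) / Real.exp x)) := by gcongr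
    _ = 2 * Real.exp (2 * K + 4 * (L * K) + 4 * (Ω * (K ^ 2 * L)) - x) := by
        rw [← Real.exp_nat_mul, ← Real.exp_mul, Real.exp_sub, Real.exp_add, Real.exp_add]
        push_cast
        ring_nf
    _ ≤ 2 * Real.exp (-(x / 8)) := by
        gcongr
        -- All terms of the exponent are absorbed in K²L: 2K + 4LK + 4ΩK²L ≤ 4(Ω+2)K²L ≤
        -- 16(Ω+2)x^(2η)L ≤ x/2.
        have k1 : (K : ℝ) ≤ K ^ 2 * L := by nlinarith
        have k2 : L * K ≤ K ^ 2 * L := by nlinarith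
        have k3 : (K : ℝ) ^ 2 * L ≤ 4 * ((x ^ η) ^ 2 * L) := by
          calc (K : ℝ) ^ 2 * L ≤ (2 * x ^ η) ^ 2 * L := by gcongr
            _ = _ := by ring
        have k4 : (Ω + 2) * (K ^ 2 * L) ≤ (Ω + 2) * (4 * ((x ^ η) ^ 2 * L)) := by gcongr
        nlinarith
    _ ≤ 2 * G := by gcongr

end Estimates


/-! ### Thresholds on log T -/

section Parameters

/-- The lower bounds on `x = log T` in terms of `α`, `θ`, `δ` that the final estimate needs. -/
structure LargeParameter (Ω X₀ a θ δ x : ℝ) : Prop where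
  one_le : 1 ≤ x
  rpow_delta_le : 2 * x ^ δ ≤ x
  pow_mul_exp_le : x ^ 4 * Real.exp (-(1 / 2) * x ^ (θ / 2)) ≤ 1
  rpow_half_le : 1 / 2 * x ^ (θ / 2) ≤ x / 8
  sq_le_exp : x ^ 2 ≤ Real.exp (x / 8)
  sq_le_exp_rpow : 3 * x ^ 2 ≤ Real.exp (x ^ (3 * θ / 2))
  exponent_le : 16 * (Ω + 2) * ((x ^ (2 * δ + 9 * θ / 8)) ^ 2 * x ^ (3 * θ / 2)) ≤ x / 2
  variance_le : 24 * ((x ^ δ) ^ 2 * x ^ θ) ≤ x ^ (2 * δ + 9 * θ / 8)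
  exp_rpow_le : Real.exp (x ^ (3 * θ / 2)) + 1 ≤ Real.exp x
  le_exp_rpow : X₀ ≤ Real.exp (x ^ (3 * θ / 2))
  le_log_log : a ≤ Real.log (Real.log x)
  log_le : Real.log x ≤ x ^ θ

theorem eventually_const_mul_rpow_le {p q c d : ℝ} (hpq : p < q) (hd : 0 < d) :
    ∀ᶠ x : ℝ in atTop, c * x ^ p ≤ d * x ^ q := by
  have h := (tendsto_rpow_atTop (sub_pos.2 hpq)).eventually_ge_atTop (c / d)
  filter_upwards [h, eventually_gt_atTop 0] with x hx hx0
  rw [div_le_iff₀' hd] at hx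
  calc c * x ^ p ≤ d * x ^ (q - p) * x ^ p := by gcongr
    _ = d * x ^ q := by rw [mul_assoc, ← Real.rpow_add hx0]; ring_nf

theorem eventually_const_mul_pow_le_exp_rpow {p b : ℝ} (hp : 0 < p) (hb : 0 < b) (c : ℝ) (m : ℕ) :
    ∀ᶠ x : ℝ in atTop, c * x ^ m ≤ Real.exp (b * x ^ p) := by
  have h := (((isLittleO_rpow_exp_pos_mul_atTop (m / p) hb).bound
    (c := (|c| + 1)⁻¹) (by positivity))).filter_mono le_rfl
  have h' := (tendsto_rpow_atTop hp).eventually h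
  filter_upwards [h', eventually_gt_atTop 0] with x hx hx0
  rw [← Real.rpow_mul hx0.le, mul_div_cancel₀ _ hp.ne', Real.rpow_natCast,
    Real.norm_of_nonneg (by positivity), Real.norm_of_nonneg (by positivity),
    inv_mul_eq_div, le_div_iff₀' (by positivity)] at hx
  refine le_trans ?_ hx
  gcongr
  linarith [le_abs_self c]

theorem eventually_largeParameter (Ω X₀ a : ℝ) {θ δ : ℝ} (hθ : 0 < θ) (hδ : 0 < δ)
    (hθδ : θ + δ < 1 / 4) : ∀ᶠ x in atTop, LargeParameter Ω X₀ a θ δ x := by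
  have hL : Tendsto (fun x : ℝ => x ^ (3 * θ / 2)) atTop atTop := tendsto_rpow_atTop (by linarith)
  have hexp := (Real.tendsto_exp_atTop.comp hL).eventually_ge_atTop X₀
  have hll := (Real.tendsto_log_atTop.comp Real.tendsto_log_atTop).eventually_ge_atTop a
  have hlog := (isLittleO_log_rpow_atTop hθ).bound (c := 1) one_pos
  filter_upwards [eventually_ge_atTop 2,
    eventually_const_mul_rpow_le (p := δ) (q := 1) (c := 2) (d := 1) (by linarith) one_pos,
    eventually_const_mul_pow_le_exp_rpow (p := θ / 2) (b := 1 / 2) (by linarith) (by norm_num) 1 4,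
    eventually_const_mul_rpow_le (p := θ / 2) (q := 1) (c := 1 / 2) (d := 1 / 8) (by linarith)
      (by norm_num),
    eventually_const_mul_pow_le_exp_rpow (p := 1) (b := 1 / 8) one_pos (by norm_num) 1 2,
    eventually_const_mul_pow_le_exp_rpow (p := 3 * θ / 2) (b := 1) (by linarith) one_pos 3 2,
    -- The decisive use of θ + δ < 1/4: the exponent is 4δ + 15θ/4 < 4(θ + δ) < 1.
    eventually_const_mul_rpow_le (p := 2 * (2 * δ + 9 * θ / 8) + 3 * θ / 2) (q := 1)
      (c := 16 * (Ω + 2)) (d := 1 / 2) (by linarith) (by norm_num),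
    -- The extra θ/8 in the exponent of K is there to beat the constant 24.
    eventually_const_mul_rpow_le (p := 2 * δ + θ) (q := 2 * δ + 9 * θ / 8) (c := 24) (d := 1)
      (by linarith) one_pos,
    eventually_const_mul_rpow_le (p := 3 * θ / 2) (q := 1) (c := 1) (d := 1 / 2) (by linarith)
      (by norm_num), hexp, hll, hlog] with x h1 h2 h3 h4 h5 h6 h7 h8 h9 h10 h11 h12
  have hx0 : 0 < x := by linarith
  rw [Real.rpow_one] at h2 h4 h5 h7 h9
  have hsq (p : ℝ) : (x ^ p) ^ 2 = x ^ (2 * p) := by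
    rw [← Real.rpow_natCast, ← Real.rpow_mul hx0.le]; ring_nf
  refine ⟨by linarith, by linarith, ?_, by linarith, ?_, by simpa using h6, ?_, ?_, ?_, h10, h11, ?_⟩
  · rw [neg_mul, Real.exp_neg, mul_inv_le_iff₀ (Real.exp_pos _)]
    linarith
  · rw [one_mul] at h5
    rwa [div_eq_inv_mul, ← one_div]
  · rw [hsq, ← Real.rpow_add hx0]
    linarith
  · rw [hsq, ← Real.rpow_add hx0]
    linarith
  · have e1 : Real.exp (x ^ (3 * θ / 2)) ≤ Real.exp (x / 2) := Real.exp_le_exp.2 (by linarith)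
    have e2 : Real.exp x = Real.exp (x / 2) * Real.exp (x / 2) := by
      rw [← Real.exp_add]; ring_nf
    have e3 : 2 ≤ Real.exp (x / 2) := by linarith [Real.add_one_le_exp (x / 2)]
    nlinarith
  · rw [Real.norm_of_nonneg (Real.log_nonneg (by linarith)),
      Real.norm_of_nonneg (by positivity), one_mul] at h12
    exact h12

theorem eventually_log_log_rpow_le (p : ℝ) :
    ∀ᶠ x : ℝ in atTop, Real.log (Real.log x) ^ p ≤ Real.log x := by
  have h1 := (isLittleO_rpow_exp_atTop p).bound (c := 1) one_pos
  have ht := Real.tendsto_log_atTop.comp Real.tendsto_log_atTop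
  filter_upwards [ht.eventually h1, Real.tendsto_log_atTop.eventually_gt_atTop 1] with x hx hx1
  simp only [Function.comp_apply] at hx
  rw [Real.exp_log (by linarith), Real.norm_of_nonneg (Real.rpow_nonneg (Real.log_nonneg hx1.le) _),
    Real.norm_of_nonneg (by linarith), one_mul] at hx
  exact hx

end Parameters

/-! ### Choice of parameters and uniformity of the constants -/

section Final

theorem exp_one_sq_le : Real.exp 1 ^ 2 ≤ 8 := by
  calc Real.exp 1 ^ 2 ≤ 2.8 ^ 2 := by gcongr; linarith [Real.exp_one_lt_d9]
    _ ≤ 8 := by norm_num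

theorem norm_besselProduct_le_one {σ α : ℝ} (hα : 0 < α) (hσ : 1 / 2 < σ) (z : ℂ) :
    ‖besselProduct σ α z‖ ≤ 1 := by
  refine le_of_tendsto (hasProd_besselProduct hα hσ z).tendsto_prod_nat.norm
    (Eventually.of_forall fun N => ?_)
  rw [norm_prod]
  exact Finset.prod_le_one (fun _ _ => norm_nonneg _) fun _ _ => norm_besselJ0_le_one _

/-- The trivial bound, for those T that lie below a threshold depending on λ and σ₁. -/
theorem norm_mean_sub_fourierM_le_two (lam : ℝ) {α σ T : ℝ} (hα : 0 < α)
    (hσ : 1 / 2 < σ) (hT : 0 < T) (z : ℂ) :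
    ‖((1 / T : ℝ) : ℂ) * (∫ t in (0 : ℝ)..T,
      psi z (lerchZeta lam α ((σ : ℂ) + (t : ℂ) * Complex.I))) - fourierM σ α z‖ ≤ 2 := by
  have := isProbabilityMeasure_timeMeasure hT
  rw [← integral_timeMeasure hT, fourierM_eq_besselProduct hα hσ]
  refine (norm_sub_le _ _).trans ?_
  have h1 : ‖∫ t : ℝ, psi z (lerchZeta lam α ((σ : ℂ) + (t : ℂ) * Complex.I)) ∂(timeMeasure T)‖
      ≤ 1 := by
    have := norm_integral_le_of_norm_le_const (μ := timeMeasure T) (C := 1)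
      (f := fun t : ℝ => psi z (lerchZeta lam α ((σ : ℂ) + (t : ℂ) * Complex.I)))
      (Eventually.of_forall fun t => (norm_psi _ _).le)
    simpa using this
  linarith [norm_besselProduct_le_one hα hσ z]

set_option maxHeartbeats 800000 in
/-- The mean value estimate with an absolute constant, for `log T` large. -/
theorem norm_mean_sub_fourierM_le {lam σ₁ A : ℝ}
    (hA : ∀ α σ T t : ℝ, 0 < α → α ≤ 1 → 1 / 2 < σ → σ ≤ σ₁ → 1 ≤ t → t ≤ T →
      ∀ M : ℕ, A * T ≤ M →
      ‖lerchZeta lam α ((σ : ℂ) + (t : ℂ) * Complex.I)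
        - ∑ n ∈ Finset.range M, lerchTerm lam α ((σ : ℂ) + (t : ℂ) * Complex.I) n‖
      ≤ A * (M : ℝ) ^ (-(1 / 2) : ℝ) + 2 * (M : ℝ) ^ (1 / 2 : ℝ) / t) (hA1 : 1 ≤ A)
    {α : ℝ} (hα : Admissible α) {Ω X₀ : ℝ} (hΩ : 0 < Ω) (hsp : ∀ X : ℝ, X₀ ≤ X →
      ∀ (N : ℕ) (n : Fin N → ℕ) (ε : Fin N → ℝ),
      (∀ j, (n j : ℝ) ≤ X) → (∀ j, ε j = 1 ∨ ε j = -1) →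
      ∑ j, ε j * Real.log ((n j : ℝ) + α) ≠ 0 →
      X ^ (-(Ω * (N : ℝ) ^ 2)) ≤ |∑ j, ε j * Real.log ((n j : ℝ) + α)|)
    {θ δ x : ℝ} (hθ : 0 < θ) (hδ : 0 < δ) (hθδ : θ + δ < 1 / 4)
    (hx : LargeParameter Ω X₀ α⁻¹ θ δ x) (hAx : 4 * A ≤ x)
    (hσx : Real.log (Real.log x) ^ (2 * σ₁) ≤ Real.log x) {σ : ℝ}
    (hσ : 1 / 2 + x ^ (-θ) ≤ σ) (hσ1 : σ ≤ σ₁) {z : ℂ} (hre : |z.re| ≤ x ^ δ)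
    (him : |z.im| ≤ x ^ δ) :
    ‖((1 / Real.exp x : ℝ) : ℂ) * (∫ t in (0 : ℝ)..Real.exp x,
      psi z (lerchZeta lam α ((σ : ℂ) + (t : ℂ) * Complex.I))) - fourierM σ α z‖
      ≤ 120 * Real.exp (-(1 / 2) * x ^ (θ / 2)) := by
  have hx1 := hx.one_le
  have hx0 : 0 < x := by linarith
  have hxθ0 : 0 < x ^ (-θ) := by positivity
  have hσ2 : 1 / 2 < σ := by linarith
  set G := Real.exp (-(1 / 2) * x ^ (θ / 2)) with hG
  -- With N at least e^L and σ - 1/2 ≥ x^(-θ), N^(1/2-σ) ≤ exp(-x^(θ/2)) = G².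
  set L := x ^ (3 * θ / 2) with hLdef
  set η := 2 * δ + 9 * θ / 8 with hη
  -- Floor plus one: N ≥ e^L gives the saving, while all indices n < N stay at most e^L, where the
  -- spacing condition is applied.
  set N := ⌊Real.exp L⌋₊ + 1 with hNdef
  set K := ⌈x ^ η⌉₊ with hKdef
  have hG0 : 0 < G := Real.exp_pos _
  have hL1 : 1 ≤ L := Real.one_le_rpow hx1 (by linarith)
  have hη1 : 1 ≤ x ^ η := Real.one_le_rpow hx1 (by linarith)
  have hxθ : 1 ≤ x ^ θ := Real.one_le_rpow hx1 hθ.le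
  have hxθ' : x ^ θ ≤ x := by
    simpa using Real.rpow_le_rpow_of_exponent_le hx1 (by linarith : θ ≤ 1)
  have hN1 : 1 ≤ N := by omega
  have hNl : Real.exp L ≤ N := by
    rw [hNdef]; push_cast; exact (Nat.lt_floor_add_one _).le
  have hNu : (N : ℝ) ≤ Real.exp L + 1 := by
    rw [hNdef]; push_cast; linarith [Nat.floor_le (Real.exp_pos L).le]
  have hKl : x ^ η ≤ K := Nat.le_ceil _
  have hKu : (K : ℝ) ≤ 2 * x ^ η := by
    linarith [Nat.ceil_lt_add_one (by linarith : 0 ≤ x ^ η)]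
  have hG1 : G ≤ 1 := Real.exp_le_one_iff.2 (by
    have : 0 ≤ x ^ (θ / 2) := by positivity
    linarith)
  have hGx : Real.exp (-(x / 8)) ≤ G := Real.exp_le_exp.2 (by linarith [hx.rpow_half_le])
  have hz2 : ‖z‖ ≤ 2 * x ^ δ := (Complex.norm_le_abs_re_add_abs_im z).trans (by linarith)
  have hz : ‖z‖ ≤ x := hz2.trans hx.rpow_delta_le
  -- powers of the truncation point
  have hNσ : (N : ℝ) ^ (1 / 2 - σ) ≤ G ^ 2 := by
    calc (N : ℝ) ^ (1 / 2 - σ) ≤ (Real.exp L) ^ (1 / 2 - σ) :=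
          Real.rpow_le_rpow_of_nonpos (Real.exp_pos _) hNl (by linarith)
      _ = Real.exp (L * (1 / 2 - σ)) := by rw [← Real.exp_mul]
      _ ≤ Real.exp (L * (-x ^ (-θ))) := by gcongr; linarith
      _ = G ^ 2 := by
          rw [hG, ← Real.exp_nat_mul, mul_neg, hLdef, ← Real.rpow_add hx0]
          congr 1
          push_cast
          ring_nf
  have hNσ2 : (N : ℝ) ^ (1 - 2 * σ) ≤ G ^ 2 := by
    have : (N : ℝ) ^ (1 - 2 * σ) = (N : ℝ) ^ (1 / 2 - σ) * (N : ℝ) ^ (1 / 2 - σ) := by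
      rw [← Real.rpow_add (by positivity)]; ring_nf
    rw [this]
    have h0 : 0 ≤ (N : ℝ) ^ (1 / 2 - σ) := by positivity
    have h1 : G ^ 2 ≤ 1 := pow_le_one₀ hG0.le hG1
    nlinarith
  have hinv : 1 / (2 * σ - 1) ≤ x ^ θ := by
    rw [div_le_iff₀ (by linarith)]
    have : x ^ θ * x ^ (-θ) = 1 := by rw [← Real.rpow_add hx0]; simp
    nlinarith
  -- the size of the coefficients
  have hα2 : α ^ (-(2 * σ)) ≤ x ^ θ :=
    ((inv_rpow_le hα.pos hα.le_one (by linarith) (by linarith) hx.le_log_log).trans hσx).trans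
      hx.log_le
  have hα1 : α ^ (-σ) ≤ x :=
    ((Real.rpow_le_rpow_of_exponent_ge hα.pos hα.le_one (by linarith)).trans hα2).trans hxθ'
  set S₁ := ∑ n ∈ Finset.range N, ((n : ℝ) + α) ^ (-σ) with hS₁
  set S₂ := ∑ n ∈ Finset.range N, (((n : ℝ) + α) ^ (-σ)) ^ 2 with hS₂
  have hα0 := hα.pos
  have hS₁0 : 0 ≤ S₁ := Finset.sum_nonneg fun n _ => by positivity
  have hS₁N : S₁ ≤ N * x := (sum_rpow_le hα.pos (by linarith) N).trans (by gcongr)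
  have hS₂x : S₂ ≤ 3 * x ^ θ := by
    linarith [sum_sq_rpow_le hα.pos hσ2 hN1]
  -- the three parts of the error
  have hNM : N ≤ ⌈A * Real.exp x⌉₊ := by
    have h1 : (N : ℝ) ≤ ⌈A * Real.exp x⌉₊ := by
      have h2 : Real.exp x ≤ A * Real.exp x := le_mul_of_one_le_left (Real.exp_pos _).le hA1
      linarith [hx.exp_rpow_le, Nat.le_ceil (A * Real.exp x)]
    exact_mod_cast h1
  -- The cut t₀ = T^(3/4), with M of order T, balances t₀/T against M^(1/2)/t₀, both about T^(-1/4).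
  have E₁ := (norm_mean_psi_lerchZeta_sub_le hA hA1 hα.pos hα.le_one hσ2 hσ1
    (t₀ := Real.exp (3 * x / 4)) (T := Real.exp x) (Real.one_le_exp (by linarith))
    (Real.exp_le_exp.2 (by linarith)) hN1 hNM (Nat.le_ceil _) z).trans
    (truncation_error_le hA1 hAx hz hG0 hGx hx.sq_le_exp hx.pow_mul_exp_le hNσ)
  -- Scale y = e in the Chernoff bound: once e² times the variance over 4 is at most K, y^(-2K)·e^K
  -- = e^(-K) remains.
  have E₂ := norm_mean_psi_sum_sub_prod_le hα hΩ (Real.one_le_exp (by linarith : 0 ≤ L))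
    (hsp _ hx.le_exp_rpow) (Real.exp_pos x) lam σ hNu K (Real.exp_pos 1) z
  have E₂' := moment_error_le hΩ hL1 hx1 hx.sq_le_exp_rpow hη1 hKl hKu hNu (norm_nonneg z) hz
    hS₁N hS₁0 hx.exponent_le hGx
  have E₃ := norm_besselProduct_sub_prod_le hα.pos hσ2 hN1 z
  have hV : Real.exp 1 ^ 2 * (‖z‖ ^ 2 * S₂) / 4 ≤ K := by
    have he := exp_one_sq_le
    have hv : ‖z‖ ^ 2 * S₂ ≤ (2 * x ^ δ) ^ 2 * (3 * x ^ θ) := by gcongr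
    have h0 : 0 ≤ ‖z‖ ^ 2 * S₂ :=
      mul_nonneg (by positivity) (Finset.sum_nonneg fun n _ => by positivity)
    have h1 : Real.exp 1 ^ 2 * (‖z‖ ^ 2 * S₂) ≤ 8 * ((2 * x ^ δ) ^ 2 * (3 * x ^ θ)) := by gcongr
    have h2 := hx.variance_le
    linarith
  have E₂'' : 2 * (2 * (Real.exp 1 ^ (2 * K))⁻¹ * Real.exp
      (Real.exp 1 ^ 2 * (‖z‖ ^ 2 * S₂) / 4)) ≤ 4 * G := by
    calc _ ≤ 2 * (2 * (Real.exp 1 ^ (2 * K))⁻¹ * Real.exp K) := by gcongr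
      _ = 4 * Real.exp (-(K : ℝ)) := by
          rw [← Real.exp_nat_mul, ← Real.exp_neg, mul_assoc, ← Real.exp_add]
          push_cast; ring_nf
      _ ≤ 4 * G := by
          rw [hG]
          gcongr
          have h1 : x ^ (θ / 2) ≤ x ^ η :=
            Real.rpow_le_rpow_of_exponent_le hx1 (by linarith)
          have h2 : 0 ≤ x ^ (θ / 2) := by positivity
          linarith
  have E₃' : ‖z‖ ^ 2 * ((N : ℝ) ^ (1 - 2 * σ) * (1 + 1 / (2 * σ - 1))) ≤ 2 * G := by
    have hσ3 : 0 < 2 * σ - 1 := by linarith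
    have hinv' : 1 / (2 * σ - 1) ≤ x := hinv.trans hxθ'
    calc _ ≤ x ^ 2 * (G ^ 2 * (x + x)) := by gcongr
      _ = 2 * (x ^ 3 * G) * G := by ring
      _ ≤ 2 * 1 * G := by
          gcongr
          refine le_trans ?_ hx.pow_mul_exp_le
          gcongr
          norm_num
      _ = 2 * G := by ring
  rw [fourierM_eq_besselProduct hα.pos hσ2]
  rw [norm_sub_rev] at E₃
  refine (norm_sub_le_norm_sub_add_norm_sub _ _ _).trans
    ((add_le_add E₁ ((norm_sub_le_norm_sub_add_norm_sub _ _ _).trans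
      (add_le_add (E₂.trans (add_le_add E₂' E₂'')) (E₃.trans E₃')))).trans ?_)
  -- The total is 110 + (2 + 4) + 2 = 118 times G.
  linarith

/-- The hypotheses stand inside the conclusion so that T₀ can be chosen as a total function of α, θ,
δ, with the value 1 where they fail. Neither λ nor σ₁ enters. -/
theorem exists_parameter_threshold (α θ δ : ℝ) : ∃ T₀ : ℝ, 0 < T₀ ∧
    (Admissible α → 0 < θ → 0 < δ → θ + δ < 1 / 4 → ∃ Ω X₀ : ℝ, 0 < Ω ∧
      (∀ X : ℝ, X₀ ≤ X → ∀ (N : ℕ) (n : Fin N → ℕ) (ε : Fin N → ℝ),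
        (∀ j, (n j : ℝ) ≤ X) → (∀ j, ε j = 1 ∨ ε j = -1) →
        ∑ j, ε j * Real.log ((n j : ℝ) + α) ≠ 0 →
        X ^ (-(Ω * (N : ℝ) ^ 2)) ≤ |∑ j, ε j * Real.log ((n j : ℝ) + α)|) ∧
      ∀ T : ℝ, T₀ ≤ T → LargeParameter Ω X₀ α⁻¹ θ δ (Real.log T)) := by
  by_cases h : Admissible α ∧ 0 < θ ∧ 0 < δ ∧ θ + δ < 1 / 4
  · obtain ⟨hα, hθ, hδ, hθδ⟩ := h
    obtain ⟨Ω, hΩ, X₀, hsp⟩ := hα.spacing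
    obtain ⟨T₀, hT₀⟩ := eventually_atTop.1 ((Real.tendsto_log_atTop.eventually
      (eventually_largeParameter Ω X₀ α⁻¹ hθ hδ hθδ)).and (eventually_gt_atTop 0))
    exact ⟨T₀, (hT₀ T₀ le_rfl).2, fun _ _ _ _ => ⟨Ω, X₀, hΩ, hsp, fun T hT => (hT₀ T hT).1⟩⟩
  · exact ⟨1, one_pos, fun h1 h2 h3 h4 => absurd ⟨h1, h2, h3, h4⟩ h⟩

/-- The main estimate also needs log T ≥ x₂ with x₂ depending on λ and σ₁, which T₀ may not see. If
1 ≤ log T ≤ x₂, then (log T)^(θ/2) ≤ x₂, and the trivial bound 2 is at most 2 exp(x₂/2) times the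
claimed error; so this condition goes into the constant. -/
theorem exists_uniform_constant (lam σ₁ : ℝ) : ∃ C : ℝ, ∀ α θ δ Ω X₀ T σ : ℝ, ∀ z : ℂ,
    Admissible α → 0 < θ → 0 < δ → θ + δ < 1 / 4 → 0 < Ω →
    (∀ X : ℝ, X₀ ≤ X → ∀ (N : ℕ) (n : Fin N → ℕ) (ε : Fin N → ℝ),
        (∀ j, (n j : ℝ) ≤ X) → (∀ j, ε j = 1 ∨ ε j = -1) →
        ∑ j, ε j * Real.log ((n j : ℝ) + α) ≠ 0 →
        X ^ (-(Ω * (N : ℝ) ^ 2)) ≤ |∑ j, ε j * Real.log ((n j : ℝ) + α)|) →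
    0 < T → LargeParameter Ω X₀ α⁻¹ θ δ (Real.log T) →
    1 / 2 + (Real.log T) ^ (-θ) ≤ σ → σ ≤ σ₁ →
    |z.re| ≤ (Real.log T) ^ δ → |z.im| ≤ (Real.log T) ^ δ →
    ‖((1 / T : ℝ) : ℂ) * (∫ t in (0 : ℝ)..T,
      psi z (lerchZeta lam α ((σ : ℂ) + (t : ℂ) * Complex.I))) - fourierM σ α z‖
      ≤ C * Real.exp (-(1 / 2) * (Real.log T) ^ (θ / 2)) := by
  obtain ⟨A, hA1, hA⟩ := exists_norm_lerchZeta_sub_sum_le lam σ₁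
  obtain ⟨x₂, hx₂⟩ := eventually_atTop.1
    ((eventually_ge_atTop (4 * A)).and (eventually_log_log_rpow_le (2 * σ₁)))
  refine ⟨120 + 2 * Real.exp (1 / 2 * x₂), ?_⟩
  intro α θ δ Ω X₀ T σ z hα hθ hδ hθδ hΩ hsp hT hx hσ hσ1 hre him
  have hx1 := hx.one_le
  rw [add_mul]
  rcases le_total x₂ (Real.log T) with h | h
  · have hb := norm_mean_sub_fourierM_le hA hA1 hα hΩ hsp hθ hδ hθδ hx (hx₂ _ h).1 (hx₂ _ h).2 hσ
      hσ1 hre him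
    rw [Real.exp_log hT] at hb
    refine hb.trans (le_add_of_nonneg_right (by positivity))
  · have hσ2 : 1 / 2 < σ := by
      have : 0 < (Real.log T) ^ (-θ) := Real.rpow_pos_of_pos (by linarith) _
      linarith
    refine (norm_mean_sub_fourierM_le_two lam hα.pos hσ2 hT z).trans ?_
    refine le_add_of_nonneg_of_le (by positivity) ?_
    rw [mul_assoc, ← Real.exp_add]
    have h1 : (Real.log T) ^ (θ / 2) ≤ Real.log T := by
      simpa using Real.rpow_le_rpow_of_exponent_le hx1 (by linarith : θ / 2 ≤ 1)
    have h2 : 1 ≤ Real.exp (1 / 2 * x₂ + -(1 / 2) * (Real.log T) ^ (θ / 2)) :=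
      Real.one_le_exp (by linarith)
    linarith

end Final

end LerchDensity

/-- The first conjunct says that `M_σ(·; α)` is the density of the infinite convolution and that its
Fourier transform is the product of Bessel functions. In the second one the implied constant `C`
depends only on `lam` and `σ₁`, and `T₀` depends only on `α`, `θ` and `δ`. -/
theorem mainTheorem4 :
    (∀ α σ : ℝ, 0 < α → α ≤ 1 → 1 / 2 < σ →
      LerchDensity.IsLimitDensity σ α (LerchDensity.densityM σ α) ∧
      ∀ z : ℂ, HasProd
        (fun n : ℕ => (LerchDensity.besselJ0 (‖z‖ * ((n : ℝ) + α) ^ (-σ)) : ℂ))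
        (LerchDensity.fourierM σ α z)) ∧
    ∃ (C : ℝ → ℝ → ℝ) (T₀ : ℝ → ℝ → ℝ → ℝ),
      ∀ lam α σ₁ θ δ : ℝ, LerchDensity.Admissible α → 0 < σ₁ → 0 < θ → 0 < δ → θ + δ < 1 / 4 →
        0 < T₀ α θ δ ∧
        ∀ T : ℝ, T₀ α θ δ ≤ T →
        ∀ σ : ℝ, 1 / 2 + (Real.log T) ^ (-θ) ≤ σ → σ ≤ σ₁ →
        ∀ z : ℂ, |z.re| ≤ (Real.log T) ^ δ → |z.im| ≤ (Real.log T) ^ δ →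
          ‖((1 / T : ℝ) : ℂ) * (∫ t in (0 : ℝ)..T,
              LerchDensity.psi z
                (LerchDensity.lerchZeta lam α ((σ : ℂ) + (t : ℂ) * Complex.I)))
            - LerchDensity.fourierM σ α z‖
          ≤ C lam σ₁ * Real.exp (-(1 / 2) * (Real.log T) ^ (θ / 2)) := by

  refine ⟨fun α σ hα _ hσ => ⟨LerchDensity.isLimitDensity_densityM hα hσ, fun z => ?_⟩, ?_⟩
  · rw [LerchDensity.fourierM_eq_besselProduct hα hσ]
    exact LerchDensity.hasProd_besselProduct hα hσ z
  choose C hC using LerchDensity.exists_uniform_constant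
  choose T₀ hT₀ hpar using LerchDensity.exists_parameter_threshold
  refine ⟨C, T₀, fun lam α σ₁ θ δ hα _ hθ hδ hθδ => ⟨hT₀ α θ δ, ?_⟩⟩
  intro T hT σ hσ hσ1 z hre him
  obtain ⟨Ω, X₀, hΩ, hsp, hlarge⟩ := hpar α θ δ hα hθ hδ hθδ
  exact hC lam σ₁ α θ δ Ω X₀ T σ z hα hθ hδ hθδ hΩ hsp ((hT₀ α θ δ).trans_le hT) (hlarge T hT) hσ
    hσ1 hre him
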